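/- Work over $\mathbb{C}$. Let $\sigma\in\mathbb{C}[X_0,X_1]$ be a non-zero homogeneous form of degree $6$, regarded as a global section of $\mathcal{O}_{\mathbb{P}^1}(6)$, with $6$ distinct zeros in $\mathbb{P}^1$. For $n\ge 0$ let $\mathbb{P}_n=\mathbb{P}(\mathcal{O}_{\mathbb{P}^1}\oplus\mathcal{O}_{\mathbb{P}^1}(n))$ be the rational ruled surface over $\mathbb{P}^1$; over the chart $X_0\neq 0$ with coordinate $x=X_1/X_0$ it has homogeneous fibre coordinates $(y_1:y_2)$, and $u=y_2/y_1$ transforms like a section of $\mathcal{O}(n)$. On $\mathbb{P}_6$ let $E_0=\{u=0\}$ and $E_\sigma=\{u=\sigma(1,x)\}$ be the sections defined by $0$ and $\sigma$. Let $\mu:\mathbb{P}_1\to\mathbb{P}_6$ be the degree $6$ covering over $\mathbb{P}^1$ given in these coordinates by $(y_1:y_2)\mapsto(y_1^6:y_2^6)$. Let $\mathcal{Y}\to\mathbb{P}_1$ be the Kummer covering of degree $2$ given by the square root of a rational function with divisor $\mu^*E_\sigma-\mu^*E_0$, that is, the normalization of $\mathbb{P}_1$ in $\mathbb{C}(x,u)\bigl(\sqrt{(u^6-\sigma(1,x))/u^6}\bigr)$.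 Let $C$ be the smooth projective curve $y^6=\sigma(X_0,X_1)$, a cyclic covering of $\mathbb{P}^1$ of degree $6$ branched exactly over the six zeros of $\sigma$, and let $C'$ be the smooth projective curve with affine equation $y^6=x(x-1)$. Fix a primitive sixth root of unity $\xi$, let $\gamma$ and $\gamma'$ be the automorphisms $(x,y)\mapsto(x,\xi y)$ of $C$ and of $C'$, and let $C\times C'/\langle(1,1)\rangle$ denote the quotient of $C\times C'$ by the group generated by $(\gamma,\gamma')$. Then $\mathcal{Y}$ is birationally equivalent over $\mathbb{C}$ to $C\times C'/\langle(1,1)\rangle$. Moreover, $\mathcal{Y}$ is birationally equivalent over $\mathbb{C}$ to the double covering of $\mathbb{P}^2$ branched along the sextic curve $C=\{Y^6=\sigma(X_0,X_1)\}\subset\mathbb{P}^2$. -/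

import Mathlib

open CategoryTheory CategoryTheory.Limits AlgebraicGeometry

noncomputable section

namespace KummerSurface

/-! ### Gluing affine charts inside a common function field -/

section Loc

variable {K : Type} [Field K] [Algebra ℂ K]

/-- `B = A[1/f]` inside `K`, for `A ≤ B ⊆ K` and `0 ≠ f ∈ A`. -/
structure IsLocAt (f : K) (A B : Subalgebra ℂ K) : Prop where
  le : A ≤ B
  mem : f ∈ A
  ne_zero : f ≠ 0
  inv_mem : f⁻¹ ∈ B
  exists_pow : ∀ b ∈ B, ∃ n : ℕ, f ^ n * b ∈ A

/-- The elements of `K` that become elements of `A` after multiplication by a power of `f`. -/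
def denomAlg {f : K} {A : Subalgebra ℂ K} (hf : f ∈ A) : Subalgebra ℂ K where
  carrier := {b | ∃ n : ℕ, f ^ n * b ∈ A}
  mul_mem' := by
    rintro a b ⟨m, hm⟩ ⟨n, hn⟩
    refine ⟨m + n, ?_⟩
    have := A.mul_mem hm hn
    rwa [show f ^ (m + n) * (a * b) = f ^ m * a * (f ^ n * b) by ring]
  add_mem' := by
    rintro a b ⟨m, hm⟩ ⟨n, hn⟩
    refine ⟨m + n, ?_⟩
    have h1 := A.mul_mem (A.pow_mem hf n) hm
    have h2 := A.mul_mem (A.pow_mem hf m) hn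
    have := A.add_mem h1 h2
    rwa [show f ^ (m + n) * (a + b) = f ^ n * (f ^ m * a) + f ^ m * (f ^ n * b) by ring]
  algebraMap_mem' := fun r => ⟨0, by simp [A.algebraMap_mem r]⟩

lemma IsLocAt.refl (A : Subalgebra ℂ K) : IsLocAt 1 A A :=
  ⟨le_rfl, A.one_mem, one_ne_zero, by simp [A.one_mem], fun b hb => ⟨0, by simpa using hb⟩⟩

lemma IsLocAt.sup_right {f : K} {A B : Subalgebra ℂ K} (h : IsLocAt f A B)
    (D : Subalgebra ℂ K) : IsLocAt f (A ⊔ D) (B ⊔ D) := by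
  have hf : f ∈ A ⊔ D := (le_sup_left : A ≤ A ⊔ D) h.mem
  refine ⟨sup_le_sup_right h.le D, hf, h.ne_zero, (le_sup_left : B ≤ B ⊔ D) h.inv_mem, ?_⟩
  have : B ⊔ D ≤ denomAlg hf := by
    refine sup_le (fun b hb => ?_) (fun d hd => ⟨0, ?_⟩)
    · obtain ⟨n, hn⟩ := h.exists_pow b hb
      exact ⟨n, (le_sup_left : A ≤ A ⊔ D) hn⟩
    · simpa using (le_sup_right : D ≤ A ⊔ D) hd
  exact fun b hb => this hb

lemma IsLocAt.sup {f g : K} {A B C : Subalgebra ℂ K} (h : IsLocAt f A B) (h' : IsLocAt g A C) :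
    IsLocAt (f * g) A (B ⊔ C) := by
  have hfg : f * g ∈ A := A.mul_mem h.mem h'.mem
  refine ⟨h.le.trans le_sup_left, hfg, mul_ne_zero h.ne_zero h'.ne_zero, ?_, ?_⟩
  · rw [mul_inv]
    exact (B ⊔ C).mul_mem ((le_sup_left : B ≤ B ⊔ C) h.inv_mem)
      ((le_sup_right : C ≤ B ⊔ C) h'.inv_mem)
  · have : B ⊔ C ≤ denomAlg hfg := by
      refine sup_le (fun b hb => ?_) (fun c hc => ?_)
      · obtain ⟨n, hn⟩ := h.exists_pow b hb
        exact ⟨n, by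
          rw [show (f * g) ^ n * b = g ^ n * (f ^ n * b) by ring]
          exact A.mul_mem (A.pow_mem h'.mem n) hn⟩
      · obtain ⟨n, hn⟩ := h'.exists_pow c hc
        exact ⟨n, by
          rw [show (f * g) ^ n * c = f ^ n * (g ^ n * c) by ring]
          exact A.mul_mem (A.pow_mem h.mem n) hn⟩
    exact fun b hb => this hb

lemma isLocAt_adjoin {f : K} {S T : Set K} (hf : f ∈ Algebra.adjoin ℂ S) (h0 : f ≠ 0)
    (hinv : f⁻¹ ∈ Algebra.adjoin ℂ S ⊔ Algebra.adjoin ℂ T)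
    (hT : ∀ t ∈ T, ∃ n : ℕ, f ^ n * t ∈ Algebra.adjoin ℂ S) :
    IsLocAt f (Algebra.adjoin ℂ S) (Algebra.adjoin ℂ S ⊔ Algebra.adjoin ℂ T) := by
  refine ⟨le_sup_left, hf, h0, hinv, ?_⟩
  have : Algebra.adjoin ℂ S ⊔ Algebra.adjoin ℂ T ≤ denomAlg hf :=
    sup_le (fun b hb => ⟨0, by simpa using hb⟩) (Algebra.adjoin_le hT)
  exact fun b hb => this hb

lemma IsLocAt.isLocalization {f : K} {A B : Subalgebra ℂ K} (h : IsLocAt f A B) :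
    letI := (Subalgebra.inclusion h.le).toRingHom.toAlgebra
    IsLocalization.Away (⟨f, h.mem⟩ : A) B := by
  let := (Subalgebra.inclusion h.le).toRingHom.toAlgebra
  have hmap : ∀ a : A, ((algebraMap A B a : B) : K) = a := fun a => rfl
  refine ⟨?_, ?_, ?_⟩
  · rintro ⟨_, n, rfl⟩
    refine IsUnit.of_mul_eq_one (⟨f⁻¹ ^ n, B.pow_mem h.inv_mem n⟩ : B) (Subtype.ext ?_)
    simp only [MulMemClass.coe_mul, hmap, SubmonoidClass.coe_pow, OneMemClass.coe_one, map_pow]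
    rw [← mul_pow, mul_inv_cancel₀ h.ne_zero, one_pow]
  · intro z
    obtain ⟨n, hn⟩ := h.exists_pow z z.2
    refine ⟨⟨⟨_, hn⟩, ⟨_, n, rfl⟩⟩, Subtype.ext ?_⟩
    simp only [MulMemClass.coe_mul, hmap, SubmonoidClass.coe_pow, map_pow]
    ring
  · intro x y hxy
    refine ⟨1, ?_⟩
    have : (x : K) = y := by rw [← hmap x, ← hmap y, hxy]
    rw [Subtype.ext this]

lemma IsLocAt.comap_injective {f : K} {A B : Subalgebra ℂ K} (h : IsLocAt f A B) :
    Function.Injective (PrimeSpectrum.comap (Subalgebra.inclusion h.le).toRingHom) := by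
  let := (Subalgebra.inclusion h.le).toRingHom.toAlgebra
  have := h.isLocalization
  exact PrimeSpectrum.localization_comap_injective B (Submonoid.powers (⟨f, h.mem⟩ : A))

lemma IsLocAt.range_comap {f : K} {A B : Subalgebra ℂ K} (h : IsLocAt f A B) :
    Set.range (PrimeSpectrum.comap (Subalgebra.inclusion h.le).toRingHom) =
      PrimeSpectrum.basicOpen (⟨f, h.mem⟩ : A) := by
  let := (Subalgebra.inclusion h.le).toRingHom.toAlgebra
  have := h.isLocalization
  exact PrimeSpectrum.localization_away_comap_range B (⟨f, h.mem⟩ : A)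

lemma IsLocAt.exists_common {f g : K} {A B C D : Subalgebra ℂ K} (hB : IsLocAt f A B)
    (hC : IsLocAt g A C) (hD : IsLocAt (f * g) A D) (hBD : B ≤ D) (hCD : C ≤ D)
    (x : PrimeSpectrum B) (y : PrimeSpectrum C)
    (hxy : PrimeSpectrum.comap (Subalgebra.inclusion hB.le).toRingHom x =
      PrimeSpectrum.comap (Subalgebra.inclusion hC.le).toRingHom y) :
    ∃ z : PrimeSpectrum D, PrimeSpectrum.comap (Subalgebra.inclusion hBD).toRingHom z = x ∧
      PrimeSpectrum.comap (Subalgebra.inclusion hCD).toRingHom z = y := by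
  set p := PrimeSpectrum.comap (Subalgebra.inclusion hB.le).toRingHom x with hp
  have h1 : p ∈ (PrimeSpectrum.basicOpen (⟨f, hB.mem⟩ : A) : Set (PrimeSpectrum A)) :=
    hB.range_comap ▸ ⟨x, rfl⟩
  have h2 : p ∈ (PrimeSpectrum.basicOpen (⟨g, hC.mem⟩ : A) : Set (PrimeSpectrum A)) :=
    hC.range_comap ▸ ⟨y, hxy.symm⟩
  have h3 : p ∈ (PrimeSpectrum.basicOpen (⟨f * g, hD.mem⟩ : A) : Set (PrimeSpectrum A)) := by
    rw [show (⟨f * g, hD.mem⟩ : A) = ⟨f, hB.mem⟩ * ⟨g, hC.mem⟩ from rfl,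
      PrimeSpectrum.basicOpen_mul]
    exact ⟨h1, h2⟩
  rw [← hD.range_comap] at h3
  obtain ⟨z, hz⟩ := h3
  refine ⟨z, hB.comap_injective ?_, hC.comap_injective ?_⟩
  · rw [← hp, ← hz]; rfl
  · rw [← hxy, ← hz]; rfl

end Loc

/-- A finite family of affine charts `Spec (chart i)` with common function field `K` over `ℂ`,
such that the overlap of any two charts, `Spec` of the ring generated by both coordinate rings,
is a principal open subset of each. -/
structure Atlas (K : Type) [Field K] [Algebra ℂ K] (ι : Type) where
  chart : ι → Subalgebra ℂ K
  overlap : ∀ i j, ∃ f, IsLocAt f (chart i) (chart i ⊔ chart j)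

namespace Atlas

variable {K : Type} [Field K] [Algebra ℂ K] {ι : Type} (A : Atlas K ι)

/-- The coordinate ring of the intersection of the charts in `s`. -/
def ring (s : Finset ι) : Subalgebra ℂ K := s.sup A.chart

lemma ring_mono {s t : Finset ι} (h : s ≤ t) : A.ring s ≤ A.ring t := Finset.sup_mono h

lemma exists_isLocAt {s t : Finset ι} (hs : s.Nonempty) (h : s ≤ t) :
    ∃ f, IsLocAt f (A.ring s) (A.ring t) := by
  classical
  obtain ⟨i, hi⟩ := hs
  have key : ∀ t' : Finset ι, ∃ f, IsLocAt f (A.ring s) (A.ring s ⊔ A.ring t') := by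
    intro t'
    induction t' using Finset.induction_on with
    | empty => exact ⟨1, by simpa [ring] using IsLocAt.refl (A.ring s)⟩
    | insert j t' _ ih =>
      obtain ⟨f, hf⟩ := ih
      obtain ⟨g, hg⟩ := A.overlap i j
      have h1 := hg.sup_right (A.ring s)
      have hle : A.chart i ≤ A.ring s := Finset.le_sup hi
      rw [sup_eq_right.mpr hle, sup_right_comm, sup_eq_right.mpr hle] at h1
      have h2 := h1.sup hf
      refine ⟨g * f, ?_⟩
      rwa [show (A.ring s ⊔ A.chart j) ⊔ (A.ring s ⊔ A.ring t') =
        A.ring s ⊔ A.ring (insert j t') by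
          simp only [ring, Finset.sup_insert]
          exact (sup_sup_distrib_left _ _ _).symm] at h2
  obtain ⟨f, hf⟩ := key t
  exact ⟨f, by rwa [sup_eq_right.mpr (A.ring_mono h)] at hf⟩

/-- Nonempty finite sets of charts. -/
abbrev Index (ι : Type) : Type := {s : Finset ι // s.Nonempty}

/-- The diagram of coordinate rings of the finite intersections of charts. -/
def ringFunctor : Index ι ⥤ CommRingCat.{0} where
  obj s := .of (A.ring s.1)
  map {_ _} h := CommRingCat.ofHom (Subalgebra.inclusion (A.ring_mono h.le)).toRingHom
  map_id _ := rfl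
  map_comp _ _ := rfl

/-- The diagram of finite intersections of charts. -/
def functor : (Index ι)ᵒᵖ ⥤ Scheme.{0} := A.ringFunctor.op ⋙ Scheme.Spec

instance {s t : (Index ι)ᵒᵖ} (h : s ⟶ t) : IsOpenImmersion (A.functor.map h) := by
  obtain ⟨f, hf⟩ := A.exists_isLocAt t.unop.2 h.unop.le
  let := (Subalgebra.inclusion hf.le).toRingHom.toAlgebra
  have := hf.isLocalization
  exact IsOpenImmersion.of_isLocalization (R := A.ring t.unop.1) (S := A.ring s.unop.1)
    (⟨f, hf.mem⟩ : A.ring t.unop.1)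

instance : (A.functor ⋙ Scheme.forget).IsLocallyDirected where
  cond {s s' k} h h' x x' hx := by
    classical
    obtain ⟨f, hf⟩ := A.exists_isLocAt k.unop.2 h.unop.le
    obtain ⟨g, hg⟩ := A.exists_isLocAt k.unop.2 h'.unop.le
    let l : (Index ι)ᵒᵖ := .op ⟨s.unop.1 ∪ s'.unop.1, s.unop.2.mono Finset.subset_union_left⟩
    let a : l ⟶ s := (homOfLE (show s.unop.1 ≤ _ from Finset.subset_union_left)).op
    let b : l ⟶ s' := (homOfLE (show s'.unop.1 ≤ _ from Finset.subset_union_right)).op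
    have hD : IsLocAt (f * g) (A.ring k.unop.1) (A.ring (s.unop.1 ∪ s'.unop.1)) := by
      have := hf.sup hg
      rwa [show A.ring s.unop.1 ⊔ A.ring s'.unop.1 = A.ring (s.unop.1 ∪ s'.unop.1) from
        Finset.sup_union.symm] at this
    obtain ⟨z, hz, hz'⟩ := hf.exists_common hg hD (A.ring_mono Finset.subset_union_left)
      (A.ring_mono Finset.subset_union_right) x x' hx
    exact ⟨l, a, b, z, hz, hz'⟩

/-- The scheme obtained by gluing the charts along their overlaps. -/
abbrev scheme : Scheme.{0} := colimit A.functor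

/-- The inclusion of the open subscheme `Spec (chart i)`. -/
def chartMap (i : ι) : Spec (.of (A.ring {i})) ⟶ A.scheme :=
  colimit.ι A.functor (.op ⟨{i}, Finset.singleton_nonempty i⟩)

/-- The structure morphism to `Spec ℂ`. -/
def toSpec : A.scheme ⟶ Spec (.of ℂ) :=
  colimit.desc A.functor
    { pt := Spec (.of ℂ)
      ι :=
        { app := fun s => Spec.map (CommRingCat.ofHom (algebraMap ℂ (A.ring s.unop.1)))
          naturality := by
            intro s t h
            exact (Spec.map_comp _ _).symm.trans (Category.comp_id _).symm } }

/-- The generic point `Spec K ⟶ A.scheme`. -/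
def generic [Inhabited ι] : Spec (.of K) ⟶ A.scheme :=
  Spec.map (CommRingCat.ofHom (A.ring {(default : ι)}).val.toRingHom) ≫ A.chartMap default

section Map

variable {K' : Type} [Field K'] [Algebra ℂ K'] (B : Atlas K' ι) (φ : K →ₐ[ℂ] K')
  (h : ∀ i, (A.chart i).map φ ≤ B.chart i)

lemma ring_map_le (h : ∀ i, (A.chart i).map φ ≤ B.chart i) (s : Finset ι) : ∀ a ∈ A.ring s, φ a ∈ B.ring s := by
  suffices A.ring s ≤ (B.ring s).comap φ from fun a ha => this ha
  refine Finset.sup_le fun i hi a ha => ?_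
  exact (Finset.le_sup hi : B.chart i ≤ B.ring s) (h i ⟨a, ha, rfl⟩)

/-- The map of coordinate rings of the intersection of the charts in `s` induced by `φ`. -/
def ringMap (s : Finset ι) : A.ring s →+* B.ring s :=
  φ.toRingHom.restrict (A.ring s) (B.ring s) (A.ring_map_le B φ h s)

/-- The morphism of glued schemes that is given on the `i`-th charts by a homomorphism
`φ` of function fields. -/
def map : B.scheme ⟶ A.scheme :=
  colimMap
    { app := fun s => Spec.map (CommRingCat.ofHom (A.ringMap B φ h s.unop.1))
      naturality := by
        intro s t f
        refine (Spec.map_comp (CommRingCat.ofHom (A.ringMap B φ h t.unop.1))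
          (B.ringFunctor.map f.unop)).symm.trans ?_
        exact (Spec.map_comp (A.ringFunctor.map f.unop)
          (CommRingCat.ofHom (A.ringMap B φ h s.unop.1))) }

lemma generic_map [Inhabited ι] :
    B.generic ≫ A.map B φ h = Spec.map (CommRingCat.ofHom φ.toRingHom) ≫ A.generic := by
  have h1 : B.chartMap default ≫ A.map B φ h =
      Spec.map (CommRingCat.ofHom (A.ringMap B φ h {default})) ≫ A.chartMap default :=
    ι_colimMap _ _
  rw [generic, generic, Category.assoc, h1, ← Category.assoc, ← Category.assoc, ← Spec.map_comp,
    ← Spec.map_comp]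
  rfl

end Map

end Atlas

/-! ### Projective spaces and rational ruled surfaces -/

/-- The rational function field `ℂ(t₁, …, tₙ)`. -/
abbrev RatField (n : ℕ) : Type := FractionRing (MvPolynomial (Fin n) ℂ)

/-- The `i`-th variable of `ℂ(t₁, …, tₙ)`. -/
def var {n : ℕ} (i : Fin n) : RatField n := algebraMap (MvPolynomial (Fin n) ℂ) _ (.X i)

lemma var_ne_zero {n : ℕ} (i : Fin n) : var i ≠ 0 := by
  simp [var]

/-- The homogeneous coordinates `(1 : t₁ : … : tₙ)` of the generic point of `ℙⁿ`. -/
def homCoord (n : ℕ) : Fin (n + 1) → RatField n := Fin.cons 1 var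

lemma homCoord_ne_zero {n : ℕ} (i : Fin (n + 1)) : homCoord n i ≠ 0 := by
  refine Fin.cases ?_ (fun i => ?_) i
  · simp [homCoord]
  · simpa [homCoord] using var_ne_zero i

/-- The projective space `ℙⁿ` over `ℂ`, with its standard charts, whose coordinate rings are
`ℂ[X₀/Xᵢ, …, Xₙ/Xᵢ]`. -/
def projAtlas (n : ℕ) : Atlas (RatField n) (Fin (n + 1)) where
  chart i := Algebra.adjoin ℂ (Set.range fun j => homCoord n j / homCoord n i)
  overlap i j := by
    have h := @homCoord_ne_zero n
    refine ⟨homCoord n j / homCoord n i, isLocAt_adjoin (Algebra.subset_adjoin ⟨j, rfl⟩)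
      (div_ne_zero (h j) (h i)) ?_ ?_⟩
    · rw [inv_div]
      exact (le_sup_right : Algebra.adjoin ℂ (Set.range fun k => homCoord n k / homCoord n j) ≤ _)
        (Algebra.subset_adjoin ⟨i, rfl⟩)
    · rintro _ ⟨k, rfl⟩
      refine ⟨1, ?_⟩
      have h1 := h i
      have h2 := h j
      rw [pow_one, show homCoord n j / homCoord n i * (homCoord n k / homCoord n j) =
        homCoord n k / homCoord n i by field_simp]
      exact Algebra.subset_adjoin ⟨k, rfl⟩

/-- The coordinate `x = X₁/X₀` of the base of a ruled surface over `ℙ¹`. -/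
def xVar : RatField 2 := var 0

/-- The fibre coordinate `u = y₂/y₁` of a ruled surface over the chart `X₀ ≠ 0`. -/
def uVar : RatField 2 := var 1

/-- The coordinate `x` or `x⁻¹` on the two charts of the base `ℙ¹`. -/
def baseCoord (a : Bool) : RatField 2 := if a then xVar⁻¹ else xVar

/-- The fibre coordinate over the two charts of the base: `u` where `x` is regular and `x⁻ⁿ u`
where `x⁻¹` is regular. -/
def fibCoord (n : ℕ) (a : Bool) : RatField 2 := if a then uVar * (xVar ^ n)⁻¹ else uVar

/-- The fibre coordinate `y₂/y₁` or its inverse `y₁/y₂` on the chart `(a, b)`. -/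
def fibChart (n : ℕ) (a b : Bool) : RatField 2 :=
  if b then (fibCoord n a)⁻¹ else fibCoord n a

lemma baseCoord_ne_zero (a : Bool) : baseCoord a ≠ 0 := by
  have : xVar ≠ 0 := var_ne_zero 0
  cases a <;> simp [baseCoord, this]

lemma fibChart_ne_zero (n : ℕ) (a b : Bool) : fibChart n a b ≠ 0 := by
  have : xVar ≠ 0 := var_ne_zero 0
  have : uVar ≠ 0 := var_ne_zero 1
  cases a <;> cases b <;> simp [fibChart, fibCoord, *]

lemma baseCoord_not (a : Bool) : baseCoord (!a) = (baseCoord a)⁻¹ := by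
  cases a <;> simp [baseCoord]

lemma fibChart_not_right (n : ℕ) (a b : Bool) : fibChart n a (!b) = (fibChart n a b)⁻¹ := by
  cases b <;> simp [fibChart]

lemma fibCoord_not (n : ℕ) (a : Bool) :
    fibCoord n (!a) = fibCoord n a * (baseCoord a ^ n)⁻¹ := by
  have : xVar ≠ 0 := var_ne_zero 0
  cases a <;> simp [fibCoord, baseCoord, this]

lemma fibChart_not_left (n : ℕ) (a b : Bool) :
    fibChart n (!a) b =
      fibChart n a b * (if b then baseCoord a ^ n else (baseCoord a ^ n)⁻¹) := by
  cases b <;> simp [fibChart, fibCoord_not, mul_comm]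

/-- The rational ruled surface `ℙₙ = ℙ(𝒪 ⊕ 𝒪(n))` over `ℙ¹`, glued from four affine planes:
over each of the two charts of `ℙ¹` it is `Proj` of `𝒪[y₁, y₂]`, with fibre coordinate
`u = y₂/y₁` transforming like a section of `𝒪(n)`.  The section `E₀` is `u = 0`, the section
`E_∞` is `u = ∞`, and a form `σ` of degree `n` gives the section `E_σ : u = σ(1, x)`. -/
def hirzebruch (n : ℕ) : Atlas (RatField 2) (Bool × Bool) where
  chart i := Algebra.adjoin ℂ {baseCoord i.1, fibChart n i.1 i.2}
  overlap := by
    rintro ⟨a, b⟩ ⟨a', b'⟩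
    have hX := baseCoord_ne_zero a
    have hY := fibChart_ne_zero n a b
    have hXm : baseCoord a ∈ Algebra.adjoin ℂ {baseCoord a, fibChart n a b} :=
      Algebra.subset_adjoin (by simp)
    have hYm : fibChart n a b ∈ Algebra.adjoin ℂ {baseCoord a, fibChart n a b} :=
      Algebra.subset_adjoin (by simp)
    have hXi : (baseCoord a)⁻¹ ∈
        Algebra.adjoin ℂ {baseCoord (!a), fibChart n (!a) b'} :=
      Algebra.subset_adjoin (by simp [baseCoord_not])
    have hYi : fibChart n (!a) (!b) ∈
        Algebra.adjoin ℂ {baseCoord (!a), fibChart n (!a) (!b)} :=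
      Algebra.subset_adjoin (by simp)
    have hYi' : (fibChart n a b)⁻¹ ∈ Algebra.adjoin ℂ {baseCoord a, fibChart n a (!b)} :=
      Algebra.subset_adjoin (by simp [fibChart_not_right])
    have ha : a' = a ∨ a' = !a := by cases a <;> cases a' <;> simp
    have hb : b' = b ∨ b' = !b := by cases b <;> cases b' <;> simp
    rcases ha with rfl | rfl <;> rcases hb with rfl | rfl
    · exact ⟨1, by simpa using IsLocAt.refl _⟩
    · refine ⟨_, isLocAt_adjoin hYm hY (le_sup_right (a := Algebra.adjoin ℂ _) hYi') ?_⟩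
      rintro t (rfl | rfl)
      · exact ⟨0, by simpa using hXm⟩
      · exact ⟨1, by simp [fibChart_not_right, hY]⟩
    · refine ⟨_, isLocAt_adjoin hXm hX (le_sup_right (a := Algebra.adjoin ℂ _) hXi) ?_⟩
      rintro t (rfl | rfl)
      · exact ⟨1, by simp [baseCoord_not, hX]⟩
      · refine ⟨n, ?_⟩
        rw [fibChart_not_left]
        cases b'
        · convert! hYm using 1
          simp only [Bool.false_eq_true, if_false]
          field_simp
        · convert! mul_mem hYm (pow_mem hXm (n + n)) using 1
          simp only [if_true]
          ring
    · refine ⟨_, isLocAt_adjoin (mul_mem hXm hYm) (mul_ne_zero hX hY) ?_ ?_⟩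
      · have h1 := le_sup_right (a := Algebra.adjoin ℂ {baseCoord a, fibChart n a b}) hXi
        have h2 := le_sup_right (a := Algebra.adjoin ℂ {baseCoord a, fibChart n a b}) hYi
        have h3 := le_sup_left
          (b := Algebra.adjoin ℂ {baseCoord (!a), fibChart n (!a) (!b)}) hXm
        rw [mul_inv]
        refine mul_mem h1 ?_
        cases b
        · convert! mul_mem h2 (pow_mem h1 n) using 1
          rw [fibChart_not_left, fibChart_not_right]
          simp only [Bool.not_false, if_true, inv_pow]
          field_simp
        · convert! mul_mem h2 (pow_mem h3 n) using 1
          rw [fibChart_not_left, fibChart_not_right]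
          simp only [Bool.not_true, Bool.false_eq_true, if_false]
          field_simp
      · rintro t (rfl | rfl)
        · refine ⟨1, ?_⟩
          convert! hYm using 1
          rw [baseCoord_not]
          field_simp
        · refine ⟨n + 1, ?_⟩
          rw [fibChart_not_left, fibChart_not_right]
          cases b
          · convert! mul_mem (pow_mem hXm (2 * n + 1)) (pow_mem hYm n) using 1
            simp only [Bool.not_false, if_true]
            field_simp
            ring
          · convert! mul_mem hXm (pow_mem hYm n) using 1
            simp only [Bool.not_true, Bool.false_eq_true, if_false]
            field_simp
            ring

/-- The homomorphism `x ↦ x`, `u ↦ u⁶` of function fields. -/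
def muField : RatField 2 →ₐ[ℂ] RatField 2 :=
  IsFractionRing.liftAlgHom (g := MvPolynomial.aeval ![xVar, uVar ^ 6])
    (by
      have h : AlgebraicIndependent ℂ (var : Fin 2 → RatField 2) := by
        have := (MvPolynomial.algebraicIndependent_X (Fin 2) ℂ).map'
          (f := IsScalarTower.toAlgHom ℂ (MvPolynomial (Fin 2) ℂ) (RatField 2))
          (IsFractionRing.injective _ _)
        exact this
      have h2 := h.polynomial_aeval_of_transcendental
        (f := ![(Polynomial.X : Polynomial ℂ), Polynomial.X ^ 6])
        (by
          intro i
          fin_cases i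
          · exact Polynomial.transcendental_X ℂ
          · exact (Polynomial.transcendental_X ℂ).pow (by norm_num))
      have h3 : (fun i => Polynomial.aeval (var i : RatField 2)
          ((![(Polynomial.X : Polynomial ℂ), Polynomial.X ^ 6] : Fin 2 → _) i)) =
          ![xVar, uVar ^ 6] := by
        funext i
        fin_cases i <;> simp [xVar, uVar]
      rw [h3] at h2
      exact h2)

lemma muField_xVar : muField xVar = xVar := by
  simp [muField, xVar, var]

lemma muField_uVar : muField uVar = uVar ^ 6 := by
  simp [muField, uVar, var]

/-- The morphism `μ : ℙ₁ ⟶ ℙ₆` over `ℙ¹`, given on the charts by `y₁ ↦ y₁⁶`, `y₂ ↦ y₂⁶`. -/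
def mu : (hirzebruch 1).scheme ⟶ (hirzebruch 6).scheme :=
  (hirzebruch 6).map (hirzebruch 1) muField (by
    rintro ⟨a, b⟩
    have hX : muField (baseCoord a) = baseCoord a := by
      cases a <;> simp [baseCoord, muField_xVar]
    have hY : muField (fibChart 6 a b) = fibChart 1 a b ^ 6 := by
      cases a <;> cases b <;>
        simp [fibChart, fibCoord, muField_xVar, muField_uVar, mul_pow]
    rw [hirzebruch, hirzebruch, AlgHom.map_adjoin]
    refine Algebra.adjoin_le ?_
    rintro _ ⟨t, rfl | rfl, rfl⟩
    · rw [hX]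
      exact Algebra.subset_adjoin (by simp)
    · rw [hY]
      exact pow_mem (Algebra.subset_adjoin (by simp)) 6)

/-- `muField` is the pullback of rational functions along `μ`. -/
lemma generic_mu : (hirzebruch 1).generic ≫ mu =
    Spec.map (CommRingCat.ofHom muField.toRingHom) ≫ (hirzebruch 6).generic :=
  (hirzebruch 6).generic_map (hirzebruch 1) muField _

/-! ### Kummer coverings -/

section Kummer

variable {K : Type} [Field K] {X : Scheme.{0}} (η : Spec (.of K) ⟶ X) (n : ℕ) (h : K)

/-- The function field `K(ⁿ√h) = K[T]/(Tⁿ - h)` of a Kummer covering. -/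
abbrev KummerField : Type := AdjoinRoot (Polynomial.X ^ n - Polynomial.C h : Polynomial K)

/-- The morphism `Spec K(ⁿ√h) ⟶ Spec K ⟶ X`. -/
def kummerMap : Spec (.of (KummerField n h)) ⟶ X :=
  Spec.map (CommRingCat.ofHom (AdjoinRoot.of _)) ≫ η

instance : QuasiCompact (kummerMap η n h) := by
  have : IsNoetherianRing (KummerField n h) := inferInstance
  infer_instance

/-- The Kummer covering of `X` given by `ⁿ√h`, for a rational function `h` on `X`: the
normalization of `X` in `K(ⁿ√h)`, where `η : Spec K ⟶ X` is the generic point. -/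
abbrev kummerCover : Scheme.{0} := (kummerMap η n h).normalization

/-- The covering morphism. -/
abbrev kummerCoverMap : kummerCover η n h ⟶ X := (kummerMap η n h).fromNormalization

variable {n}

/-- The automorphism `T ↦ ξ T` of `K(ⁿ√h)`, for `ξⁿ = 1`. -/
def deckField (ξ : K) (hξ : ξ ^ n = 1) : KummerField n h →ₐ[K] KummerField n h :=
  AdjoinRoot.liftAlgHom _ (Algebra.ofId K _)
    (algebraMap K (KummerField n h) ξ * AdjoinRoot.root _) (by
      have := AdjoinRoot.eval₂_root (Polynomial.X ^ n - Polynomial.C h : Polynomial K)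
      rw [Polynomial.eval₂_sub, Polynomial.eval₂_pow, Polynomial.eval₂_X,
        Polynomial.eval₂_C] at this
      change Polynomial.eval₂ (algebraMap K (KummerField n h)) _ _ = 0
      rw [Polynomial.eval₂_sub, Polynomial.eval₂_pow, Polynomial.eval₂_X, Polynomial.eval₂_C,
        mul_pow, ← map_pow, hξ, map_one, one_mul]
      exact this)

/-- The covering transformation of the Kummer covering whose pullback is `ⁿ√h ↦ ξ ⁿ√h`. -/
def deck (ξ : K) (hξ : ξ ^ n = 1) : kummerCover η n h ⟶ kummerCover η n h :=
  (kummerMap η n h).normalizationDesc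
    (Spec.map (CommRingCat.ofHom (deckField h ξ hξ).toRingHom) ≫
      (kummerMap η n h).toNormalization)
    (kummerMap η n h).fromNormalization (by
      rw [Category.assoc, Scheme.Hom.toNormalization_fromNormalization, kummerMap,
        ← Category.assoc, ← Spec.map_comp, ← CommRingCat.ofHom_comp]
      congr 3
      exact (deckField h ξ hξ).comp_algebraMap.symm)

lemma deck_comp (ξ : K) (hξ : ξ ^ n = 1) :
    deck η h ξ hξ ≫ kummerCoverMap η n h = kummerCoverMap η n h :=
  Scheme.Hom.normalizationDesc_comp ..

end Kummer

/-! ### The curves and surfaces -/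

/-- The curve given by `yⁿ = h(x)`: the smooth projective model, as a cyclic covering of `ℙ¹`. -/
abbrev cyclicCurve (n : ℕ) (h : RatField 1) : Scheme.{0} :=
  kummerCover (projAtlas 1).generic n h

/-- The structure morphism of `yⁿ = h(x)` over `ℂ`. -/
def cyclicCurveToSpec (n : ℕ) (h : RatField 1) : cyclicCurve n h ⟶ Spec (.of ℂ) :=
  kummerCoverMap (projAtlas 1).generic n h ≫ (projAtlas 1).toSpec

/-- The automorphism `(x, y) ↦ (x, ξ y)` of the curve `yⁿ = h(x)`. -/
def cyclicCurveAut {n : ℕ} (h : RatField 1) (ξ : ℂ) (hξ : ξ ^ n = 1) :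
    cyclicCurve n h ⟶ cyclicCurve n h :=
  deck (projAtlas 1).generic h (algebraMap ℂ _ ξ) (by rw [← map_pow, hξ, map_one])

lemma cyclicCurveAut_comp {n : ℕ} (h : RatField 1) (ξ : ℂ) (hξ : ξ ^ n = 1) :
    cyclicCurveAut h ξ hξ ≫ cyclicCurveToSpec n h = cyclicCurveToSpec n h := by
  rw [cyclicCurveAut, cyclicCurveToSpec, ← Category.assoc, deck_comp]

/-- The product `C₁ × C₂` over `ℂ` of the curves `C₁ : yⁿ = h₁(x)` and `C₂ : yⁿ = h₂(x)`. -/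
abbrev curveProd (n : ℕ) (h₁ h₂ : RatField 1) : Scheme.{0} :=
  pullback (cyclicCurveToSpec n h₁) (cyclicCurveToSpec n h₂)

/-- The automorphism `(γ₁, γ₂)` of `C₁ × C₂`, where `γᵢ` is `(x, y) ↦ (x, ξ y)`. -/
def diagAut {n : ℕ} (h₁ h₂ : RatField 1) (ξ : ℂ) (hξ : ξ ^ n = 1) :
    curveProd n h₁ h₂ ⟶ curveProd n h₁ h₂ :=
  pullback.map _ _ _ _ (cyclicCurveAut h₁ ξ hξ) (cyclicCurveAut h₂ ξ hξ) (𝟙 _)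
    (by rw [cyclicCurveAut_comp, Category.comp_id]) (by rw [cyclicCurveAut_comp, Category.comp_id])

/-- The quotient `C₁ × C₂/⟨(1, 1)⟩` by the group generated by `(γ₁, γ₂)`: the coequalizer of
`(γ₁, γ₂)` and the identity in locally ringed spaces, that is the topological quotient with the
sheaf of invariant functions. -/
def quotProd {n : ℕ} (h₁ h₂ : RatField 1) (ξ : ℂ) (hξ : ξ ^ n = 1) : LocallyRingedSpace.{0} :=
  coequalizer (diagAut h₁ h₂ ξ hξ).toLRSHom (𝟙 (curveProd n h₁ h₂).toLocallyRingedSpace)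

/-- The structure morphism of `C₁ × C₂` over `ℂ`. -/
def curveProdToSpec (n : ℕ) (h₁ h₂ : RatField 1) : curveProd n h₁ h₂ ⟶ Spec (.of ℂ) :=
  pullback.fst _ _ ≫ cyclicCurveToSpec n h₁

lemma diagAut_comp {n : ℕ} (h₁ h₂ : RatField 1) (ξ : ℂ) (hξ : ξ ^ n = 1) :
    diagAut h₁ h₂ ξ hξ ≫ curveProdToSpec n h₁ h₂ = curveProdToSpec n h₁ h₂ := by
  rw [diagAut, curveProdToSpec, ← Category.assoc, pullback.lift_fst, Category.assoc,
    cyclicCurveAut_comp]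

/-- The structure morphism of `C₁ × C₂/⟨(1, 1)⟩` over `ℂ`. -/
def quotProdToSpec {n : ℕ} (h₁ h₂ : RatField 1) (ξ : ℂ) (hξ : ξ ^ n = 1) :
    quotProd h₁ h₂ ξ hξ ⟶ (Spec (.of ℂ)).toLocallyRingedSpace :=
  coequalizer.desc (curveProdToSpec n h₁ h₂).toLRSHom (by
    rw [Category.id_comp]
    exact congrArg Scheme.Hom.toLRSHom (diagAut_comp h₁ h₂ ξ hξ))

/-- Birational equivalence over a base: there are dense open subspaces that are isomorphic over
the base.  For schemes this is `AlgebraicGeometry.Scheme.BirationalOver`. -/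
def LRSBirationalOver {X Y S : LocallyRingedSpace.{0}} (sX : X ⟶ S) (sY : Y ⟶ S) : Prop :=
  ∃ (U : TopologicalSpace.Opens X) (V : TopologicalSpace.Opens Y),
    Dense (U : Set X) ∧ Dense (V : Set Y) ∧
    ∃ e : X.restrict U.isOpenEmbedding ≅ Y.restrict V.isOpenEmbedding,
      e.hom ≫ Y.ofRestrict V.isOpenEmbedding ≫ sY = X.ofRestrict U.isOpenEmbedding ≫ sX

/-- The coordinate `x = X₁/X₀` of `ℙ¹`. -/
def pVar : RatField 1 := var 0

/-- The value `σ(1, x)` of a binary form `σ(X₀, X₁)`; for `x = X₁/X₀` and `σ` of degree `6` it is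
the rational function `σ/X₀⁶`. -/
def formValue {K : Type} [Field K] [Algebra ℂ K] (σ : MvPolynomial (Fin 2) ℂ) (x : K) : K :=
  MvPolynomial.aeval ![1, x] σ

/-- The rational function on `ℙ₆` with divisor `E_σ - E₀`. -/
def sectionRatio (σ : MvPolynomial (Fin 2) ℂ) : RatField 2 :=
  (uVar - formValue σ xVar) / uVar

/-- The surface `𝒴`: the Kummer covering of `ℙ₁` of degree `2` given by the square root of the
rational function with divisor `μ^*E_σ - μ^*E₀` (the pullback along `μ` of the one with divisor
`E_σ - E₀`; it is determined up to a constant, which has a square root in `ℂ`). -/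
abbrev surfaceY (σ : MvPolynomial (Fin 2) ℂ) : Scheme.{0} :=
  kummerCover (hirzebruch 1).generic 2 (muField (sectionRatio σ))

/-- The structure morphism of `𝒴` over `ℂ`. -/
def surfaceYToSpec (σ : MvPolynomial (Fin 2) ℂ) : surfaceY σ ⟶ Spec (.of ℂ) :=
  kummerCoverMap (hirzebruch 1).generic 2 (muField (sectionRatio σ)) ≫ (hirzebruch 1).toSpec

/-- The double covering of `ℙ²`, with homogeneous coordinates `(X₀ : X₁ : Y)`, branched along the
sextic curve `C : Y⁶ = σ(X₀, X₁)`: the Kummer covering given by the square root of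
`(Y⁶ - σ(X₀, X₁))/X₀⁶`. -/
abbrev doublePlane (σ : MvPolynomial (Fin 2) ℂ) : Scheme.{0} :=
  kummerCover (projAtlas 2).generic 2 (var 1 ^ 6 - formValue σ (var 0))

/-- The structure morphism of the double plane over `ℂ`. -/
def doublePlaneToSpec (σ : MvPolynomial (Fin 2) ℂ) : doublePlane σ ⟶ Spec (.of ℂ) :=
  kummerCoverMap (projAtlas 2).generic 2 (var 1 ^ 6 - formValue σ (var 0)) ≫ (projAtlas 2).toSpec

end KummerSurface

end

open CategoryTheory CategoryTheory.Limits AlgebraicGeometry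

noncomputable section

namespace KummerSurface

/-! ### Sections of the structure sheaf of a coequalizer. -/

open TopologicalSpace Opposite

/-! All three spaces have the same function field, and a space over ℂ is determined up to birational
equivalence by its function field as soon as it contains, as a dense open subspace, the spectrum of
a finitely generated domain with that fraction field (`HasModel`). Two such domains inside one field
have a common localization (`exists_common_localization`), and its spectrum is a dense open subspace
of both spaces.

The algebra is short. Write f(x) = σ(1, x). The field of 𝒴 is ℂ(x, u, t) with t² = (u⁶ - f(x))/u⁶.
Putting r = u³t gives r² = u⁶ - f(x), the field of the double plane. On C × C' there are coordinates
with y₁⁶ = f(x₁) and y₂⁶ = x₂(x₂ - 1). The functions x₁, x₂ and y₁/y₂ are invariant. With c⁶ = -4, u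
= y₁/(c y₂) and t = 2x₂ - 1, one gets t² = 1 + 4y₂⁶ = 1 - f(x₁)/u⁶, which is the equation of 𝒴. The
whole field of C × C' is generated by y₂ over M = ℂ(x₁, u, t), y₂⁶ lies in M, and the automorphism
fixes M and multiplies y₂ by ξ. Averaging therefore shows that every invariant element lies in M
(`mem_of_fixed`, `exists_invariant_field`).

The geometry supplies the models. Over an affine chart a normalization is the spectrum of an
integral closure (`exists_normalization_chart`), finitely generated because the extension is
separable. For the quotient, charts of the two curves that are stable under the automorphisms give a
stable dense chart Spec (B₁ ⊗ B₂) of the product. The coequalizer of a stable open subspace is open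
in the coequalizer of the whole (`isOpenImmersion_of_isTopQuot`), and the coequalizer of an affine
scheme by an automorphism of finite order is the spectrum of the ring of invariants
(`isTopQuot_spec`, `secEq_spec`, `isIso_of_isTopQuot`).

The algebras T ^ n - h must be fields. This is Eisenstein's criterion at a smooth point of h = 0
(`irreducible_X_pow_sub_C`). For σ such a point comes from a simple zero away from infinity, which
exists because σ has six distinct zeros (`exists_simple_root`). The ring B₁ ⊗ B₂ is a domain because
ℂ is algebraically closed (`isDomain_tensorProduct`). -/

/-- The two preimages of U in X agree only propositionally when q coequalizes f and g. Quantifying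
over the inclusion i avoids fixing a transport between them. -/
def SecEq {X Y Z : PresheafedSpace.{_, _, 0} CommRingCat.{0}} (f g : X ⟶ Y) (q : Y ⟶ Z) (U : Opens Z) : Prop :=
  Function.Injective (q.c.app (op U)) ∧
    ∀ s : Y.presheaf.obj (op ((Opens.map q.base).obj U)),
      (∀ i : (Opens.map f.base).obj ((Opens.map q.base).obj U) ⟶
          (Opens.map g.base).obj ((Opens.map q.base).obj U),
        f.c.app (op _) s = X.presheaf.map i.op (g.c.app (op _) s)) →
      ∃ t, q.c.app (op U) t = s

/-- Sections of a colimit of presheafed spaces over U form the limit of the sections over the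
preimages of U. For a parallel pair that limit is an equalizer of rings. -/
lemma secEq_coequalizer {X Y : PresheafedSpace.{_, _, 0} CommRingCat.{0}} (f g : X ⟶ Y)
    (U : Opens (coequalizer f g : PresheafedSpace.{_, _, 0} CommRingCat.{0})) : SecEq f g (coequalizer.π f g) U := by
  let D := PresheafedSpace.componentwiseDiagram (parallelPair f g) U
  let e := PresheafedSpace.colimitPresheafObjIsoComponentwiseLimit (parallelPair f g) U
  have he : e.hom ≫ limit.π D (op .one) = (coequalizer.π f g).c.app (op U) :=
    PresheafedSpace.colimitPresheafObjIsoComponentwiseLimit_hom_π (parallelPair f g) U .one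
  constructor
  · rw [← he]
    -- The component at `zero` is the image of the component at `one` under a transition map.
    have h1 : Function.Injective (limit.π D (op .one)) := by
      intro a b hab
      refine Concrete.limit_ext D a b ?_
      rintro ⟨j⟩
      cases j
      · have := limit.w D (Quiver.Hom.op (V := WalkingParallelPair) WalkingParallelPairHom.left)
        rw [← this, ConcreteCategory.comp_apply, ConcreteCategory.comp_apply, hab]
      · exact hab
    exact h1.comp (ConcreteCategory.bijective_of_isIso e.hom).1
  · intro s hs
    have hw : (Opens.map f.base).obj ((Opens.map (coequalizer.π f g).base).obj U) =
          (Opens.map g.base).obj ((Opens.map (coequalizer.π f g).base).obj U) := by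
      have := congrArg PresheafedSpace.Hom.base (coequalizer.condition f g)
      exact congrArg (fun k => (Opens.map k).obj U) this
    let a := D.map (Quiver.Hom.op (V := WalkingParallelPair) WalkingParallelPairHom.left)
    let b := D.map (Quiver.Hom.op (V := WalkingParallelPair) WalkingParallelPairHom.right)
    -- The subring on which both restrictions agree is the point of a cone over D, so each of its
    -- elements lifts to the limit.
    let T := RingHom.eqLocus a.hom b.hom
    have hsT : s ∈ T := by
      have hz : (Opens.map (colimit.ι (parallelPair f g) .zero).base).obj U =
          (Opens.map f.base).obj ((Opens.map (coequalizer.π f g).base).obj U) := by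
        rw [← colimit.w (parallelPair f g) WalkingParallelPairHom.left]
        rfl
      have ha : a = f.c.app (op _) ≫ X.presheaf.map (eqToHom (congrArg op hz.symm)) := rfl
      have hb : b = g.c.app (op _) ≫ X.presheaf.map (eqToHom (congrArg op (hz.trans hw).symm)) := rfl
      change a s = b s
      rw [ha, hb]
      refine (congrArg (X.presheaf.map (eqToHom (congrArg op hz.symm))) (hs (eqToHom hw))).trans ?_
      change (g.c.app (op _) ≫ X.presheaf.map (eqToHom hw).op ≫ X.presheaf.map (eqToHom (congrArg op hz.symm))) s = _
      rw [← X.presheaf.map_comp]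
      rfl
    let ι : CommRingCat.of T ⟶ D.obj (op .one) := CommRingCat.ofHom T.subtype
    have hι : ι ≫ a = ι ≫ b := by
      ext x
      exact x.2
    let c : Cone D :=
      { pt := .of T
        π := { app := fun j => match j with
                | op .one => ι
                | op .zero => ι ≫ a
               naturality := by
                rintro ⟨j⟩ ⟨k⟩ ⟨h⟩
                change WalkingParallelPairHom k j at h
                cases h
                · exact Category.id_comp _
                · exact (Category.id_comp _).trans hι
                · exact (Category.id_comp _).trans ((Category.comp_id _).symm.trans (congrArg _ (D.map_id _).symm)) } }
    have hc : limit.lift D c ≫ limit.π D (op .one) = ι := limit.lift_π c (op .one)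
    refine ⟨e.inv (limit.lift D c ⟨s, hsT⟩), ?_⟩
    rw [← he]
    change (limit.lift D c ≫ e.inv ≫ e.hom ≫ limit.π D (op .one)) ⟨s, hsT⟩ = s
    rw [e.inv_hom_id_assoc, hc]
    rfl

lemma SecEq.comp_iso {X Y Z Z' : PresheafedSpace.{_, _, 0} CommRingCat.{0}} {f g : X ⟶ Y} {q : Y ⟶ Z}
    (H : ∀ U, SecEq f g q U) (e : Z ⟶ Z') [IsIso e] (U : Opens Z') : SecEq f g (q ≫ e) U := by
  have : IsIso (e.c.app (op U)) := by
    have := PresheafedSpace.c_isIso_of_iso e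
    exact NatIso.isIso_app_of_isIso e.c (op U)
  have hc : (q ≫ e).c.app (op U) = e.c.app (op U) ≫ q.c.app (op ((Opens.map e.base).obj U)) := by
    rw [PresheafedSpace.comp_c_app]
  obtain ⟨h1, h2⟩ := H ((Opens.map e.base).obj U)
  have hb := ConcreteCategory.bijective_of_isIso (e.c.app (op U))
  constructor
  · rw [hc]
    exact h1.comp hb.1
  · intro s hs
    obtain ⟨t, ht⟩ := h2 s hs
    obtain ⟨t', rfl⟩ := hb.2 t
    exact ⟨t', by rw [hc]; exact ht⟩

abbrev toPre : LocallyRingedSpace.{0} ⥤ PresheafedSpace.{_, _, 0} CommRingCat.{0} := LocallyRingedSpace.forgetToSheafedSpace ⋙ SheafedSpace.forgetToPresheafedSpace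

/-- The forgetful functor to presheafed spaces preserves coequalizers, so the computation of
sections carries over. -/
lemma secEq_lrs {X Y : LocallyRingedSpace.{0}} (f g : X ⟶ Y) (U : Opens (coequalizer f g : LocallyRingedSpace.{0})) :
    SecEq (toPre.map f) (toPre.map g) (toPre.map (coequalizer.π f g)) U := by
  have := ι_comp_coequalizerComparison f g toPre
  rw [← this]
  have : IsIso (coequalizerComparison f g toPre) := by
    have : PreservesColimitsOfShape WalkingParallelPair
      (SheafedSpace.forgetToPresheafedSpace (C := CommRingCat.{0})) := inferInstance
    have : PreservesColimitsOfShape WalkingParallelPair toPre := inferInstance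
    rw [← PreservesCoequalizer.iso_hom]
    infer_instance
  exact @SecEq.comp_iso _ _ _ _ _ _ _ (secEq_coequalizer _ _) _ this U

section HEq
variable {X Y : PresheafedSpace.{_, _, 0} CommRingCat.{0}}

/-- Preimages under equal morphisms are equal without being definitionally so. Sections over them
are compared by heterogeneous equality here and in the next lemmas. -/
lemma app_heq_of_hom_eq {f g : X ⟶ Y} (e : f = g) (U : Opens Y) (s : Y.presheaf.obj (op U)) :
    HEq (f.c.app (op U) s) (g.c.app (op U) s) := by
  subst e; rfl

lemma app_heq_app (f : X ⟶ Y) {U V : Opens Y} (e : U = V) {s : Y.presheaf.obj (op U)}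
    {t : Y.presheaf.obj (op V)} (h : HEq s t) : HEq (f.c.app (op U) s) (f.c.app (op V) t) := by
  subst e; cases h; rfl

lemma map_heq {U V : Opens X} (i : U ⟶ V) (e : U = V) (s : X.presheaf.obj (op V)) :
    HEq (X.presheaf.map i.op s) s := by
  subst e
  obtain rfl : i = 𝟙 _ := Subsingleton.elim _ _
  simp

lemma isIso_app_of_eq (f : X ⟶ Y) {U V : Opens Y} (e : U = V) (h : IsIso (f.c.app (op U))) : IsIso (f.c.app (op V)) := by
  subst e; exact h

lemma exists_heq {U V : Opens X} (e : U = V) (s : X.presheaf.obj (op V)) : ∃ t : X.presheaf.obj (op U), HEq t s := by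
  subst e; exact ⟨s, HEq.rfl⟩
end HEq

lemma preimage_comp_eq {X Y Z : PresheafedSpace.{_, _, 0} CommRingCat.{0}} (f : X ⟶ Y) (g : Y ⟶ Z) (h : X ⟶ Z)
    (e : f ≫ g = h) (U : Opens Z) : (Opens.map f.base).obj ((Opens.map g.base).obj U) = (Opens.map h.base).obj U := by
  subst e; rfl

/-- Sections of Q₁ over h⁻¹O are invariant sections on W, sections of Q over O are invariant
sections on X, and w identifies the two because it is an isomorphism on sections over q⁻¹O. -/
lemma isIso_app_of_secEq {W X Q₁ Q : PresheafedSpace.{_, _, 0} CommRingCat.{0}} {f₁ : W ⟶ W} {f : X ⟶ X}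
    {q₁ : W ⟶ Q₁} {q : X ⟶ Q} {w : W ⟶ X} {h : Q₁ ⟶ Q} (hf : f₁ ≫ w = w ≫ f) (hq : q₁ ≫ h = w ≫ q)
    (hf₁ : f₁ ≫ q₁ = q₁) (hfq : f ≫ q = q)
    (O : Opens Q) (h₁ : SecEq f₁ (𝟙 W) q₁ ((Opens.map h.base).obj O)) (h₂ : SecEq f (𝟙 X) q O)
    (hw : IsIso (w.c.app (op ((Opens.map q.base).obj O)))) : IsIso (h.c.app (op O)) := by
  rw [ConcreteCategory.isIso_iff_bijective]
  have hwb := ConcreteCategory.bijective_of_isIso (w.c.app (op ((Opens.map q.base).obj O)))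
  have key : ∀ t, HEq (q₁.c.app (op _) (h.c.app (op O) t)) (w.c.app (op _) (q.c.app (op O) t)) :=
    fun t => app_heq_of_hom_eq hq O t
  have eO : (Opens.map q₁.base).obj ((Opens.map h.base).obj O) = (Opens.map w.base).obj ((Opens.map q.base).obj O) :=
    preimage_comp_eq q₁ h _ hq O
  constructor
  · intro a b hab
    have h1 := key a
    rw [hab] at h1
    exact h₂.1 (hwb.1 (eq_of_heq (h1.symm.trans (key b))))
  · intro s
    obtain ⟨r, hr⟩ := exists_heq eO.symm (q₁.c.app (op _) s)
    obtain ⟨s', rfl⟩ := hwb.2 r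
    have efq : (Opens.map f.base).obj ((Opens.map q.base).obj O) = (Opens.map q.base).obj O :=
      preimage_comp_eq f q _ hfq O
    -- The section s' of X corresponding to s is invariant: its pullback to W is the pullback of s
    -- along q₁, which f₁ fixes.
    obtain ⟨t, ht⟩ := h₂.2 s' (by
      intro i
      have := isIso_app_of_eq w efq.symm hw
      have hw' := ConcreteCategory.bijective_of_isIso (w.c.app (op ((Opens.map f.base).obj ((Opens.map q.base).obj O))))
      refine hw'.1 (eq_of_heq ?_)
      have e1 : HEq (w.c.app (op _) (f.c.app (op _) s')) (f₁.c.app (op _) (w.c.app (op _) s')) :=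
        (app_heq_of_hom_eq hf _ s').symm
      have e2 : HEq (f₁.c.app (op _) (w.c.app (op _) s')) (f₁.c.app (op _) (q₁.c.app (op _) s)) :=
        app_heq_app f₁ eO.symm hr
      have e3 : HEq (f₁.c.app (op _) (q₁.c.app (op _) s)) (q₁.c.app (op _) s) :=
        app_heq_of_hom_eq hf₁ _ s
      have e4 : HEq (w.c.app (op _) (X.presheaf.map i.op ((𝟙 X : X ⟶ X).c.app (op _) s'))) (w.c.app (op _) s') :=
        app_heq_app w efq (map_heq i efq _)
      exact e1.trans (e2.trans (e3.trans (hr.symm.trans e4.symm))))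
    refine ⟨t, h₁.1 (eq_of_heq ((key t).trans ?_))⟩
    rw [ht]
    exact hr

/-! ### Comparison of quotients by an endomorphism. -/

/-- The field `fib` says that the fibres of q are no larger than the classes of the equivalence
relation generated by x ∼ f(x), phrased through arbitrary invariant functions. -/
structure IsTopQuot {X Y : LocallyRingedSpace.{0}} (f : X ⟶ X) (q : X ⟶ Y) : Prop where
  comp : f ≫ q = q
  isQuotientMap : Topology.IsQuotientMap q.base
  fib : ∀ {T : Type} (g : X → T), (∀ x, g (f.base x) = g x) → ∀ x y, q.base x = q.base y → g x = g y

abbrev toTop : LocallyRingedSpace.{0} ⥤ TopCat.{0} :=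
  LocallyRingedSpace.forgetToSheafedSpace ⋙ SheafedSpace.forget _

/-- The coequalizer is preserved by the passage to topological spaces and then to sets; `fib` is the
universal property in sets. -/
lemma isTopQuot_coequalizer {X : LocallyRingedSpace.{0}} (f : X ⟶ X) :
    IsTopQuot f (coequalizer.π f (𝟙 X)) where
  comp := by rw [coequalizer.condition, Category.id_comp]
  isQuotientMap := by
    exact TopCat.isQuotientMap_of_isColimit_cofork _
      (isColimitCoforkMapOfIsColimit toTop _ (coequalizerIsCoequalizer f (𝟙 X)))
  fib := by
    intro T g hg x y hxy
    have h := isColimitCoforkMapOfIsColimit (forget TopCat) _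
      (isColimitCoforkMapOfIsColimit toTop _ (coequalizerIsCoequalizer f (𝟙 X)))
    obtain ⟨l, hl⟩ := Cofork.IsColimit.desc' h (W := T) (TypeCat.ofHom g) (by
      ext x
      exact hg x)
    have h1 : ∀ x, l ((coequalizer.π f (𝟙 X)).base x) = g x := fun x => congrArg (fun k => k x) hl
    rw [← h1, ← h1, hxy]

section Compare

variable {W X Q₁ Q : LocallyRingedSpace.{0}} {f₁ : W ⟶ W} {f : X ⟶ X}
    {q₁ : W ⟶ Q₁} {q : X ⟶ Q} {w : W ⟶ X} {h : Q₁ ⟶ Q}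

/-- Apply `fib` to the function on X that is q₁ on the image of w and `none` elsewhere. It is
invariant because this image equals its own preimage under f. -/
lemma exists_of_isTopQuot (H₁ : IsTopQuot f₁ q₁) (H : IsTopQuot f q)
    (hf : f₁ ≫ w = w ≫ f) (hw : Topology.IsOpenEmbedding w.base)
    (hr : f.base ⁻¹' Set.range w.base = Set.range w.base) {x : X} {a : W}
    (hx : q.base x = q.base (w.base a)) : ∃ a', w.base a' = x ∧ q₁.base a' = q₁.base a := by
  classical
  have hf' : ∀ a, w.base (f₁.base a) = f.base (w.base a) := fun a =>
    congrArg (fun k : W ⟶ X => k.base a) hf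
  have hq' : ∀ a, q₁.base (f₁.base a) = q₁.base a := fun a =>
    congrArg (fun k : W ⟶ Q₁ => k.base a) H₁.comp
  let g : X → Option Q₁ := fun x => if hx : ∃ a, w.base a = x then some (q₁.base hx.choose) else none
  have hg : ∀ a, g (w.base a) = some (q₁.base a) := by
    intro a
    have hx : ∃ a', w.base a' = w.base a := ⟨a, rfl⟩
    simp only [g, dif_pos hx]
    rw [hw.injective hx.choose_spec]
  have hgn : ∀ x, (¬ ∃ a, w.base a = x) → g x = none := fun x hx => dif_neg hx
  have hinv : ∀ x, g (f.base x) = g x := by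
    intro x
    by_cases hx : x ∈ Set.range w.base
    · obtain ⟨a, rfl⟩ := hx
      rw [← hf', hg, hg, hq']
    · rw [hgn x hx, hgn]
      intro h'
      exact hx (hr ▸ (show x ∈ f.base ⁻¹' Set.range w.base from h'))
  have := H.fib g hinv _ _ hx
  rw [hg] at this
  by_cases hx : ∃ a, w.base a = x
  · obtain ⟨a', rfl⟩ := hx
    rw [hg] at this
    exact ⟨a', rfl, Option.some_injective _ this⟩
  · rw [hgn x hx] at this
    cases this

/-- The preimage formula makes h an open map, since q is a quotient map and w is open; injectivity
is the fibre comparison just made. -/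
lemma isOpenEmbedding_of_isTopQuot (H₁ : IsTopQuot f₁ q₁) (H : IsTopQuot f q)
    (hf : f₁ ≫ w = w ≫ f) (hq : q₁ ≫ h = w ≫ q) (hw : Topology.IsOpenEmbedding w.base)
    (hr : f.base ⁻¹' Set.range w.base = Set.range w.base) :
    Topology.IsOpenEmbedding h.base ∧ ∀ U : Set Q₁, q.base ⁻¹' (h.base '' U) = w.base '' (q₁.base ⁻¹' U) := by
  have hq' : ∀ a, h.base (q₁.base a) = q.base (w.base a) := fun a =>
    congrArg (fun k : W ⟶ Q => k.base a) hq
  have him : ∀ U : Set Q₁, q.base ⁻¹' (h.base '' U) = w.base '' (q₁.base ⁻¹' U) := by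
    intro U
    ext x
    constructor
    · rintro ⟨b, hb, hbx⟩
      obtain ⟨a, rfl⟩ := H₁.isQuotientMap.surjective b
      rw [hq'] at hbx
      obtain ⟨a', rfl, ha'⟩ := exists_of_isTopQuot H₁ H hf hw hr hbx.symm
      exact ⟨a', by rwa [Set.mem_preimage, ha'], rfl⟩
    · rintro ⟨a, ha, rfl⟩
      exact ⟨_, ha, hq' a⟩
  refine ⟨.of_continuous_injective_isOpenMap h.base.hom.continuous ?_ ?_, him⟩
  · intro b b' hbb
    obtain ⟨a, rfl⟩ := H₁.isQuotientMap.surjective b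
    obtain ⟨a', rfl⟩ := H₁.isQuotientMap.surjective b'
    rw [hq', hq'] at hbb
    obtain ⟨c, hc, hc'⟩ := exists_of_isTopQuot H₁ H hf hw hr hbb
    rw [← hc', hw.injective hc]
  · intro U hU
    rw [← H.isQuotientMap.isOpen_preimage, him]
    exact hw.isOpenMap _ (hU.preimage q₁.base.hom.continuous)

lemma isOpenImmersion_of_isTopQuot (H₁ : IsTopQuot f₁ q₁) (H : IsTopQuot f q)
    (hf : f₁ ≫ w = w ≫ f) (hq : q₁ ≫ h = w ≫ q) [hw : LocallyRingedSpace.IsOpenImmersion w]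
    (hr : f.base ⁻¹' Set.range w.base = Set.range w.base)
    (h₁ : ∀ U, SecEq (toPre.map f₁) (𝟙 _) (toPre.map q₁) U)
    (h₂ : ∀ U, SecEq (toPre.map f) (𝟙 _) (toPre.map q) U) :
    LocallyRingedSpace.IsOpenImmersion h := by
  obtain ⟨hb, him⟩ := isOpenEmbedding_of_isTopQuot H₁ H hf hq hw.base_open hr
  refine ⟨hb, fun U => ?_⟩
  refine isIso_app_of_secEq (f₁ := toPre.map f₁) (f := toPre.map f) (q₁ := toPre.map q₁) (q := toPre.map q)
    (w := toPre.map w) (h := toPre.map h) ?_ ?_ ?_ ?_ _ (h₁ _) (h₂ _) ?_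
  · rw [← toPre.map_comp, ← toPre.map_comp, hf]
  · rw [← toPre.map_comp, ← toPre.map_comp, hq]
  · rw [← toPre.map_comp, H₁.comp]
  · rw [← toPre.map_comp, H.comp]
  · refine PresheafedSpace.IsOpenImmersion.c_iso' (f := w.toHom) ((Opens.map q₁.base).obj U) ?_
    exact Opens.ext (him U.1)

/-- Two quotients of one space are homeomorphic, and a morphism of sheaves is an isomorphism once it
is one on a basis. Only a basis is required of Q because invariants of a ring are computed on
principal open sets. -/
lemma isIso_of_isTopQuot {q : W ⟶ Q} {h : Q₁ ⟶ Q} (H₁ : IsTopQuot f₁ q₁) (H : IsTopQuot f₁ q) (hq : q₁ ≫ h = q)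
    {ι : Type} {B : ι → Opens Q} (hB : Opens.IsBasis (Set.range B))
    (h₁ : ∀ U, SecEq (toPre.map f₁) (𝟙 _) (toPre.map q₁) U)
    (h₂ : ∀ i, SecEq (toPre.map f₁) (𝟙 _) (toPre.map q) (B i)) : IsIso h := by
  obtain ⟨hb, -⟩ := isOpenEmbedding_of_isTopQuot (w := 𝟙 W) (h := h) H₁ H (by simp) (by simpa using hq)
    (Topology.IsOpenEmbedding.id) (by
      ext x; simp)
  have hsurj : Function.Surjective h.base := by
    intro b
    obtain ⟨a, rfl⟩ := H.isQuotientMap.surjective b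
    exact ⟨q₁.base a, congrArg (fun k : W ⟶ Q => k.base a) hq⟩
  have hiso : IsIso h.base := by
    have e : IsHomeomorph h.base := ⟨hb.continuous, hb.isOpenMap, hb.injective, hsurj⟩
    exact (TopCat.isIso_iff_isHomeomorph _).2 e
  have hc : IsIso h.c := by
    let φ : Q.toSheafedSpace.sheaf ⟶ (TopCat.Sheaf.pushforward _ h.base).obj Q₁.toSheafedSpace.sheaf := ⟨h.c⟩
    have : IsIso φ := by
      refine TopCat.Sheaf.isIso_iff_isIso_basis hB fun i => ?_
      refine isIso_app_of_secEq (f₁ := toPre.map f₁) (f := toPre.map f₁) (q₁ := toPre.map q₁) (q := toPre.map q)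
        (w := 𝟙 _) (h := toPre.map h) ?_ ?_ ?_ ?_ _ (h₁ _) (h₂ _) ?_
      · simp
      · rw [← toPre.map_comp, hq, Category.id_comp]
      · rw [← toPre.map_comp, H₁.comp]
      · rw [← toPre.map_comp, H.comp]
      · have := PresheafedSpace.c_isIso_of_iso (𝟙 (toPre.obj W))
        exact NatIso.isIso_app_of_isIso _ _
    exact inferInstanceAs (IsIso ((TopCat.Sheaf.forget _ _).map φ))
  have : IsIso (toPre.map h) := by
    have : IsIso (toPre.map h).base := hiso
    have : IsIso (toPre.map h).c := hc
    exact PresheafedSpace.isIso_of_components _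
  exact isIso_of_reflects_iso h toPre

end Compare

/-! ### Quotient of an affine scheme by an automorphism of finite order. -/

section SpecQuot

/-- The morphism of locally ringed spaces `Spec S' ⟶ Spec S` given by a ring homomorphism. -/
abbrev specHom {S S' : Type} [CommRing S] [CommRing S'] (φ : S →+* S') :
    (Spec (.of S')).toLocallyRingedSpace ⟶ (Spec (.of S)).toLocallyRingedSpace :=
  (Spec.map (CommRingCat.ofHom φ)).toLRSHom

/-- The section of the structure sheaf of `Spec S` given by an element of `S`. -/
def secOf (S : Type) [CommRing S] (U : Opens (PrimeSpectrum S)) :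
    S →+* (Spec (.of S)).presheaf.obj (op U) :=
  @algebraMap S ((Spec.structureSheaf S).obj.obj (op U)) _ _ (StructureSheaf.openAlgebra S (op U))

lemma specHom_app_secOf {S S' : Type} [CommRing S] [CommRing S'] (φ : S →+* S')
    (U : Opens (PrimeSpectrum S)) (s : S) :
    ((toPre.map (specHom φ)).c.app (op U)).hom (secOf S U s) =
      secOf S' ((Opens.map (toPre.map (specHom φ)).base).obj U) (φ s) :=
  congrArg (fun k => k.hom s) (StructureSheaf.toOpen_comp_comap φ U)

lemma res_secOf {S : Type} [CommRing S] {U V : Opens (PrimeSpectrum S)} (i : U ⟶ V) (s : S) :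
    ((Spec (.of S)).presheaf.map i.op).hom (secOf S V s) = secOf S U s :=
  congrArg (fun k => k.hom s) (StructureSheaf.algebraMap_self_map S (op U) (op V) i.op)

/-- The homomorphism `e : S →+* A` is a localization away from `a`. -/
structure IsAwayHom {S A : Type} [CommRing S] [CommRing A] (e : S →+* A) (a : S) : Prop where
  isUnit : IsUnit (e a)
  surj : ∀ z : A, ∃ (n : ℕ) (r : S), z * e a ^ n = e r
  exists_of_eq : ∀ r r' : S, e r = e r' → ∃ n : ℕ, a ^ n * r = a ^ n * r'

lemma isAwayHom_algebraMap {S A : Type} [CommRing S] [CommRing A] [Algebra S A] (a : S)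
    [IsLocalization.Away a A] : IsAwayHom (algebraMap S A) a where
  isUnit := IsLocalization.Away.algebraMap_isUnit a
  surj z := IsLocalization.Away.surj a z
  exists_of_eq _ _ h := IsLocalization.Away.exists_of_eq a h

lemma isAwayHom_secOf {S : Type} [CommRing S] (a : S) :
    IsAwayHom (secOf S (PrimeSpectrum.basicOpen a)) a :=
  @isAwayHom_algebraMap S ((Spec.structureSheaf S).obj.obj (op (PrimeSpectrum.basicOpen a))) _ _
    (StructureSheaf.openAlgebra S (op (PrimeSpectrum.basicOpen a))) a
    (StructureSheaf.IsLocalization.to_basicOpen S a)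

variable {k R : Type} [CommRing k] [CommRing R] [Algebra k R]

/-- The subalgebra of elements fixed by an endomorphism. -/
abbrev fixedSubalgebra (γ : R →ₐ[k] R) : Subalgebra k R := AlgHom.equalizer γ (AlgHom.id k R)

/-- Taking invariants commutes with localization at an invariant element. -/
lemma invariants_localization (γ : R →ₐ[k] R) (a : fixedSubalgebra γ) {A₀ A₁ A₂ : Type}
    [CommRing A₀] [CommRing A₁] [CommRing A₂] {e₀ : fixedSubalgebra γ →+* A₀} {e₁ : R →+* A₁}
    {e₂ : R →+* A₂} (h₀ : IsAwayHom e₀ a) (h₁ : IsAwayHom e₁ (a : R)) (h₂ : IsAwayHom e₂ (a : R))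
    (q : A₀ →+* A₁) (f i : A₁ →+* A₂) (hq : ∀ r, q (e₀ r) = e₁ r) (hf : ∀ r, f (e₁ r) = e₂ (γ r))
    (hi : ∀ r, i (e₁ r) = e₂ r) :
    Function.Injective q ∧ ∀ s, f s = i s → ∃ t, q t = s := by
  have hγ : ∀ r : fixedSubalgebra γ, γ r = r := fun r => r.2
  constructor
  · rw [injective_iff_map_eq_zero]
    intro t ht
    obtain ⟨n, r, hr⟩ := h₀.surj t
    have h1 : e₁ r = e₁ 0 := by rw [← hq, ← hr, map_mul, ht, zero_mul, map_zero]
    obtain ⟨m, hm⟩ := h₁.exists_of_eq _ _ h1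
    have hm' : a ^ m * r = 0 := Subtype.ext (by simpa using hm)
    have h3 : t * e₀ a ^ (n + m) = 0 := by
      rw [pow_add, ← mul_assoc, hr, ← map_pow, ← map_mul, mul_comm r, hm', map_zero]
    exact ((h₀.isUnit.pow (n + m)).mul_left_eq_zero).1 h3
  · intro s hs
    obtain ⟨n, r, hr⟩ := h₁.surj s
    have h3 : e₂ (γ r) = e₂ r := by
      rw [← hf, ← hi, ← hr, map_mul, map_mul, hs, map_pow, map_pow, hf, hi, hγ]
    obtain ⟨m, hm⟩ := h₂.exists_of_eq _ _ h3
    -- The numerator r of an invariant fraction is invariant only up to a power of a, and that power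
    -- is absorbed here.
    let b : fixedSubalgebra γ := ⟨a ^ m * r, by
      change γ (a ^ m * r) = a ^ m * r
      rw [map_mul, map_pow, hγ, hm]⟩
    obtain ⟨v, hv⟩ := (h₀.isUnit.pow (n + m)).exists_left_inv
    refine ⟨e₀ b * v, (h₁.isUnit.pow (n + m)).mul_right_cancel ?_⟩
    have h5 := congrArg q hv
    rw [map_mul, map_one, map_pow, hq] at h5
    rw [map_mul, mul_assoc, h5, mul_one, hq, pow_add, ← mul_assoc, hr]
    change e₁ (a ^ m * r) = _
    rw [map_mul, map_pow, mul_comm]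

/-- On a principal open set all three rings of sections are localizations at a, so this is the
exactness of invariants under localization. The equality D(γ a) = D(a) handles the preimage under
Spec γ. -/
lemma secEq_spec (γ : R →ₐ[k] R) (a : fixedSubalgebra γ) :
    SecEq (toPre.map (specHom γ.toRingHom)) (𝟙 _)
      (toPre.map (specHom (fixedSubalgebra γ).val.toRingHom)) (PrimeSpectrum.basicOpen a) := by
  have hVf : PrimeSpectrum.basicOpen (γ a) = PrimeSpectrum.basicOpen (a : R) := by
    rw [show γ a = a from a.2]
  have h₂ : IsAwayHom (secOf R (PrimeSpectrum.basicOpen (γ a))) (a : R) := by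
    rw [show γ a = a from a.2]; exact isAwayHom_secOf _
  obtain ⟨h, h'⟩ := invariants_localization γ a (isAwayHom_secOf a) (isAwayHom_secOf (a : R)) h₂
    ((toPre.map (specHom (fixedSubalgebra γ).val.toRingHom)).c.app (op _)).hom
    ((toPre.map (specHom γ.toRingHom)).c.app (op (PrimeSpectrum.basicOpen (a : R)))).hom
    ((Spec (.of R)).presheaf.map (eqToHom hVf).op).hom
    (fun r => specHom_app_secOf (fixedSubalgebra γ).val.toRingHom _ r)
    (fun r => specHom_app_secOf γ.toRingHom _ r) (fun r => res_secOf _ r)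
  exact ⟨h, fun s hs => h' s (hs (eqToHom hVf))⟩

/-- The group generated by an endomorphism of finite order, with its ring of invariants. -/
lemma exists_invariant_group (γ : R →ₐ[k] R) {n : ℕ} (hn : 0 < n) (hγ : γ ^ n = 1) :
    ∃ G : Subgroup (R ≃ₐ[k] R), Finite G ∧ SMulCommClass G (fixedSubalgebra γ) R ∧
      Algebra.IsInvariant (fixedSubalgebra γ) R G ∧ ∀ h ∈ G, ∃ m : ℕ, ∀ r, h r = (γ ^ m) r := by
  let R₀ := fixedSubalgebra γ
  have h1 : γ * γ ^ (n - 1) = 1 := by rw [← pow_succ', Nat.sub_add_cancel hn, hγ]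
  have h2 : γ ^ (n - 1) * γ = 1 := by rw [← pow_succ, Nat.sub_add_cancel hn, hγ]
  let g : R ≃ₐ[k] R := AlgEquiv.ofAlgHom γ (γ ^ (n - 1)) h1 h2
  have hgp : ∀ (m : ℕ) (r : R), (g ^ m) r = (γ ^ m) r := by
    intro m
    induction m with
    | zero => intro r; rfl
    | succ m ih => intro r; rw [pow_succ, pow_succ]; exact ih _
  have hgn : g ^ n = 1 := by
    ext r; rw [hgp, hγ]; rfl
  have hfin : IsOfFinOrder g := isOfFinOrder_iff_pow_eq_one.2 ⟨n, hn, hgn⟩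
  let G := Subgroup.zpowers g
  have : Finite G := hfin.finite_zpowers
  have hfix : ∀ (h : G) (r : R₀), h.1 (r : R) = r := by
    rintro ⟨h, hh⟩ r
    obtain ⟨m, rfl⟩ := (hfin.mem_powers_iff_mem_zpowers).2 hh
    induction m with
    | zero => rfl
    | succ m ih =>
      change (g ^ (m + 1)) (r : R) = r
      rw [pow_succ]
      change (g ^ m) (γ r) = r
      rw [show γ r = r from r.2]
      exact ih ((hfin.mem_powers_iff_mem_zpowers).1 ⟨m, rfl⟩)
  have : SMulCommClass G R₀ R := ⟨fun h r x => by
    change h.1 ((r : R) * x) = r * h.1 x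
    rw [map_mul, hfix]⟩
  have : Algebra.IsInvariant R₀ R G :=
    ⟨fun b hb => ⟨⟨b, hb ⟨g, Subgroup.mem_zpowers g⟩⟩, rfl⟩⟩
  refine ⟨G, inferInstance, inferInstance, inferInstance, fun h hh => ?_⟩
  obtain ⟨m, rfl⟩ := (hfin.mem_powers_iff_mem_zpowers).2 hh
  exact ⟨m, hgp m⟩

lemma isIntegral_fixedSubalgebra (γ : R →ₐ[k] R) {n : ℕ} (hn : 0 < n) (hγ : γ ^ n = 1) :
    Algebra.IsIntegral (fixedSubalgebra γ) R := by
  obtain ⟨G, _, _, _, -⟩ := exists_invariant_group γ hn hγ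
  exact Algebra.IsInvariant.isIntegral (fixedSubalgebra γ) R G

/-- Artin–Tate: R is integral and of finite type, hence finite, over the invariants. -/
lemma finiteType_fixedSubalgebra [IsNoetherianRing k] [Algebra.FiniteType k R] (γ : R →ₐ[k] R) {n : ℕ}
    (hn : 0 < n) (hγ : γ ^ n = 1) : Algebra.FiniteType k (fixedSubalgebra γ) := by
  have := isIntegral_fixedSubalgebra γ hn hγ
  have : Algebra.FiniteType (fixedSubalgebra γ) R := Algebra.FiniteType.of_restrictScalars_finiteType k _ _
  have : Module.Finite (fixedSubalgebra γ) R := Algebra.IsIntegral.finite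
  exact ⟨fg_of_fg_of_fg k (fixedSubalgebra γ) R Algebra.FiniteType.out Module.Finite.fg_top Subtype.val_injective⟩

/-- Integrality over the invariants makes the map on spectra closed and surjective, hence a quotient
map. Primes over the same prime are conjugate under the finite group, all of whose elements are
powers of γ. -/
lemma isTopQuot_spec (γ : R →ₐ[k] R) {n : ℕ} (hn : 0 < n) (hγ : γ ^ n = 1) :
    IsTopQuot (specHom γ.toRingHom) (specHom (fixedSubalgebra γ).val.toRingHom) := by
  let R₀ := fixedSubalgebra γ
  obtain ⟨G, _, _, _, hG⟩ := exists_invariant_group γ hn hγ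
  have := isIntegral_fixedSubalgebra γ hn hγ
  refine ⟨?_, ?_, ?_⟩
  · have : Spec.map (CommRingCat.ofHom γ.toRingHom) ≫ Spec.map (CommRingCat.ofHom R₀.val.toRingHom) =
       Spec.map (CommRingCat.ofHom R₀.val.toRingHom) := by
      rw [← Spec.map_comp, ← CommRingCat.ofHom_comp]
      congr 2
      ext r
      exact r.2
    exact congrArg Scheme.Hom.toLRSHom this
  · have hint : (algebraMap R₀ R).IsIntegral := Algebra.IsIntegral.isIntegral
    have hcl := PrimeSpectrum.isClosedMap_comap_of_isIntegral _ hint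
    have hsu := hint.comap_surjective Subtype.val_injective
    exact hcl.isQuotientMap (PrimeSpectrum.continuous_comap _) hsu
  · intro T f hf x y hxy
    have hf' : ∀ (m : ℕ) (x : PrimeSpectrum R), f (PrimeSpectrum.comap (γ ^ m).toRingHom x) = f x := by
      intro m
      induction m with
      | zero => intro x; rfl
      | succ m ih =>
        intro x
        rw [← ih x, ← hf (PrimeSpectrum.comap (γ ^ m).toRingHom x), pow_succ]
        rfl
    have hu : x.asIdeal.under R₀ = y.asIdeal.under R₀ := congrArg PrimeSpectrum.asIdeal hxy
    change PrimeSpectrum R at x y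
    have := x.isPrime
    have := y.isPrime
    obtain ⟨h, hh⟩ := Algebra.IsInvariant.exists_smul_of_under_eq R₀ R G x.asIdeal y.asIdeal hu
    obtain ⟨m, hm⟩ := hG _ (h⁻¹).2
    have hy : y = PrimeSpectrum.comap (γ ^ m).toRingHom x := by
      ext r
      rw [hh, Ideal.mem_pointwise_smul_iff_inv_smul_mem]
      change (h⁻¹).1 r ∈ x.asIdeal ↔ (γ ^ m) r ∈ x.asIdeal
      rw [hm]
    rw [hy, hf']
end SpecQuot

/-! ### Relative normalization over an affine chart. -/

section Normalization

/-- The pullback of sections along a morphism from an affine scheme into an open subset. -/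
def pullSec {L : CommRingCat.{0}} {Z : Scheme.{0}} (g : Spec L ⟶ Z) (U : Z.Opens)
    (h : ⊤ ≤ g ⁻¹ᵁ U) : Γ(Z, U) ⟶ L :=
  g.appLE U ⊤ h ≫ (Scheme.ΓSpecIso L).hom

lemma specMap_pullSec_fromSpec {L : CommRingCat.{0}} {Z : Scheme.{0}} (g : Spec L ⟶ Z)
    {U : Z.Opens} (hU : IsAffineOpen U) (h : ⊤ ≤ g ⁻¹ᵁ U) :
    Spec.map (pullSec g U h) ≫ hU.fromSpec = g := by
  have h1 := hU.SpecMap_appLE_fromSpec g (isAffineOpen_top (Spec L)) h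
  rw [pullSec, Spec.map_comp, Category.assoc, h1, IsAffineOpen.fromSpec_top]
  rw [Scheme.isoSpec_Spec_inv, ← Spec.map_comp_assoc]
  simp

lemma pullSec_comp {L : CommRingCat.{0}} {Z Z' : Scheme.{0}} (g : Spec L ⟶ Z) (p : Z ⟶ Z') (U : Z'.Opens)
    (V : Z.Opens) (hV : V ≤ p ⁻¹ᵁ U) (h : ⊤ ≤ g ⁻¹ᵁ V) (h' : ⊤ ≤ (g ≫ p) ⁻¹ᵁ U) :
    pullSec (g ≫ p) U h' = p.appLE U V hV ≫ pullSec g V h := by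
  rw [pullSec, pullSec, Scheme.Hom.appLE_comp_appLE_assoc]

lemma pullSec_specMap_comp {L R : CommRingCat.{0}} {Z : Scheme.{0}} (φ : R ⟶ L) (g : Spec R ⟶ Z) (U : Z.Opens)
    (h : ⊤ ≤ g ⁻¹ᵁ U) (h' : ⊤ ≤ (Spec.map φ ≫ g) ⁻¹ᵁ U) :
    pullSec (Spec.map φ ≫ g) U h' = pullSec g U h ≫ φ := by
  rw [pullSec_comp (Spec.map φ) g U ⊤ h (show ⊤ ≤ Spec.map φ ⁻¹ᵁ ⊤ from fun _ _ => trivial) h', pullSec.eq_1 (Spec.map φ),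
    pullSec.eq_1 g]
  have : (Spec.map φ).appLE ⊤ ⊤ (fun _ _ => trivial) = (Spec.map φ).appTop :=
    (Scheme.Hom.app_eq_appLE _).symm
  rw [this, Scheme.ΓSpecIso_naturality, Category.assoc]

instance isIso_pullSec {R : CommRingCat.{0}} {Z : Scheme.{0}} (c : Spec R ⟶ Z) [IsOpenImmersion c] :
    IsIso (pullSec c c.opensRange (by simp)) := by
  rw [pullSec]
  have : IsIso (c.appLE c.opensRange ⊤ (by simp)) := by
    have : IsIso (homOfLE (show ⊤ ≤ c ⁻¹ᵁ c.opensRange by simp)) := ⟨homOfLE le_top, rfl, rfl⟩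
    have := Scheme.Hom.isIso_app c c.opensRange le_rfl
    rw [Scheme.Hom.appLE]
    infer_instance
  infer_instance

/-- Over the affine open U = c(Spec R) the normalization is the spectrum of the integral closure of
Γ(Y, U) in Γ(f⁻¹U). Here f⁻¹U is all of Spec L, so these two rings are identified with R and L by ρ
and τ. -/
lemma exists_normalization_chart {R L : Type} [CommRing R] [CommRing L] [Algebra R L] {Y : Scheme.{0}}
    (c : Spec (.of R) ⟶ Y) [IsOpenImmersion c] (f : Spec (.of L) ⟶ Y) [QuasiCompact f] [QuasiSeparated f]
    (hf : f = Spec.map (CommRingCat.ofHom (algebraMap R L)) ≫ c) :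
    ∃ κ : Spec (.of (integralClosure R L)) ⟶ f.normalization, ∃ _ : IsOpenImmersion κ,
      Spec.map (CommRingCat.ofHom (algebraMap (integralClosure R L) L)) ≫ κ = f.toNormalization ∧
      κ ≫ f.fromNormalization = Spec.map (CommRingCat.ofHom (algebraMap R (integralClosure R L))) ≫ c ∧
      κ.opensRange = f.fromNormalization ⁻¹ᵁ c.opensRange := by
  let U := c.opensRange
  have hU : IsAffineOpen U := isAffineOpen_opensRange c
  have hcU : ⊤ ≤ c ⁻¹ᵁ U := by simp [U]
  have hfU : ⊤ ≤ f ⁻¹ᵁ U := by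
    rw [hf, Scheme.Hom.comp_preimage]
    exact fun x _ => hcU trivial
  let V := f.fromNormalization ⁻¹ᵁ U
  have hV : IsAffineOpen V := hU.preimage _
  have htV : ⊤ ≤ f.toNormalization ⁻¹ᵁ V := by
    rw [← Scheme.Hom.comp_preimage, Scheme.Hom.toNormalization_fromNormalization]
    exact hfU
  let θ := pullSec f.toNormalization V htV
  let ρ := pullSec c U hcU
  have hρ : IsIso ρ := isIso_pullSec c
  have hθ1 : Spec.map θ ≫ hV.fromSpec = f.toNormalization := specMap_pullSec_fromSpec _ hV _
  have hρ1 : Spec.map ρ ≫ hU.fromSpec = c := specMap_pullSec_fromSpec _ hU _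
  have hfρ : pullSec f U hfU = ρ ≫ CommRingCat.ofHom (algebraMap R L) := by
    subst hf
    exact pullSec_specMap_comp _ _ _ _ _
  have hcomp : f.fromNormalization.appLE U V le_rfl ≫ θ = ρ ≫ CommRingCat.ofHom (algebraMap R L) := by
    rw [← hfρ, ← pullSec_comp f.toNormalization f.fromNormalization U V le_rfl htV
      (by rwa [Scheme.Hom.toNormalization_fromNormalization])]
    congr 1
    exact Scheme.Hom.toNormalization_fromNormalization f
  let := (f.app U).hom.toAlgebra
  let τ : Γ(Spec (.of L), f ⁻¹ᵁ U) ⟶ .of L := 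
    (Spec (.of L)).presheaf.map (homOfLE hfU).op ≫ (Scheme.ΓSpecIso (.of L)).hom
  have hτ : IsIso τ := by
    have : IsIso (homOfLE hfU) := ⟨homOfLE le_top, rfl, rfl⟩
    infer_instance
  have hτb : Function.Bijective τ.hom := ConcreteCategory.bijective_of_isIso τ
  have hθ : θ = (f.normalizationObjIso hU).hom ≫ CommRingCat.ofHom (Subalgebra.val _).toRingHom ≫ τ := by
    rw [← Category.assoc, Scheme.Hom.normalizationObjIso_hom_val]
    simp [θ, τ, pullSec, V]
  have hθ' : ∀ a, θ.hom a = τ.hom ((f.normalizationObjIso hU).hom.hom a).1 := fun a =>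
    congrArg (fun k => k.hom a) hθ
  have hob : Function.Bijective (f.normalizationObjIso hU).hom.hom :=
    ConcreteCategory.bijective_of_isIso (f.normalizationObjIso hU).hom
  have hfτ : f.app U ≫ τ = ρ ≫ CommRingCat.ofHom (algebraMap R L) := by
    rw [← hfρ]
    simp [τ, pullSec, Scheme.Hom.appLE]
  have hfτ' : ∀ a, τ.hom (algebraMap Γ(Y, U) Γ(Spec (.of L), f ⁻¹ᵁ U) a) = algebraMap R L (ρ.hom a) :=
    fun a => congrArg (fun k => k.hom a) hfτ
  have hρb : Function.Bijective ρ.hom := ConcreteCategory.bijective_of_isIso ρ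
  have hinj : Function.Injective θ.hom := by
    intro a b hab
    rw [hθ', hθ'] at hab
    exact hob.1 (Subtype.ext (hτb.1 hab))
  -- Integrality is carried in both directions by the isomorphisms ρ and τ, which are compatible
  -- with the two algebra structures.
  have hint : ∀ z : Γ(Spec (.of L), f ⁻¹ᵁ U), IsIntegral Γ(Y, U) z ↔ IsIntegral R (τ.hom z) := by
    intro z
    refine ⟨fun h => h.map_of_comp_eq ρ.hom τ.hom (RingHom.ext fun a => (hfτ' a).symm), fun h => ?_⟩
    let eρ := RingEquiv.ofBijective ρ.hom hρb
    let eτ := RingEquiv.ofBijective τ.hom hτb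
    have := h.map_of_comp_eq (R := R) (S := L) (T := Γ(Y, U)) eρ.symm.toRingHom eτ.symm.toRingHom
      (RingHom.ext fun a => ?_)
    · rwa [show eτ.symm.toRingHom (τ.hom z) = z from eτ.symm_apply_apply z] at this
    · obtain ⟨b, rfl⟩ := hρb.2 a
      rw [RingHom.comp_apply, RingHom.comp_apply, ← hfτ']
      exact (congrArg _ (eρ.symm_apply_apply b)).trans (eτ.symm_apply_apply _).symm
  have hrange : ∀ a, θ.hom a ∈ integralClosure R L := by
    intro a
    rw [hθ']
    exact (hint _).1 (((f.normalizationObjIso hU).hom.hom a).2)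
  let e : Γ(f.normalization, V) →+* integralClosure R L := θ.hom.codRestrict _ hrange
  have he : Function.Bijective e := by
    refine ⟨fun a b hab => hinj (congrArg Subtype.val hab), fun z => ?_⟩
    obtain ⟨z', hz'⟩ := hτb.2 z.1
    obtain ⟨a, ha⟩ := hob.2 ⟨z', (hint z').2 (by rw [hz']; exact z.2)⟩
    refine ⟨a, Subtype.ext ?_⟩
    change θ.hom a = z.1
    rw [hθ', ha, hz']
  have he' : IsIso (CommRingCat.ofHom e) := (ConcreteCategory.isIso_iff_bijective _).2 he
  have heθ : CommRingCat.ofHom e ≫ CommRingCat.ofHom (algebraMap (integralClosure R L) L) = θ := rfl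
  refine ⟨Spec.map (CommRingCat.ofHom e) ≫ hV.fromSpec, inferInstance, ?_, ?_, ?_⟩
  · rw [← Spec.map_comp_assoc, heθ, hθ1]
  · have h1 := hU.SpecMap_appLE_fromSpec f.fromNormalization hV le_rfl
    rw [Category.assoc, ← h1, ← hρ1, ← Spec.map_comp_assoc, ← Spec.map_comp_assoc]
    congr 2
    ext a
    exact congrArg (fun k => k.hom a) hcomp
  · rw [Scheme.Hom.opensRange_comp_of_isIso]
    exact hV.opensRange_fromSpec
end Normalization

/-! ### Common localizations of algebras with the same fraction field. -/

section CommonLocalization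

variable {F : Type} [Field F] [Algebra ℂ F]

/-- Every element of `F` is a quotient of two elements of the subalgebra `B`. -/
def HasFractions (B : Subalgebra ℂ F) : Prop := ∀ z : F, ∃ b ∈ B, b ≠ 0 ∧ b * z ∈ B

lemma HasFractions.exists_denom {B : Subalgebra ℂ F} (hB : HasFractions B) (S : Finset F) :
    ∃ b ∈ B, b ≠ 0 ∧ ∀ z ∈ S, b * z ∈ B := by
  classical
  induction S using Finset.induction_on with
  | empty => exact ⟨1, B.one_mem, one_ne_zero, by simp⟩
  | insert z S _ ih =>
    obtain ⟨b, hb, hb0, hS⟩ := ih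
    obtain ⟨c, hc, hc0, hz⟩ := hB z
    refine ⟨b * c, B.mul_mem hb hc, mul_ne_zero hb0 hc0, fun w hw => ?_⟩
    rcases Finset.mem_insert.1 hw with rfl | hw
    · rw [mul_assoc]; exact B.mul_mem hb hz
    · rw [mul_right_comm]; exact B.mul_mem (hS w hw) hc

lemma HasFractions.exists_le_denomAlg {B B' : Subalgebra ℂ F} (hB : HasFractions B) (hB' : B'.FG) :
    ∃ c, ∃ hc : c ∈ B, c ≠ 0 ∧ B' ≤ denomAlg hc := by
  obtain ⟨S, hS⟩ := hB'
  obtain ⟨c, hc, hc0, h⟩ := hB.exists_denom S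
  refine ⟨c, hc, hc0, ?_⟩
  rw [← hS]
  exact Algebra.adjoin_le fun z hz => ⟨1, by simpa using h z hz⟩

/-- For c^m d ∈ B, the localization of B at f = c · (c^m d) contains 1/c and d⁻¹ = c^m/(c^m d), and
it contains B' because c clears the denominators of B'. -/
lemma exists_isLocAt_sup_adjoin {B B' : Subalgebra ℂ F} {c d : F} (hc : c ∈ B) (hc0 : c ≠ 0)
    (h : B' ≤ denomAlg hc) (hd : d ∈ B') (hd0 : d ≠ 0) :
    ∃ f, IsLocAt f B (B ⊔ B' ⊔ Algebra.adjoin ℂ {c⁻¹, d⁻¹}) := by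
  obtain ⟨m, hm⟩ := h hd
  have hf : c * (c ^ m * d) ∈ B := B.mul_mem hc hm
  refine ⟨c * (c ^ m * d), ?_, hf, by positivity, ?_, ?_⟩
  · exact le_sup_left.trans le_sup_left
  · have hle : Algebra.adjoin ℂ {c⁻¹, d⁻¹} ≤ B ⊔ B' ⊔ Algebra.adjoin ℂ {c⁻¹, d⁻¹} := le_sup_right
    have h1 := hle (Algebra.subset_adjoin (show c⁻¹ ∈ ({c⁻¹, d⁻¹} : Set F) by simp))
    have h2 := hle (Algebra.subset_adjoin (show d⁻¹ ∈ ({c⁻¹, d⁻¹} : Set F) by simp))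
    rw [mul_inv, mul_inv, ← inv_pow]
    exact mul_mem h1 (mul_mem (pow_mem h1 m) h2)
  · suffices B ⊔ B' ⊔ Algebra.adjoin ℂ {c⁻¹, d⁻¹} ≤ denomAlg hf from fun b hb => this hb
    refine sup_le (sup_le (fun b hb => ⟨0, by simpa using hb⟩) fun b hb => ?_)
      (Algebra.adjoin_le ?_)
    · obtain ⟨n, hn⟩ := h hb
      refine ⟨n, ?_⟩
      rw [mul_pow, mul_right_comm]
      exact mul_mem hn (pow_mem hm n)
    · rintro _ (rfl | rfl)
      · exact ⟨1, by rwa [pow_one, mul_right_comm, mul_inv_cancel₀ hc0, one_mul]⟩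
      · refine ⟨1, ?_⟩
        rw [pow_one, mul_assoc, mul_assoc, mul_inv_cancel₀ hd0, mul_one]
        exact mul_mem hc (pow_mem hc m)

/-- Two finitely generated subalgebras with the same fraction field have a common localization. -/
lemma exists_common_localization {B B' : Subalgebra ℂ F} (hB : HasFractions B) (hB' : HasFractions B')
    (hfg : B.FG) (hfg' : B'.FG) :
    ∃ (T : Subalgebra ℂ F) (f f' : F), IsLocAt f B T ∧ IsLocAt f' B' T := by
  obtain ⟨c, hc, hc0, h⟩ := hB.exists_le_denomAlg hfg'
  obtain ⟨d, hd, hd0, h'⟩ := hB'.exists_le_denomAlg hfg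
  obtain ⟨f, hf⟩ := exists_isLocAt_sup_adjoin hc hc0 h hd hd0
  obtain ⟨f', hf'⟩ := exists_isLocAt_sup_adjoin hd hd0 h' hc hc0
  -- The ring generated by B, B', c⁻¹ and d⁻¹ is symmetric in (B, c) and (B', d), so it is a
  -- localization of each.
  rw [sup_comm B', Set.pair_comm] at hf'
  exact ⟨_, f, f', hf, hf'⟩

end CommonLocalization

/-! ### Affine models and birational equivalence. -/

section Model

/-- The structure morphism of `Spec B` for a `ℂ`-algebra `B`. -/
abbrev specStr (B : Type) [CommRing B] [Algebra ℂ B] :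
    (Spec (.of B)).toLocallyRingedSpace ⟶ (Spec (.of ℂ)).toLocallyRingedSpace :=
  specHom (algebraMap ℂ B)

/-- The space `X` over `ℂ` contains, as a dense open subspace over `ℂ`, the spectrum of a finitely
generated algebra with fraction field `L`. -/
def HasModel {X : LocallyRingedSpace.{0}} (s : X ⟶ (Spec (.of ℂ)).toLocallyRingedSpace)
    (L : Type) [Field L] [Algebra ℂ L] : Prop :=
  ∃ (B : Subalgebra ℂ L) (κ : (Spec (.of B)).toLocallyRingedSpace ⟶ X), B.FG ∧ HasFractions B ∧
    LocallyRingedSpace.IsOpenImmersion κ ∧ DenseRange κ.base ∧ κ ≫ s = specStr B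

lemma specHom_comp {A B C : Type} [CommRing A] [CommRing B] [CommRing C] (φ : A →+* B) (ψ : B →+* C) :
    specHom ψ ≫ specHom φ = specHom (ψ.comp φ) := by
  have := Spec.map_comp (CommRingCat.ofHom φ) (CommRingCat.ofHom ψ)
  exact (congrArg Scheme.Hom.toLRSHom this).symm

lemma isIso_specHom_ringEquiv {A B : Type} [CommRing A] [CommRing B] (e : A ≃+* B) :
    IsIso (specHom e.toRingHom) := by
  have : IsIso (CommRingCat.ofHom e.toRingHom) := (ConcreteCategory.isIso_iff_bijective _).2 e.bijective
  have : IsIso (Spec.map (CommRingCat.ofHom e.toRingHom)) := inferInstance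
  infer_instance

lemma hasModel_of_algHom {X : LocallyRingedSpace.{0}} {s : X ⟶ (Spec (.of ℂ)).toLocallyRingedSpace}
    {L : Type} [Field L] [Algebra ℂ L] {B : Type} [CommRing B] [Algebra ℂ B] [Algebra.FiniteType ℂ B]
    (ψ : B →ₐ[ℂ] L) (hψ : Function.Injective ψ) (hfr : ∀ z, ∃ a b, ψ b ≠ 0 ∧ ψ b * z = ψ a)
    (κ : (Spec (.of B)).toLocallyRingedSpace ⟶ X) [LocallyRingedSpace.IsOpenImmersion κ]
    (hd : DenseRange κ.base) (hs : κ ≫ s = specStr B) : HasModel s L := by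
  let e : B ≃ₐ[ℂ] ψ.range := AlgEquiv.ofInjective ψ hψ
  have := isIso_specHom_ringEquiv e.toRingEquiv
  refine ⟨ψ.range, specHom e.toRingEquiv.toRingHom ≫ κ, ?_, ?_, inferInstance, ?_, ?_⟩
  · rw [← Algebra.map_top]
    exact Subalgebra.FG.map _ Algebra.FiniteType.out
  · intro z
    obtain ⟨a, b, hb, h⟩ := hfr z
    exact ⟨ψ b, ⟨b, rfl⟩, hb, ⟨a, h.symm⟩⟩
  · rw [LocallyRingedSpace.comp_base, TopCat.coe_comp]
    refine hd.comp ?_ κ.base.hom.continuous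
    have : IsIso (CommRingCat.ofHom e.toRingEquiv.toRingHom) :=
      (ConcreteCategory.isIso_iff_bijective _).2 e.bijective
    exact (Spec.map (CommRingCat.ofHom e.toRingEquiv.toRingHom)).surjective.denseRange
  · rw [Category.assoc, hs, specHom_comp]
    congr 1
    exact e.toAlgHom.comp_algebraMap

lemma IsLocAt.isOpenImmersion {L : Type} [Field L] [Algebra ℂ L] {f : L} {A B : Subalgebra ℂ L} (h : IsLocAt f A B) :
    LocallyRingedSpace.IsOpenImmersion (specHom (Subalgebra.inclusion h.le).toRingHom) := by
  let := (Subalgebra.inclusion h.le).toRingHom.toAlgebra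
  have := h.isLocalization
  exact IsOpenImmersion.of_isLocalization (R := A) (S := B) (⟨f, h.mem⟩ : A)

lemma IsLocAt.denseRange {L : Type} [Field L] [Algebra ℂ L] {f : L} {A B : Subalgebra ℂ L} (h : IsLocAt f A B) :
    DenseRange (specHom (Subalgebra.inclusion h.le).toRingHom).base := by
  have h1 : IsOpen (Set.range (PrimeSpectrum.comap (Subalgebra.inclusion h.le).toRingHom)) := by
    rw [h.range_comap]
    exact (PrimeSpectrum.basicOpen (⟨f, h.mem⟩ : A)).2
  exact h1.dense (Set.range_nonempty _)

/-- The spectrum of a common localization of the two models is a principal open subset of each, and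
nonempty open subsets of the spectrum of a domain are dense. -/
lemma HasModel.exists_span {X Y : LocallyRingedSpace.{0}} {sX : X ⟶ (Spec (.of ℂ)).toLocallyRingedSpace}
    {sY : Y ⟶ (Spec (.of ℂ)).toLocallyRingedSpace} {L : Type} [Field L] [Algebra ℂ L]
    (hX : HasModel sX L) (hY : HasModel sY L) :
    ∃ (T : Subalgebra ℂ L) (i : (Spec (.of T)).toLocallyRingedSpace ⟶ X)
      (j : (Spec (.of T)).toLocallyRingedSpace ⟶ Y),
      LocallyRingedSpace.IsOpenImmersion i ∧ LocallyRingedSpace.IsOpenImmersion j ∧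
      DenseRange i.base ∧ DenseRange j.base ∧ i ≫ sX = specStr T ∧ j ≫ sY = specStr T := by
  obtain ⟨B, κ, hfg, hfr, hκ, hd, hs⟩ := hX
  obtain ⟨B', κ', hfg', hfr', hκ', hd', hs'⟩ := hY
  obtain ⟨T, f, f', h, h'⟩ := exists_common_localization hfr hfr' hfg hfg'
  have := h.isOpenImmersion
  have := h'.isOpenImmersion
  refine ⟨T, specHom (Subalgebra.inclusion h.le).toRingHom ≫ κ,
    specHom (Subalgebra.inclusion h'.le).toRingHom ≫ κ', inferInstance, inferInstance, ?_, ?_, ?_, ?_⟩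
  · rw [LocallyRingedSpace.comp_base, TopCat.coe_comp]
    exact hd.comp h.denseRange κ.base.hom.continuous
  · rw [LocallyRingedSpace.comp_base, TopCat.coe_comp]
    exact hd'.comp h'.denseRange κ'.base.hom.continuous
  · rw [Category.assoc, hs, specHom_comp]; rfl
  · rw [Category.assoc, hs', specHom_comp]; rfl

lemma exists_iso_restrict {X T : LocallyRingedSpace.{0}} (i : T ⟶ X) [LocallyRingedSpace.IsOpenImmersion i] :
    ∃ (U : Opens X), (U : Set X) = Set.range i.base ∧
      ∃ e : T ≅ X.restrict U.isOpenEmbedding, e.hom ≫ X.ofRestrict U.isOpenEmbedding = i := by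
  have hi : Topology.IsOpenEmbedding i.base :=
    PresheafedSpace.IsOpenImmersion.base_open (f := i.toHom)
  let U : Opens X := ⟨Set.range i.base, hi.isOpen_range⟩
  have hr : Set.range (X.ofRestrict U.isOpenEmbedding).base = Set.range i.base := Subtype.range_val
  refine ⟨U, rfl, ⟨LocallyRingedSpace.IsOpenImmersion.lift (X.ofRestrict U.isOpenEmbedding) i hr.ge,
    LocallyRingedSpace.IsOpenImmersion.lift i (X.ofRestrict U.isOpenEmbedding) hr.le, ?_, ?_⟩, ?_⟩
  · rw [← cancel_mono i, Category.assoc, LocallyRingedSpace.IsOpenImmersion.lift_fac,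
      LocallyRingedSpace.IsOpenImmersion.lift_fac, Category.id_comp]
  · rw [← cancel_mono (X.ofRestrict U.isOpenEmbedding), Category.assoc, LocallyRingedSpace.IsOpenImmersion.lift_fac,
      LocallyRingedSpace.IsOpenImmersion.lift_fac, Category.id_comp]
  · exact LocallyRingedSpace.IsOpenImmersion.lift_fac _ _ hr.ge

lemma HasModel.lrsBirationalOver {X Y : LocallyRingedSpace.{0}} {sX : X ⟶ (Spec (.of ℂ)).toLocallyRingedSpace}
    {sY : Y ⟶ (Spec (.of ℂ)).toLocallyRingedSpace} {L : Type} [Field L] [Algebra ℂ L]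
    (hX : HasModel sX L) (hY : HasModel sY L) : LRSBirationalOver sX sY := by
  obtain ⟨T, i, j, hi, hj, hdi, hdj, hsi, hsj⟩ := hX.exists_span hY
  obtain ⟨U, hU, e, he⟩ := exists_iso_restrict i
  obtain ⟨V, hV, e', he'⟩ := exists_iso_restrict j
  refine ⟨U, V, by rw [hU]; exact hdi, by rw [hV]; exact hdj, e.symm ≪≫ e', ?_⟩
  rw [Iso.trans_hom, Category.assoc, reassoc_of% he', hsj, Iso.symm_hom, Iso.inv_comp_eq,
    reassoc_of% he, hsi]

lemma HasModel.birationalOver {X Y : Scheme.{0}} {sX : X ⟶ Spec (.of ℂ)} {sY : Y ⟶ Spec (.of ℂ)}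
    {L : Type} [Field L] [Algebra ℂ L] (hX : HasModel sX.toLRSHom L) (hY : HasModel sY.toLRSHom L) :
    Scheme.BirationalOver sX sY := by
  obtain ⟨T, i, j, hi, hj, hdi, hdj, hsi, hsj⟩ := hX.exists_span hY
  let i' : Spec (.of T) ⟶ X := ⟨i⟩
  let j' : Spec (.of T) ⟶ Y := ⟨j⟩
  have : IsOpenImmersion i' := hi
  have : IsOpenImmersion j' := hj
  have : IsDominant i' := ⟨hdi⟩
  have : IsDominant j' := ⟨hdj⟩
  have h1 : i' ≫ sX = Spec.map (CommRingCat.ofHom (algebraMap ℂ T)) := Scheme.Hom.ext' hsi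
  have h2 : j' ≫ sY = Spec.map (CommRingCat.ofHom (algebraMap ℂ T)) := Scheme.Hom.ext' hsj
  exact (Scheme.Hom.birationalOver i' _ _ h1).symm.trans (Scheme.Hom.birationalOver j' _ _ h2)

end Model

/-! ### The default charts are affine spaces. -/

section Polynomial

/-- The polynomials among the rational functions. -/
abbrev polyAlg (m : ℕ) : Subalgebra ℂ (RatField m) :=
  (IsScalarTower.toAlgHom ℂ (MvPolynomial (Fin m) ℂ) (RatField m)).range

/-- The subalgebra `polyAlg m` is a polynomial ring. -/
def polyAlgEquiv (m : ℕ) : MvPolynomial (Fin m) ℂ ≃ₐ[ℂ] polyAlg m :=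
  AlgEquiv.ofInjective _ (IsFractionRing.injective (MvPolynomial (Fin m) ℂ) (RatField m))

instance (m : ℕ) : IsIntegrallyClosed (polyAlg m) :=
  IsIntegrallyClosed.of_equiv (polyAlgEquiv m).toRingEquiv

instance (m : ℕ) : Algebra.FiniteType ℂ (polyAlg m) :=
  Algebra.FiniteType.equiv inferInstance (polyAlgEquiv m)

instance (m : ℕ) : IsFractionRing (polyAlg m) (RatField m) := by
  refine IsFractionRing.of_field _ _ fun z => ?_
  obtain ⟨a, b, -, rfl⟩ := IsFractionRing.div_surjective (A := MvPolynomial (Fin m) ℂ) z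
  exact ⟨polyAlgEquiv m a, polyAlgEquiv m b, rfl⟩

lemma polyAlg_eq_adjoin (m : ℕ) : polyAlg m = Algebra.adjoin ℂ (Set.range var) := by
  rw [polyAlg, ← Algebra.map_top, ← MvPolynomial.adjoin_range_X, AlgHom.map_adjoin, ← Set.range_comp]
  rfl

/-- The default index is 0, where the homogeneous coordinate is 1, so the chart is affine space. -/
lemma projAtlas_ring_default (m : ℕ) : (projAtlas m).ring {default} = polyAlg m := by
  rw [Atlas.ring, Finset.sup_singleton, polyAlg_eq_adjoin]
  apply le_antisymm
  · refine Algebra.adjoin_le ?_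
    rintro _ ⟨j, rfl⟩
    have h0 : homCoord m (default : Fin (m + 1)) = 1 := rfl
    simp only [h0, div_one]
    refine Fin.cases (Subalgebra.one_mem _) (fun i => Algebra.subset_adjoin ⟨i, rfl⟩) j
  · refine Algebra.adjoin_le ?_
    rintro _ ⟨j, rfl⟩
    refine Algebra.subset_adjoin ⟨j.succ, ?_⟩
    exact div_one _

/-- The default index is (false, false), whose coordinates are x and u themselves. -/
lemma hirzebruch_ring_default (n : ℕ) : (hirzebruch n).ring {default} = polyAlg 2 := by
  rw [Atlas.ring, Finset.sup_singleton, polyAlg_eq_adjoin]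
  change Algebra.adjoin ℂ {xVar, uVar} = _
  congr 1
  ext z
  simp [xVar, uVar, eq_comm]

end Polynomial

/-! ### Affine models of normalizations and Kummer coverings. -/

section NormalizationModel

/-- The integral closure of `R` in `L`, as a `ℂ`-algebra. -/
def intClosure (R L : Type) [CommRing R] [CommRing L] [Algebra R L] [Algebra ℂ R] [Algebra ℂ L]
    [IsScalarTower ℂ R L] : Subalgebra ℂ L :=
  (integralClosure R L).restrictScalars ℂ

/-- The inclusion of `R` into its integral closure. -/
def intClosureIncl (R L : Type) [CommRing R] [CommRing L] [Algebra R L] [Algebra ℂ R] [Algebra ℂ L]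
    [IsScalarTower ℂ R L] : R →+* intClosure R L :=
  algebraMap R (integralClosure R L)

lemma mem_intClosure {R L : Type} [CommRing R] [CommRing L] [Algebra R L] [Algebra ℂ R] [Algebra ℂ L]
    [IsScalarTower ℂ R L] {z : L} : z ∈ intClosure R L ↔ _root_.IsIntegral R z := Iff.rfl

variable {R L : Type} [CommRing R] [Field L] [Algebra ℂ R] [Algebra ℂ L] [Algebra R L]
  [IsScalarTower ℂ R L]

lemma hasFractions_intClosure (K : Type) [Field K] [Algebra R K] [Algebra K L] [IsScalarTower R K L]
    [FiniteDimensional K L] [IsFractionRing R K] [IsDomain R] : HasFractions (intClosure R L) := by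
  have := integralClosure.isFractionRing_of_finite_extension (A := R) K L
  intro z
  obtain ⟨a, b, hb, rfl⟩ := IsFractionRing.div_surjective (A := integralClosure R L) z
  have hb' : (b : L) ≠ 0 := by
    simpa using nonZeroDivisors.ne_zero hb
  refine ⟨b, b.2, hb', ?_⟩
  change (b : L) * (a / b) ∈ _
  rw [mul_div_cancel₀ _ hb']
  exact a.2

/-- In characteristic zero L/K is separable, so the integral closure of the noetherian integrally
closed domain R is a finite R-module. -/
lemma fg_intClosure (K : Type) [Field K] [Algebra R K] [Algebra K L] [IsScalarTower R K L]
    [FiniteDimensional K L] [IsFractionRing R K] [IsIntegrallyClosed R] [IsDomain R] [Algebra.FiniteType ℂ R] : (intClosure R L).FG := by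
  have : CharZero L := charZero_of_injective_algebraMap (algebraMap ℂ L).injective
  have : CharZero K := (RingHom.charZero_iff (algebraMap K L).injective).2 inferInstance
  have : IsNoetherianRing R := Algebra.FiniteType.isNoetherianRing ℂ R
  have : Module.Finite R (integralClosure R L) := IsIntegralClosure.finite R K L _
  have : Algebra.FiniteType ℂ (integralClosure R L) := Algebra.FiniteType.trans (S := R) inferInstance inferInstance
  exact (intClosure R L).fg_iff_finiteType.2 this

lemma exists_intClosure_chart {R L : Type} [CommRing R] [CommRing L] [Algebra R L] [Algebra ℂ R] [Algebra ℂ L]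
    [IsScalarTower ℂ R L] {Y : Scheme.{0}} (c : Spec (.of R) ⟶ Y) [IsOpenImmersion c]
    (s : Y ⟶ Spec (.of ℂ)) (hs : c ≫ s = Spec.map (CommRingCat.ofHom (algebraMap ℂ R)))
    (f : Spec (.of L) ⟶ Y) [QuasiCompact f] [QuasiSeparated f]
    (hf : f = Spec.map (CommRingCat.ofHom (algebraMap R L)) ≫ c) :
    ∃ κ : Spec (.of (intClosure R L)) ⟶ f.normalization, ∃ _ : IsOpenImmersion κ,
      IsDominant κ ∧
      Spec.map (CommRingCat.ofHom (intClosure R L).val.toRingHom) ≫ κ = f.toNormalization ∧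
      κ ≫ f.fromNormalization = Spec.map (CommRingCat.ofHom (intClosureIncl R L)) ≫ c ∧
      κ ≫ f.fromNormalization ≫ s = Spec.map (CommRingCat.ofHom (algebraMap ℂ (intClosure R L))) ∧
      κ.opensRange = f.fromNormalization ⁻¹ᵁ c.opensRange := by
  obtain ⟨κ, hκ, h1, h2, h3⟩ := exists_normalization_chart c f hf
  refine ⟨κ, hκ, ?_, h1, h2, ?_, h3⟩
  -- The dominant morphism from Spec L to the normalization factors through κ, so κ is dominant.
  · have : IsDominant (Spec.map (CommRingCat.ofHom (algebraMap (integralClosure R L) L)) ≫ κ) := by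
      rw [h1]; infer_instance
    exact IsDominant.of_comp (Spec.map (CommRingCat.ofHom (algebraMap (integralClosure R L) L))) κ
  · have h4 : κ ≫ f.fromNormalization ≫ s = Spec.map (CommRingCat.ofHom
        ((algebraMap R (integralClosure R L)).comp (algebraMap ℂ R))) := by
      rw [← Category.assoc, h2, Category.assoc, hs, ← Spec.map_comp, ← CommRingCat.ofHom_comp]
    refine h4.trans (congrArg (fun φ => Spec.map (CommRingCat.ofHom φ)) (RingHom.ext fun z => ?_))
    exact Subtype.ext (IsScalarTower.algebraMap_apply ℂ R L z).symm

lemma hasModel_normalization (K : Type) [Field K] [Algebra R K] [Algebra K L] [IsScalarTower R K L]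
    [FiniteDimensional K L] [IsFractionRing R K] [IsIntegrallyClosed R] [IsDomain R] [Algebra.FiniteType ℂ R]
    {Y : Scheme.{0}} (c : Spec (.of R) ⟶ Y) [IsOpenImmersion c]
    (s : Y ⟶ Spec (.of ℂ)) (hs : c ≫ s = Spec.map (CommRingCat.ofHom (algebraMap ℂ R)))
    (f : Spec (.of L) ⟶ Y) [QuasiCompact f] [QuasiSeparated f]
    (hf : f = Spec.map (CommRingCat.ofHom (algebraMap R L)) ≫ c) :
    HasModel (f.fromNormalization ≫ s).toLRSHom L := by
  obtain ⟨κ, hκ, hd, -, -, h2, -⟩ := exists_intClosure_chart c s hs f hf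
  exact ⟨intClosure R L, κ.toLRSHom, fg_intClosure K, hasFractions_intClosure K, hκ,
    κ.denseRange, congrArg Scheme.Hom.toLRSHom h2⟩

end NormalizationModel

section KummerModel

lemma finiteDimensional_kummerField {K : Type} [Field K] {n : ℕ} (h : K) (hn : 0 < n) :
    FiniteDimensional K (KummerField n h) :=
  (Polynomial.monic_X_pow_sub_C h hn.ne').finite_adjoinRoot

variable {K : Type} [Field K] [Algebra ℂ K] {ι : Type} (A : Atlas K ι)

instance (i : ι) : IsOpenImmersion (A.chartMap i) :=
  inferInstanceAs (IsOpenImmersion (colimit.ι A.functor _))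

lemma chartMap_toSpec (i : ι) :
    A.chartMap i ≫ A.toSpec = Spec.map (CommRingCat.ofHom (algebraMap ℂ (A.ring {i}))) :=
  colimit.ι_desc _ _

lemma kummerMap_generic [Inhabited ι] (n : ℕ) (h : K) : kummerMap A.generic n h =
    Spec.map (CommRingCat.ofHom (algebraMap (A.ring {default}) (KummerField n h))) ≫ A.chartMap default := by
  rw [kummerMap, Atlas.generic, ← Spec.map_comp_assoc, ← CommRingCat.ofHom_comp]
  rfl

lemma hasModel_kummerCover [Inhabited ι] {n : ℕ} {h : K} [Fact (Irreducible (Polynomial.X ^ n - Polynomial.C h))] (hn : 0 < n)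
    [IsIntegrallyClosed (A.ring {default})] [Algebra.FiniteType ℂ (A.ring {default})]
    [IsFractionRing (A.ring {default}) K] :
    HasModel (kummerCoverMap A.generic n h ≫ A.toSpec).toLRSHom (KummerField n h) := by
  have := finiteDimensional_kummerField h hn
  exact hasModel_normalization (R := A.ring {default}) K (A.chartMap default) A.toSpec
    (chartMap_toSpec A default) _ (kummerMap_generic A n h)

end KummerModel

open scoped TensorProduct

/-! ### Stable charts on products and quotients. -/

section EquivariantChart

/-- The morphism `κ` is a dense affine open subscheme of `X`, stable under the endomorphism `D` of
`X` over `ℂ`, which restricts to the endomorphism of `Spec B` given by `δ`. -/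
structure IsEquivariantChart {X : Scheme.{0}} (s : X ⟶ Spec (.of ℂ)) (D : X ⟶ X) {B : Type} [CommRing B]
    [Algebra ℂ B] (δ : B →ₐ[ℂ] B) (κ : Spec (.of B) ⟶ X) : Prop where
  isOpenImmersion : IsOpenImmersion κ
  isDominant : IsDominant κ
  comp_str : κ ≫ s = Spec.map (CommRingCat.ofHom (algebraMap ℂ B))
  comp_aut : Spec.map (CommRingCat.ofHom δ.toRingHom) ≫ κ = κ ≫ D
  preimage_range : D ⁻¹' Set.range κ = Set.range κ

lemma universallyOpen_of_field {X : Scheme.{0}} {k : Type} [Field k] (s : X ⟶ Spec (.of k)) : UniversallyOpen s := by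
  have : Subsingleton (Spec (.of k)) := inferInstanceAs (Subsingleton (PrimeSpectrum k))
  infer_instance

/-- The image of Spec (B₁ ⊗ B₂) is the intersection of the preimages of the two charts. Both
preimages are open and dense because the projections of a product over a field are open maps;
stability is checked factor by factor. -/
lemma IsEquivariantChart.prod {X₁ X₂ : Scheme.{0}} {s₁ : X₁ ⟶ Spec (.of ℂ)} {s₂ : X₂ ⟶ Spec (.of ℂ)}
    {D₁ : X₁ ⟶ X₁} {D₂ : X₂ ⟶ X₂} {B₁ B₂ : Type} [CommRing B₁] [CommRing B₂] [Algebra ℂ B₁] [Algebra ℂ B₂]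
    {δ₁ : B₁ →ₐ[ℂ] B₁} {δ₂ : B₂ →ₐ[ℂ] B₂} {κ₁ : Spec (.of B₁) ⟶ X₁} {κ₂ : Spec (.of B₂) ⟶ X₂}
    (H₁ : IsEquivariantChart s₁ D₁ δ₁ κ₁) (H₂ : IsEquivariantChart s₂ D₂ δ₂ κ₂)
    (h₁ : s₁ ≫ 𝟙 _ = D₁ ≫ s₁) (h₂ : s₂ ≫ 𝟙 _ = D₂ ≫ s₂) :
    ∃ w : Spec (.of (B₁ ⊗[ℂ] B₂)) ⟶ pullback s₁ s₂,
      IsEquivariantChart (pullback.fst s₁ s₂ ≫ s₁) (pullback.map s₁ s₂ s₁ s₂ D₁ D₂ (𝟙 _) h₁ h₂)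
        (Algebra.TensorProduct.map δ₁ δ₂) w := by
  have := H₁.isOpenImmersion
  have := H₂.isOpenImmersion
  have := H₁.isDominant
  have := H₂.isDominant
  let m := pullback.map (Spec.map (CommRingCat.ofHom (algebraMap ℂ B₁))) (Spec.map (CommRingCat.ofHom (algebraMap ℂ B₂)))
    s₁ s₂ κ₁ κ₂ (𝟙 _) (by rw [Category.comp_id, H₁.comp_str]) (by rw [Category.comp_id, H₂.comp_str])
  have hm : IsOpenImmersion m := inferInstance
  let w : Spec (.of (B₁ ⊗[ℂ] B₂)) ⟶ pullback s₁ s₂ := (pullbackSpecIso ℂ B₁ B₂).inv ≫ m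
  have hw1 : w ≫ pullback.fst s₁ s₂ = Spec.map (CommRingCat.ofHom Algebra.TensorProduct.includeLeftRingHom) ≫ κ₁ := by
    simp only [w, m, Category.assoc, pullback.lift_fst, pullbackSpecIso_inv_fst_assoc]
  have hw2 : w ≫ pullback.snd s₁ s₂ = Spec.map (CommRingCat.ofHom
      (Algebra.TensorProduct.includeRight (R := ℂ) (A := B₁) (B := B₂)).toRingHom) ≫ κ₂ := by
    simp only [w, m, Category.assoc, pullback.lift_snd, pullbackSpecIso_inv_snd_assoc]
    rfl
  have hr : Set.range w = pullback.fst s₁ s₂ ⁻¹' Set.range κ₁ ∩ pullback.snd s₁ s₂ ⁻¹' Set.range κ₂ := by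
    rw [← Scheme.Pullback.range_map (Spec.map (CommRingCat.ofHom (algebraMap ℂ B₁)))
      (Spec.map (CommRingCat.ofHom (algebraMap ℂ B₂))) s₁ s₂ κ₁ κ₂ (𝟙 _)
      (by rw [Category.comp_id, H₁.comp_str]) (by rw [Category.comp_id, H₂.comp_str])]
    simp only [w, Scheme.Hom.comp_base, TopCat.coe_comp]
    exact (Scheme.Hom.surjective _).range_comp _
  refine ⟨w, inferInstance, ⟨?_⟩, ?_, ?_, ?_⟩
  · rw [DenseRange, hr]
    have := universallyOpen_of_field s₁
    have := universallyOpen_of_field s₂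
    have d1 := κ₁.denseRange.preimage (pullback.fst s₁ s₂).isOpenMap
    have d2 := κ₂.denseRange.preimage (pullback.snd s₁ s₂).isOpenMap
    exact d1.inter_of_isOpen_left d2 (κ₁.isOpenEmbedding.isOpen_range.preimage (pullback.fst s₁ s₂).continuous)
  · rw [← Category.assoc, hw1, Category.assoc, H₁.comp_str, ← Spec.map_comp]
    rfl
  · apply pullback.hom_ext
    · rw [Category.assoc, hw1, Category.assoc, pullback.lift_fst, ← Category.assoc w, hw1, Category.assoc,
        ← H₁.comp_aut, ← Spec.map_comp_assoc, ← Spec.map_comp_assoc]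
      congr 2
      ext b
      simp
    · rw [Category.assoc, hw2, Category.assoc, pullback.lift_snd, ← Category.assoc w, hw2, Category.assoc,
        ← H₂.comp_aut, ← Spec.map_comp_assoc, ← Spec.map_comp_assoc]
      congr 2
      ext b
      simp
  · rw [hr]
    conv_rhs => rw [← H₁.preimage_range, ← H₂.preimage_range]
    rw [Set.preimage_inter]
    simp only [← Set.preimage_comp, ← TopCat.coe_comp, ← Scheme.Hom.comp_base]
    rw [pullback.lift_fst, pullback.lift_snd]

/-- The coequalizer of Spec B maps isomorphically to Spec of the invariants and, by stability of the
chart, as an open immersion into the coequalizer of X. The required j is the second map composed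
with the inverse of the first. -/
lemma IsEquivariantChart.quot {X : Scheme.{0}} {s : X ⟶ Spec (.of ℂ)} {D : X ⟶ X} {B : Type} [CommRing B]
    [Algebra ℂ B] {γ : B →ₐ[ℂ] B} {w : Spec (.of B) ⟶ X} (H : IsEquivariantChart s D γ w) {n : ℕ} (hn : 0 < n)
    (hγ : γ ^ n = 1) (hD : D.toLRSHom ≫ s.toLRSHom = 𝟙 X.toLocallyRingedSpace ≫ s.toLRSHom) :
    ∃ j : (Spec (.of (fixedSubalgebra γ))).toLocallyRingedSpace ⟶ coequalizer D.toLRSHom (𝟙 X.toLocallyRingedSpace),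
      LocallyRingedSpace.IsOpenImmersion j ∧ DenseRange j.base ∧
      j ≫ coequalizer.desc s.toLRSHom hD = specStr (fixedSubalgebra γ) := by
  have hw : LocallyRingedSpace.IsOpenImmersion w.toLRSHom := H.isOpenImmersion
  have := H.isDominant
  let W := (Spec (.of B)).toLocallyRingedSpace
  let f₁ : W ⟶ W := specHom γ.toRingHom
  let q₁ := coequalizer.π f₁ (𝟙 W)
  let q := coequalizer.π D.toLRSHom (𝟙 X.toLocallyRingedSpace)
  let p : W ⟶ (Spec (.of (fixedSubalgebra γ))).toLocallyRingedSpace := specHom (fixedSubalgebra γ).val.toRingHom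
  have hf : f₁ ≫ w.toLRSHom = w.toLRSHom ≫ D.toLRSHom := congrArg Scheme.Hom.toLRSHom H.comp_aut
  have hp := isTopQuot_spec γ hn hγ
  have hsec : ∀ U, SecEq (toPre.map f₁) (𝟙 _) (toPre.map q₁) U := fun U =>
    secEq_lrs f₁ (𝟙 W) U
  have hsec' : ∀ U, SecEq (toPre.map D.toLRSHom) (𝟙 _) (toPre.map q) U := fun U =>
    secEq_lrs D.toLRSHom (𝟙 _) U
  let hQ : coequalizer f₁ (𝟙 W) ⟶ coequalizer D.toLRSHom (𝟙 X.toLocallyRingedSpace) :=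
    coequalizer.desc (w.toLRSHom ≫ q) (by
      rw [← Category.assoc, hf, Category.assoc, coequalizer.condition, Category.id_comp, Category.id_comp])
  let hZ : coequalizer f₁ (𝟙 W) ⟶ (Spec (.of (fixedSubalgebra γ))).toLocallyRingedSpace :=
    coequalizer.desc p (by rw [Category.id_comp]; exact hp.comp)
  have hqQ : q₁ ≫ hQ = w.toLRSHom ≫ q := coequalizer.π_desc _ _
  have hqZ : q₁ ≫ hZ = p := coequalizer.π_desc _ _
  have i1 : LocallyRingedSpace.IsOpenImmersion hQ :=
    isOpenImmersion_of_isTopQuot (isTopQuot_coequalizer f₁) (isTopQuot_coequalizer D.toLRSHom) hf hqQ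
      H.preimage_range hsec hsec'
  have i2 : IsIso hZ :=
    isIso_of_isTopQuot (isTopQuot_coequalizer f₁) hp hqZ PrimeSpectrum.isBasis_basic_opens hsec (secEq_spec γ)
  refine ⟨inv hZ ≫ hQ, inferInstance, ?_, ?_⟩
  · have e : p ≫ inv hZ ≫ hQ = w.toLRSHom ≫ q := by
      rw [← hqZ, Category.assoc, IsIso.hom_inv_id_assoc, hqQ]
    have hd : DenseRange (w.toLRSHom ≫ q).base := by
      rw [LocallyRingedSpace.comp_base, TopCat.coe_comp]
      exact ((isTopQuot_coequalizer D.toLRSHom).isQuotientMap.surjective.denseRange).comp w.denseRange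
        q.base.hom.continuous
    rw [← e, LocallyRingedSpace.comp_base, TopCat.coe_comp] at hd
    exact hd.of_comp
  · rw [Category.assoc, IsIso.inv_comp_eq]
    refine coequalizer.hom_ext ?_
    change q₁ ≫ _ = q₁ ≫ _
    rw [← Category.assoc, hqQ, ← Category.assoc, hqZ, Category.assoc]
    change w.toLRSHom ≫ coequalizer.π _ _ ≫ _ = _
    rw [coequalizer.π_desc, specHom_comp]
    exact congrArg Scheme.Hom.toLRSHom H.comp_str

lemma exists_chart_quot_prod {X₁ X₂ : Scheme.{0}} {s₁ : X₁ ⟶ Spec (.of ℂ)} {s₂ : X₂ ⟶ Spec (.of ℂ)}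
    {D₁ : X₁ ⟶ X₁} {D₂ : X₂ ⟶ X₂} {B₁ B₂ : Type} [CommRing B₁] [CommRing B₂] [Algebra ℂ B₁] [Algebra ℂ B₂]
    {δ₁ : B₁ →ₐ[ℂ] B₁} {δ₂ : B₂ →ₐ[ℂ] B₂} (H₁ : ∃ κ₁, IsEquivariantChart s₁ D₁ δ₁ κ₁)
    (H₂ : ∃ κ₂, IsEquivariantChart s₂ D₂ δ₂ κ₂) {n : ℕ} (hn : 0 < n)
    (hγ : Algebra.TensorProduct.map δ₁ δ₂ ^ n = 1) {D : pullback s₁ s₂ ⟶ pullback s₁ s₂}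
    (h₁ : s₁ ≫ 𝟙 _ = D₁ ≫ s₁) (h₂ : s₂ ≫ 𝟙 _ = D₂ ≫ s₂)
    (hD : D = pullback.map s₁ s₂ s₁ s₂ D₁ D₂ (𝟙 _) h₁ h₂) {s : pullback s₁ s₂ ⟶ Spec (.of ℂ)}
    (hs : s = pullback.fst s₁ s₂ ≫ s₁)
    (hDs : D.toLRSHom ≫ s.toLRSHom = 𝟙 (pullback s₁ s₂).toLocallyRingedSpace ≫ s.toLRSHom) :
    ∃ j : (Spec (.of (fixedSubalgebra (Algebra.TensorProduct.map δ₁ δ₂)))).toLocallyRingedSpace ⟶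
        coequalizer D.toLRSHom (𝟙 (pullback s₁ s₂).toLocallyRingedSpace),
      LocallyRingedSpace.IsOpenImmersion j ∧ DenseRange j.base ∧
      j ≫ coequalizer.desc s.toLRSHom hDs = specStr _ := by
  subst hD hs
  obtain ⟨κ₁, H₁⟩ := H₁
  obtain ⟨κ₂, H₂⟩ := H₂
  obtain ⟨w, H⟩ := H₁.prod H₂ h₁ h₂
  exact H.quot hn hγ hDs

end EquivariantChart

/-! ### The stable affine chart of a cyclic curve. -/

section KummerChart

variable {R L : Type} [CommRing R] [CommRing L] [Algebra ℂ R] [Algebra ℂ L] [Algebra R L]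
  [IsScalarTower ℂ R L]

/-- The restriction of an endomorphism of `L` over `R` to the integral closure of `R`. -/
def intClosureMap (δ : L →ₐ[ℂ] L) (hδ : ∀ r, δ (algebraMap R L r) = algebraMap R L r) :
    intClosure R L →ₐ[ℂ] intClosure R L :=
  (δ.comp (intClosure R L).val).codRestrict _ fun z =>
    mem_intClosure.2 ((mem_intClosure.1 z.2).map_of_comp_eq (RingHom.id R) δ.toRingHom
      (RingHom.ext fun r => (hδ r).symm))

lemma exists_isEquivariantChart [_root_.IsReduced L] {Y : Scheme.{0}} (c : Spec (.of R) ⟶ Y) [IsOpenImmersion c]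
    (s : Y ⟶ Spec (.of ℂ)) (hs : c ≫ s = Spec.map (CommRingCat.ofHom (algebraMap ℂ R)))
    (f : Spec (.of L) ⟶ Y) [QuasiCompact f] [QuasiSeparated f]
    (hf : f = Spec.map (CommRingCat.ofHom (algebraMap R L)) ≫ c)
    (δ : L →ₐ[ℂ] L) (hδ : ∀ r, δ (algebraMap R L r) = algebraMap R L r)
    (D : f.normalization ⟶ f.normalization)
    (hD : f.toNormalization ≫ D = Spec.map (CommRingCat.ofHom δ.toRingHom) ≫ f.toNormalization)
    (hD' : D ≫ f.fromNormalization = f.fromNormalization) :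
    ∃ κ, IsEquivariantChart (f.fromNormalization ≫ s) D (intClosureMap (R := R) δ hδ) κ := by
  obtain ⟨κ, hκ, hd, h1, h2, h2', h3⟩ := exists_intClosure_chart c s hs f hf
  -- The chart is the full preimage of an open set of the base, and D lies over the identity of the
  -- base.
  have hDr : D ⁻¹' Set.range κ = Set.range κ := by
    rw [← Scheme.Hom.coe_opensRange, h3]
    have : D ⁻¹ᵁ f.fromNormalization ⁻¹ᵁ c.opensRange = f.fromNormalization ⁻¹ᵁ c.opensRange := by
      rw [← Scheme.Hom.comp_preimage, hD']
    exact congrArg SetLike.coe this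
  refine ⟨κ, hκ, hd, h2', ?_, hDr⟩
  have : IsDominant (Spec.map (CommRingCat.ofHom (intClosure R L).val.toRingHom)) := by
    refine ⟨(PrimeSpectrum.denseRange_comap_iff_ker_le_nilRadical _).2 ?_⟩
    rw [(RingHom.injective_iff_ker_eq_bot _).1 Subtype.val_injective]
    exact bot_le
  have : _root_.IsReduced (intClosure R L) :=
    isReduced_of_injective (intClosure R L).val Subtype.val_injective
  -- The source is reduced and the normalization map is separated, so it suffices to compare the two
  -- morphisms over Y and on the dominant Spec L.
  refine ext_of_isDominant_of_isSeparated f.fromNormalization ?_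
    (Spec.map (CommRingCat.ofHom (intClosure R L).val.toRingHom)) ?_
  · rw [Category.assoc, Category.assoc, hD', h2, ← Spec.map_comp_assoc, ← CommRingCat.ofHom_comp]
    congr 3
    ext r
    exact hδ r
  · rw [← Spec.map_comp_assoc, ← Category.assoc _ κ, h1, hD, ← h1, ← Spec.map_comp_assoc]
    rfl

lemma toNormalization_deck {K : Type} [Field K] {X : Scheme.{0}} (η : Spec (.of K) ⟶ X) {n : ℕ} (h ξ : K)
    (hξ : ξ ^ n = 1) : (kummerMap η n h).toNormalization ≫ deck η h ξ hξ =
      Spec.map (CommRingCat.ofHom (deckField h ξ hξ).toRingHom) ≫ (kummerMap η n h).toNormalization := by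
  rw [deck, Scheme.Hom.toNormalization_normalizationDesc]

variable {n : ℕ} (h : RatField 1) (ξ : ℂ) (hξ : ξ ^ n = 1)

/-- The automorphism `y ↦ ξ y` of the function field of the curve `yⁿ = h(x)`. -/
def curveDeck : KummerField n h →ₐ[ℂ] KummerField n h :=
  (deckField h (algebraMap ℂ _ ξ) (by rw [← map_pow, hξ, map_one])).restrictScalars ℂ

lemma curveDeck_algebraMap (r : RatField 1) :
    curveDeck h ξ hξ (algebraMap _ _ r) = algebraMap (RatField 1) (KummerField n h) r :=
  (deckField h (algebraMap ℂ _ ξ) (by rw [← map_pow, hξ, map_one])).commutes r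

/-- The coordinate ring of the affine part of the curve `yⁿ = h(x)`. -/
abbrev curveRing (n : ℕ) (h : RatField 1) : Subalgebra ℂ (KummerField n h) :=
  intClosure ((projAtlas 1).ring {default}) (KummerField n h)

/-- The automorphism `y ↦ ξ y` of the coordinate ring of the affine part of `yⁿ = h(x)`. -/
def curveRingDeck : curveRing n h →ₐ[ℂ] curveRing n h :=
  intClosureMap (R := (projAtlas 1).ring {default}) (curveDeck h ξ hξ) fun r => curveDeck_algebraMap h ξ hξ r

lemma exists_isEquivariantChart_cyclicCurve [_root_.IsReduced (KummerField n h)] :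
    ∃ κ, IsEquivariantChart (cyclicCurveToSpec n h) (cyclicCurveAut h ξ hξ) (curveRingDeck (n := n) h ξ hξ) κ :=
  exists_isEquivariantChart (L := KummerField n h) ((projAtlas 1).chartMap default) (projAtlas 1).toSpec
    (chartMap_toSpec _ _) (kummerMap (projAtlas 1).generic n h) (kummerMap_generic _ n h) (curveDeck h ξ hξ) _
    (cyclicCurveAut h ξ hξ) (toNormalization_deck ..) (deck_comp ..)

lemma exists_quotProd_chart {h₁ h₂ : RatField 1} [_root_.IsReduced (KummerField n h₁)]
    [_root_.IsReduced (KummerField n h₂)] (hn : 0 < n)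
    (hγ : Algebra.TensorProduct.map (curveRingDeck h₁ ξ hξ) (curveRingDeck h₂ ξ hξ) ^ n = 1) :
    ∃ j : (Spec (.of (fixedSubalgebra (Algebra.TensorProduct.map (curveRingDeck h₁ ξ hξ)
        (curveRingDeck h₂ ξ hξ))))).toLocallyRingedSpace ⟶ quotProd h₁ h₂ ξ hξ,
      LocallyRingedSpace.IsOpenImmersion j ∧ DenseRange j.base ∧
      j ≫ quotProdToSpec h₁ h₂ ξ hξ = specStr _ := by
  exact exists_chart_quot_prod (exists_isEquivariantChart_cyclicCurve h₁ ξ hξ)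
    (exists_isEquivariantChart_cyclicCurve h₂ ξ hξ) hn hγ
    (by rw [cyclicCurveAut_comp, Category.comp_id]) (by rw [cyclicCurveAut_comp, Category.comp_id])
    rfl rfl _

end KummerChart

/-! ### Tensor products of domains over an algebraically closed field. -/

section TensorDomain

variable {k A B : Type} [Field k] [CommRing A] [Algebra k A] [CommRing B] [Algebra k B]

/-- The specialization of `A ⊗ B` along a point of `A`. -/
def specialize (B : Type) [CommRing B] [Algebra k B] (e : A →ₐ[k] k) : A ⊗[k] B →ₐ[k] B :=
  Algebra.TensorProduct.lift ((Algebra.ofId k B).comp e) (AlgHom.id k B) fun _ _ => Commute.all _ _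

lemma specialize_tmul (e : A →ₐ[k] k) (a : A) (b : B) : specialize B e (a ⊗ₜ b) = e a • b := by
  simp [specialize, Algebra.smul_def, Algebra.ofId_apply]

/-- A k-basis of B is an A-basis of A ⊗ B, and specialization acts coordinatewise. Any nonzero
coordinate of z serves as a. -/
lemma exists_specialize_ne_zero {z : A ⊗[k] B} (hz : z ≠ 0) :
    ∃ a : A, a ≠ 0 ∧ ∀ e : A →ₐ[k] k, e a ≠ 0 → specialize B e z ≠ 0 := by
  let b := Module.Free.chooseBasis k B
  let bA := Algebra.TensorProduct.basis A b
  have h1 : bA.repr z ≠ 0 := by simpa using hz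
  obtain ⟨i, hi⟩ := Finsupp.ne_iff.1 h1
  refine ⟨bA.repr z i, by simpa using hi, fun e he h0 => he ?_⟩
  have key : ∀ w : A ⊗[k] B, b.repr (specialize B e w) i = e (bA.repr w i) := by
    intro w
    induction w with
    | zero => simp
    | add x y hx hy => simp [hx, hy]
    | tmul x y => simp [specialize_tmul, bA]
  rw [← key, h0]
  simp

variable [IsAlgClosed k] [IsDomain A] [Algebra.FiniteType k A]

/-- Nullstellensatz: the zero ideal of the Jacobson domain A is an intersection of maximal ideals,
and each residue field is finite over k. -/
lemma exists_algHom_ne_zero {a : A} (ha : a ≠ 0) : ∃ e : A →ₐ[k] k, e a ≠ 0 := by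
  have : IsJacobsonRing A := isJacobsonRing_of_finiteType (A := k)
  have h1 : a ∉ (⊥ : Ideal A).jacobson := by
    rw [← Ideal.radical_eq_jacobson, Ideal.IsRadical.radical (Ideal.isRadical_bot)]
    exact ha
  rw [Ideal.jacobson, Ideal.mem_sInf] at h1
  push Not at h1
  obtain ⟨m, ⟨-, hm⟩, ham⟩ := h1
  let : Field (A ⧸ m) := Ideal.Quotient.field m
  have : Module.Finite k (A ⧸ m) := finite_of_finite_type_of_isJacobsonRing k (A ⧸ m)
  let f : (A ⧸ m) →ₐ[k] k := IsAlgClosed.lift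
  refine ⟨f.comp (Ideal.Quotient.mkₐ k m), ?_⟩
  rw [AlgHom.comp_apply, ne_eq, map_eq_zero_iff f f.injective]
  exact fun h => ham (Ideal.Quotient.eq_zero_iff_mem.1 h)

/-- Two nonzero factors remain nonzero in B after specialization at a suitable common point of A, so
their product cannot vanish. -/
lemma isDomain_tensorProduct [IsDomain B] : IsDomain (A ⊗[k] B) := by
  have hn : Nontrivial (A ⊗[k] B) := by
    obtain ⟨e, -⟩ := exists_algHom_ne_zero (k := k) (one_ne_zero (α := A))
    exact (specialize B e).toRingHom.domain_nontrivial
  have : NoZeroDivisors (A ⊗[k] B) := by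
    refine ⟨fun {z w} h => ?_⟩
    by_contra! hc
    obtain ⟨a, ha, h1⟩ := exists_specialize_ne_zero hc.1
    obtain ⟨a', ha', h2⟩ := exists_specialize_ne_zero hc.2
    obtain ⟨e, he⟩ := exists_algHom_ne_zero (k := k) (mul_ne_zero ha ha')
    rw [map_mul] at he
    refine mul_ne_zero (h1 e (left_ne_zero_of_mul he)) (h2 e (right_ne_zero_of_mul he)) ?_
    rw [← map_mul, h, map_zero]
  exact NoZeroDivisors.to_isDomain _

/-- Specializing an algebraic relation at a point where one of its coefficients is nonzero gives a
nontrivial relation for x over k. -/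
lemma transcendental_one_tmul {x : B} (hx : Transcendental k x) : Transcendental A ((1 : A) ⊗ₜ[k] x) := by
  rw [transcendental_iff]
  intro p hp
  by_contra h0
  obtain ⟨i, hi⟩ : ∃ i, p.coeff i ≠ 0 := by
    by_contra! h
    exact h0 (Polynomial.ext h)
  obtain ⟨e, he⟩ := exists_algHom_ne_zero (k := k) hi
  have h1 : ∀ q : Polynomial A, specialize B e (Polynomial.aeval ((1 : A) ⊗ₜ[k] x) q) =
      Polynomial.aeval x (q.map e.toRingHom) := by
    intro q
    induction q using Polynomial.induction_on' with
    | add p q hp hq => simp [hp, hq]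
    | monomial n a =>
      simp [specialize_tmul, Polynomial.aeval_monomial, Algebra.smul_def, Algebra.TensorProduct.algebraMap_apply]
  have h2 := h1 p
  rw [hp, map_zero] at h2
  have h3 := (transcendental_iff.1 hx) _ h2.symm
  apply he
  have := congrArg (fun q => q.coeff i) h3
  simpa using this

end TensorDomain

/-! ### The field of invariants. -/

section Invariants

/-- An endomorphism of `F` that fixes `M` and multiplies `y` by a primitive `n`-th root of unity,
where `yⁿ ∈ M`, has all its fixed points in `M(y)` inside `M`. -/
lemma mem_of_fixed {F : Type} [Field F] [Algebra ℂ F] (M : IntermediateField ℂ F) (g : F →ₐ[ℂ] F)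
    (hM : ∀ m ∈ M, g m = m) {n : ℕ} (hn : 0 < n) {ξ : ℂ} (hξ : IsPrimitiveRoot ξ n) {y : F}
    (hy : g y = algebraMap ℂ F ξ * y) (hyn : y ^ n ∈ M) {z : F} (hz : z ∈ IntermediateField.adjoin M {y})
    (hgz : g z = z) : z ∈ M := by
  have hint : _root_.IsIntegral M y :=
    IsIntegral.of_pow hn (isIntegral_algebraMap (R := M) (x := (⟨y ^ n, hyn⟩ : M)))
  rw [← IntermediateField.mem_toSubalgebra, IntermediateField.adjoin_simple_toSubalgebra_of_isAlgebraic
    hint.isAlgebraic, Algebra.adjoin_singleton_eq_range_aeval] at hz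
  obtain ⟨p, hp⟩ := hz
  let c : ℂ →+* F := algebraMap ℂ F
  -- This is z = gʲ(z), with z written as a polynomial in y over M.
  have h1 : ∀ j : ℕ, z = ∑ i ∈ Finset.range (p.natDegree + 1), (p.coeff i : F) * (c ((ξ ^ i) ^ j) * y ^ i) := by
    intro j
    induction j with
    | zero =>
      rw [← hp]
      change Polynomial.aeval y p = _
      rw [Polynomial.aeval_eq_sum_range]
      simp [Algebra.smul_def]
    | succ j ih =>
      conv_lhs => rw [← hgz, ih]
      rw [map_sum]
      refine Finset.sum_congr rfl fun i _ => ?_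
      rw [map_mul, map_mul, hM _ (p.coeff i).2, map_pow g y, hy, show g (c _) = c _ from g.commutes _,
        pow_succ, map_mul c, mul_pow, map_pow c ξ i]
      ring
  -- Summing over j = 0, …, n - 1 kills every term in yⁱ with n ∤ i, since ξⁱ is then a nontrivial
  -- n-th root of unity; the remaining terms are powers of yⁿ ∈ M.
  have h2 : (n : F) * z = ∑ i ∈ Finset.range (p.natDegree + 1), (p.coeff i : F) * (c (∑ j ∈ Finset.range n, (ξ ^ i) ^ j) * y ^ i) := by
    have : (n : F) * z = ∑ j ∈ Finset.range n, z := by simp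
    rw [this, Finset.sum_congr rfl fun j _ => h1 j, Finset.sum_comm]
    refine Finset.sum_congr rfl fun i _ => ?_
    rw [map_sum, Finset.sum_mul, Finset.mul_sum]
  have hc : ∀ a : ℂ, c a ∈ M := M.algebraMap_mem
  have h3 : (n : F) * z ∈ M := by
    rw [h2]
    refine sum_mem fun i _ => M.mul_mem (p.coeff i).2 ?_
    by_cases hi : n ∣ i
    · obtain ⟨m, rfl⟩ := hi
      rw [pow_mul y]
      exact M.mul_mem (hc _) (pow_mem hyn m)
    · have h5 : ξ ^ i ≠ 1 := fun h => hi ((hξ.pow_eq_one_iff_dvd i).1 h)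
      have h6 : ∑ j ∈ Finset.range n, (ξ ^ i) ^ j = 0 := by
        rw [geom_sum_eq h5, ← pow_mul, mul_comm, pow_mul, hξ.pow_eq_one, one_pow, sub_self, zero_div]
      rw [h6]
      simp [c, M.zero_mem]
  have hn0 : (n : F) ≠ 0 := by
    have : CharZero F := charZero_of_injective_algebraMap (algebraMap ℂ F).injective
    exact_mod_cast hn.ne'
  have h4 : z = ((n : F) * z) / (n : F) := by field_simp
  rw [h4]
  exact M.div_mem h3 (natCast_mem M n)

lemma hasFractions_adjoin {F : Type} [Field F] [Algebra ℂ F] (A : Subalgebra ℂ F) {S : Set F}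
    (hS : ∀ z ∈ S, ∃ b ∈ A, b ≠ 0 ∧ b * z ∈ A) {z : F} (hz : z ∈ IntermediateField.adjoin ℂ S) :
    ∃ b ∈ A, b ≠ 0 ∧ b * z ∈ A := by
  have h1 : IntermediateField.adjoin ℂ S ≤ IntermediateField.adjoin ℂ (A : Set F) := by
    rw [IntermediateField.adjoin_le_iff]
    intro z hz
    obtain ⟨b, hb, hb0, h⟩ := hS z hz
    refine IntermediateField.mem_adjoin_iff_div.2 ⟨b * z, Algebra.subset_adjoin h, b, Algebra.subset_adjoin hb, ?_⟩
    field_simp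
  obtain ⟨r, hr, s, hs, rfl⟩ := IntermediateField.mem_adjoin_iff_div.1 (h1 hz)
  rw [Algebra.adjoin_eq] at hr hs
  by_cases hs0 : s = 0
  · exact ⟨1, A.one_mem, one_ne_zero, by simp [hs0, A.zero_mem]⟩
  · exact ⟨s, hs, hs0, by rwa [mul_div_cancel₀ _ hs0]⟩

lemma algebraicIndependent_pair {B F : Type} [CommRing B] [Field F] [Algebra ℂ B] [Algebra ℂ F] [Algebra B F]
    [IsScalarTower ℂ B F] [FaithfulSMul B F] {x : B} {u : F} (hx : Transcendental ℂ x) (hu : Transcendental B u) :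
    AlgebraicIndependent ℂ ![algebraMap B F x, u] := by
  have h1 : AlgebraicIndependent ℂ (fun _ : Unit => x) := algebraicIndependent_unique_type_iff.2 hx
  have h2 : AlgebraicIndependent B (fun _ : Unit => u) := algebraicIndependent_unique_type_iff.2 hu
  have h3 := h1.sumElim_comp h2
  have h4 := h3.comp (![Sum.inr (), Sum.inl ()] : Fin 2 → Unit ⊕ Unit) (by
    intro i j h
    fin_cases i <;> fin_cases j <;> simp_all)
  convert h4 using 1
  funext i
  fin_cases i <;> rfl

lemma injective_of_pow_eq_one {R : Type} [CommRing R] [Algebra ℂ R] {γ : R →ₐ[ℂ] R} {n : ℕ} (hn : 0 < n) (hγ : γ ^ n = 1) :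
    Function.Injective γ := by
  have h1 : γ ^ (n - 1) * γ = 1 := by rw [← pow_succ, Nat.sub_add_cancel hn, hγ]
  exact Function.LeftInverse.injective (g := ⇑(γ ^ (n - 1))) fun r => DFunLike.congr_fun h1 r

variable {B₁ B₂ R F : Type} [CommRing B₁] [CommRing B₂] [CommRing R] [Field F] [IsDomain B₁] [IsDomain B₂]
  [Algebra ℂ B₁] [Algebra ℂ B₂] [Algebra ℂ R] [Algebra ℂ F] [Algebra R F] [IsFractionRing R F] [IsScalarTower ℂ R F]
  [Algebra B₁ R] [Algebra B₁ F] [IsScalarTower B₁ R F] [IsScalarTower ℂ B₁ R] [IsScalarTower ℂ B₁ F] [FaithfulSMul B₁ R]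

/-- The fraction field of the ring of invariants in `B₁ ⊗ B₂` is generated by `x₁`, `x₂` and
`u = c⁻¹ y₁/y₂`, where `c⁶ = -4`. -/
lemma exists_invariant_field {x₁ y₁ : B₁} {x₂ y₂ : B₂} {δ₁ : B₁ →ₐ[ℂ] B₁} {δ₂ : B₂ →ₐ[ℂ] B₂} {s : B₁} {ξ : ℂ}
    {γ : R →ₐ[ℂ] R} (hξ : IsPrimitiveRoot ξ 6) (hγ : γ ^ 6 = 1) (i₂ : B₂ →ₐ[ℂ] R) (hi₂ : Function.Injective i₂)
    (hR : (IsScalarTower.toAlgHom ℂ B₁ R).range ⊔ i₂.range = ⊤)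
    (hγ₁ : ∀ b, γ (algebraMap B₁ R b) = algebraMap B₁ R (δ₁ b)) (hγ₂ : ∀ b, γ (i₂ b) = i₂ (δ₂ b))
    (hx₁ : Transcendental ℂ x₁) (hx₂ : Transcendental ℂ x₂) (hx₂' : Transcendental B₁ (i₂ x₂))
    (hδx₁ : δ₁ x₁ = x₁) (hδy₁ : δ₁ y₁ = ξ • y₁)
    (hδx₂ : δ₂ x₂ = x₂) (hδy₂ : δ₂ y₂ = ξ • y₂) (hy₁0 : y₁ ≠ 0)
    (hy₁ : y₁ ^ 6 = s) (hy₂ : y₂ ^ 6 = x₂ * (x₂ - 1))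
    (hg₁ : ∀ b : B₁, ∃ d ∈ Algebra.adjoin ℂ {x₁, y₁}, d ≠ 0 ∧ d * b ∈ Algebra.adjoin ℂ {x₁, y₁})
    (hg₂ : ∀ b : B₂, ∃ d ∈ Algebra.adjoin ℂ {x₂, y₂}, d ≠ 0 ∧ d * b ∈ Algebra.adjoin ℂ {x₂, y₂}) :
    ∃ u t : F, AlgebraicIndependent ℂ ![algebraMap B₁ F x₁, u] ∧ t ^ 2 = (u ^ 6 - algebraMap B₁ F s) / u ^ 6 ∧
      (∀ r, γ r = r → algebraMap R F r ∈ IntermediateField.adjoin ℂ {algebraMap B₁ F x₁, u, t}) ∧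
      ∀ z ∈ IntermediateField.adjoin ℂ {algebraMap B₁ F x₁, u, t}, ∃ a b, γ a = a ∧ γ b = b ∧
        algebraMap R F b ≠ 0 ∧ algebraMap R F b * z = algebraMap R F a := by
  have hγinj := injective_of_pow_eq_one (by norm_num) hγ
  let iR : R →ₐ[ℂ] F := IsScalarTower.toAlgHom ℂ R F
  have hiR : Function.Injective iR := IsFractionRing.injective R F
  let g : F →ₐ[ℂ] F := IsFractionRing.liftAlgHom (g := iR.comp γ) (hiR.comp hγinj)
  have hg : ∀ r, g (iR r) = iR (γ r) := fun r =>
    IsFractionRing.lift_algebraMap (K := F) (g := (iR.comp γ).toRingHom) (hiR.comp hγinj) r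
  let i₁ : B₁ →ₐ[ℂ] R := IsScalarTower.toAlgHom ℂ B₁ R
  let j : B₁ →ₐ[ℂ] F := IsScalarTower.toAlgHom ℂ B₁ F
  let j₂ : B₂ →ₐ[ℂ] F := iR.comp i₂
  have hji : ∀ b, j b = iR (i₁ b) := fun b => IsScalarTower.algebraMap_apply B₁ R F b
  have hj : Function.Injective j := by
    intro a b hab
    rw [hji, hji] at hab
    exact FaithfulSMul.algebraMap_injective B₁ R (hiR hab)
  have : FaithfulSMul B₁ F := (faithfulSMul_iff_algebraMap_injective _ _).2 hj
  have hj₂ : Function.Injective j₂ := hiR.comp hi₂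
  have hgj : ∀ b, g (j b) = j (δ₁ b) := fun b => by
    rw [hji, hji, hg]
    exact congrArg iR (hγ₁ b)
  have hgj₂ : ∀ b, g (j₂ b) = j₂ (δ₂ b) := fun b => (hg _).trans (congrArg iR (hγ₂ b))
  have hx₂0 : x₂ ≠ 0 := fun h => hx₂ (h ▸ isAlgebraic_zero)
  have hx₂1 : x₂ - 1 ≠ 0 := fun h => hx₂ (sub_eq_zero.1 h ▸ isAlgebraic_one)
  have hy₂0 : y₂ ≠ 0 := fun h => by
    rw [h, zero_pow (by norm_num)] at hy₂
    exact mul_ne_zero hx₂0 hx₂1 hy₂.symm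
  -- The constant -4 comes from completing the square: (2x₂ - 1)² = 1 + 4x₂(x₂ - 1) = 1 + 4y₂⁶,
  -- which must equal 1 - s/u⁶.
  obtain ⟨c, hc⟩ := IsAlgClosed.exists_pow_nat_eq (-4 : ℂ) (show 0 < 6 by norm_num)
  have hc0 : c ≠ 0 := by rintro rfl; norm_num at hc
  have hcF : algebraMap ℂ F c ^ 6 = -4 := by rw [← map_pow, hc, map_neg, map_ofNat]
  have hcF0 : algebraMap ℂ F c ≠ 0 := by simpa using hc0
  have hY₁0 : j y₁ ≠ 0 := fun h => hy₁0 (hj (h.trans (map_zero j).symm))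
  have hY₂0 : j₂ y₂ ≠ 0 := fun h => hy₂0 (hj₂ (h.trans (map_zero j₂).symm))
  have hY₁ : j y₁ ^ 6 = j s := by rw [← map_pow, hy₁]
  have hY₂ : j₂ y₂ ^ 6 = j₂ x₂ * (j₂ x₂ - 1) := by rw [← map_pow, hy₂]; simp
  let u : F := (algebraMap ℂ F c)⁻¹ * j y₁ / j₂ y₂
  let t : F := 2 * j₂ x₂ - 1
  have hu0 : u ≠ 0 := by simp [u, hcF0, hY₁0, hY₂0]
  have hu6 : j s = -4 * u ^ 6 * (j₂ x₂ * (j₂ x₂ - 1)) := by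
    rw [← hY₁, ← hY₂, ← hcF]
    simp only [u]
    field_simp
  have ht : t ^ 2 = (u ^ 6 - j s) / u ^ 6 := by
    rw [hu6]
    simp only [t]
    field_simp
    ring
  have : CharZero F := charZero_of_injective_algebraMap (algebraMap ℂ F).injective
  have hX₂ : j₂ x₂ = (t + 1) / 2 := by simp [t]
  have htr₂ : Transcendental B₁ (j₂ x₂) :=
    (transcendental_algebraMap_iff hiR).2 hx₂'
  -- If u were algebraic over B₁, then so would be t, because of its quadratic equation, and hence
  -- x₂ = (t + 1)/2.
  have hju : Transcendental B₁ u := by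
    intro hu
    have h1 : IsAlgebraic B₁ (t ^ 2) := by
      rw [ht, div_eq_mul_inv]
      exact ((hu.pow 6).sub (isAlgebraic_algebraMap s)).mul (hu.pow 6).inv
    have h2 : IsAlgebraic B₁ t := h1.of_pow (by norm_num)
    have h3 : IsAlgebraic B₁ (2 * j₂ x₂) := by
      have : 2 * j₂ x₂ = t + algebraMap B₁ F 1 := by simp [t]
      rw [this]
      exact h2.add (isAlgebraic_algebraMap 1)
    have h4 : IsAlgebraic B₁ ((2 : F)⁻¹ * (2 * j₂ x₂)) := by
      refine IsAlgebraic.mul (IsAlgebraic.inv ?_) h3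
      rw [← map_ofNat (algebraMap B₁ F) 2]
      exact isAlgebraic_algebraMap 2
    rw [inv_mul_cancel_left₀ two_ne_zero] at h4
    exact htr₂ h4
  have hind : AlgebraicIndependent ℂ ![j x₁, u] := algebraicIndependent_pair hx₁ hju
  let M := IntermediateField.adjoin ℂ {j x₁, u, t}
  have hM : ∀ z ∈ ({j x₁, u, t} : Set F), z ∈ M := fun z hz => IntermediateField.subset_adjoin _ _ hz
  have hX₁M : j x₁ ∈ M := hM _ (by simp)
  have huM : u ∈ M := hM _ (by simp)
  have hX₂M : j₂ x₂ ∈ M := by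
    rw [hX₂]
    exact M.div_mem (M.add_mem (hM _ (by simp)) M.one_mem) (ofNat_mem M 2)
  have hY₂M : j₂ y₂ ^ 6 ∈ M := by
    rw [hY₂]
    exact M.mul_mem hX₂M (M.sub_mem hX₂M M.one_mem)
  have hgX₂ : g (j₂ x₂) = j₂ x₂ := by rw [hgj₂, hδx₂]
  have hgY₂ : g (j₂ y₂) = algebraMap ℂ F ξ * j₂ y₂ := by rw [hgj₂, hδy₂, map_smul, Algebra.smul_def]
  have hgY₁ : g (j y₁) = algebraMap ℂ F ξ * j y₁ := by rw [hgj, hδy₁, map_smul, Algebra.smul_def]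
  have hξ0 : algebraMap ℂ F ξ ≠ 0 := by simpa using hξ.ne_zero (by norm_num)
  have hgM : ∀ m ∈ M, g m = m := by
    let E : IntermediateField ℂ F := (AlgHom.equalizer g (AlgHom.id ℂ F)).toIntermediateField fun z hz => by
      change g z⁻¹ = z⁻¹
      rw [map_inv₀, show g z = z from hz]
    have : M ≤ E := by
      refine IntermediateField.adjoin_le_iff.2 ?_
      rintro z (rfl | rfl | rfl)
      · change g (j x₁) = j x₁
        rw [hgj, hδx₁]
      · change g u = u
        simp only [u]
        rw [map_div₀, map_mul, map_inv₀, hgY₁, hgY₂, show g (algebraMap ℂ F c) = _ from g.commutes c]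
        field_simp
      · change g t = t
        simp only [t, map_sub, map_mul, map_one, hgX₂, map_ofNat]
    exact fun m hm => this hm
  -- M(y₂) contains y₁ = c u y₂ and x₂, hence all of R; this is what allows the averaging argument
  -- for fixed points.
  let N : IntermediateField M F := IntermediateField.adjoin M {j₂ y₂}
  have hMN : ∀ z ∈ M, z ∈ N := fun z hz => N.algebraMap_mem ⟨z, hz⟩
  have hY₂N : j₂ y₂ ∈ N := IntermediateField.mem_adjoin_simple_self M _
  have hcN : ∀ a : ℂ, algebraMap ℂ F a ∈ N := fun a => hMN _ (M.algebraMap_mem a)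
  have hY₁N : j y₁ ∈ N := by
    have : j y₁ = algebraMap ℂ F c * u * j₂ y₂ := by simp only [u]; field_simp
    rw [this]
    exact N.mul_mem (N.mul_mem (hcN c) (hMN _ huM)) hY₂N
  have hadj : ∀ {B : Type} [CommRing B] [Algebra ℂ B] (i : B →ₐ[ℂ] F) (x y : B), Function.Injective i →
      i x ∈ N → i y ∈ N → (∀ b : B, ∃ d ∈ Algebra.adjoin ℂ {x, y}, d ≠ 0 ∧ d * b ∈ Algebra.adjoin ℂ {x, y}) →
      ∀ b, i b ∈ N := by
    intro B _ _ i x y hi hx hy h b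
    have h1 : Algebra.adjoin ℂ {x, y} ≤ (N.restrictScalars ℂ).toSubalgebra.comap i := by
      refine Algebra.adjoin_le ?_
      rintro z (rfl | rfl)
      · exact hx
      · exact hy
    obtain ⟨d, hd, hd0, hdb⟩ := h b
    have hid : i d ≠ 0 := fun h => hd0 (hi (h.trans (map_zero i).symm))
    have h2 : i b = i (d * b) / i d := by rw [map_mul, mul_div_cancel_left₀ _ hid]
    rw [h2]
    exact N.div_mem (h1 hdb) (h1 hd)
  have hRN : ∀ r : R, iR r ∈ N := by
    have h1 : (⊤ : Subalgebra ℂ R) ≤ (N.restrictScalars ℂ).toSubalgebra.comap iR := by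
      rw [← hR, sup_le_iff]
      constructor
      · rintro _ ⟨b, rfl⟩
        change iR (i₁ b) ∈ N
        rw [← hji]
        exact hadj j x₁ y₁ hj (hMN _ hX₁M) hY₁N hg₁ b
      · rintro _ ⟨b, rfl⟩
        exact hadj j₂ x₂ y₂ hj₂ (hMN _ hX₂M) hY₂N hg₂ b
    exact fun r => h1 trivial
  refine ⟨u, t, hind, ht, fun r hr => ?_, fun z hz => ?_⟩
  · exact mem_of_fixed M g hgM (by norm_num) hξ hgY₂ hY₂M (hRN r) ((hg _).trans (congrArg iR hr))
  · let ι : fixedSubalgebra γ →ₐ[ℂ] F := iR.comp (fixedSubalgebra γ).val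
    obtain ⟨b, ⟨b, rfl⟩, hb0, ⟨a, ha⟩⟩ := hasFractions_adjoin ι.range (S := {j x₁, u, t}) (by
      rintro z (rfl | rfl | rfl)
      · refine ⟨1, one_mem _, one_ne_zero, ⟨⟨i₁ x₁, ?_⟩, ?_⟩⟩
        · exact (hγ₁ x₁).trans (by rw [hδx₁]; rfl)
        · rw [one_mul]
          exact (hji x₁).symm
      -- Write u = c⁻¹ y₁y₂⁵/y₂⁶: numerator and denominator are both multiplied by ξ⁶ = 1, so both
      -- are invariant.
      · refine ⟨j₂ y₂ ^ 6, ⟨⟨i₂ (y₂ ^ 6), ?_⟩, map_pow j₂ y₂ 6⟩, pow_ne_zero 6 hY₂0,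
          ⟨⟨c⁻¹ • (i₁ y₁ * i₂ (y₂ ^ 5)), ?_⟩, ?_⟩⟩
        · change γ (i₂ (y₂ ^ 6)) = i₂ (y₂ ^ 6)
          rw [hγ₂, map_pow, hδy₂, smul_pow, hξ.pow_eq_one, one_smul]
        · change γ (c⁻¹ • (i₁ y₁ * i₂ (y₂ ^ 5))) = c⁻¹ • (i₁ y₁ * i₂ (y₂ ^ 5))
          rw [map_smul, map_mul, hγ₂, show γ (i₁ y₁) = i₁ (δ₁ y₁) from hγ₁ y₁, map_pow, hδy₁, hδy₂, smul_pow,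
            map_smul, map_smul, smul_mul_smul_comm, ← pow_succ', hξ.pow_eq_one, one_smul]
        · change iR (c⁻¹ • (i₁ y₁ * i₂ (y₂ ^ 5))) = _
          rw [map_smul, map_mul, ← hji, show iR (i₂ (y₂ ^ 5)) = j₂ y₂ ^ 5 from map_pow j₂ y₂ 5, Algebra.smul_def,
            map_inv₀]
          simp only [u]
          field_simp
      · refine ⟨1, one_mem _, one_ne_zero, ⟨⟨i₂ (2 * x₂ - 1), ?_⟩, ?_⟩⟩
        · change γ (i₂ (2 * x₂ - 1)) = i₂ (2 * x₂ - 1)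
          rw [hγ₂, map_sub, map_mul, hδx₂, map_ofNat, map_one]
        · change j₂ (2 * x₂ - 1) = _
          rw [map_sub, map_mul, map_ofNat, map_one, one_mul]) hz
    exact ⟨a, b, a.2, b.2, hb0, ha.symm⟩

end Invariants

/-! ### Irreducibility of the Kummer polynomials. -/

section Irreducible

/-- If the hypersurface `p = 0` has a smooth point, then `Tⁿ - p` is irreducible. -/
lemma irreducible_X_pow_sub_C {m n : ℕ} (hn : 0 < n) {p : MvPolynomial (Fin m) ℂ} {a : Fin m → ℂ}
    (h0 : MvPolynomial.eval a p = 0) {i : Fin m} (h1 : MvPolynomial.eval a (MvPolynomial.pderiv i p) ≠ 0) :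
    Irreducible (Polynomial.X ^ n - Polynomial.C (algebraMap _ (RatField m) p)) := by
  let P := RingHom.ker (MvPolynomial.eval a)
  have hP : P.IsPrime := RingHom.ker_isPrime _
  -- By the Leibniz rule all first derivatives of an element of P² vanish at a. So p lies in P but
  -- not in P², and the polynomial is Eisenstein at P.
  have hp2 : p ∉ P ^ 2 := by
    intro hp
    refine h1 ?_
    rw [pow_two] at hp
    refine Submodule.mul_induction_on hp (fun f hf g hg => ?_) (fun f g hf hg => ?_)
    · have hf : MvPolynomial.eval a f = 0 := hf
      have hg : MvPolynomial.eval a g = 0 := hg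
      simp [Derivation.leibniz, hf, hg]
    · rw [map_add, map_add, hf, hg, add_zero]
  have hmon : (Polynomial.X ^ n - Polynomial.C p).Monic := Polynomial.monic_X_pow_sub_C p hn.ne'
  have hdeg : (Polynomial.X ^ n - Polynomial.C p).natDegree = n := Polynomial.natDegree_X_pow_sub_C
  have hE : (Polynomial.X ^ n - Polynomial.C p).IsEisensteinAt P := by
    refine hmon.isEisensteinAt_of_mem_of_notMem hP.ne_top (fun {k} hk => ?_) ?_
    · rw [hdeg] at hk
      rw [Polynomial.coeff_sub, Polynomial.coeff_X_pow, if_neg hk.ne, zero_sub, Polynomial.coeff_C]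
      split_ifs
      · exact P.neg_mem h0
      · simp
    · rw [Polynomial.coeff_sub, Polynomial.coeff_X_pow, if_neg hn.ne, zero_sub, Polynomial.coeff_C_zero]
      rwa [neg_mem_iff]
  have hirr := hE.irreducible hP hmon.isPrimitive (by rw [hdeg]; exact hn)
  rw [hmon.irreducible_iff_irreducible_map_fraction_map (K := RatField m)] at hirr
  simpa using hirr

/-- The polynomial `σ(1, T)` of a binary form `σ`. -/
def dehomogenize (σ : MvPolynomial (Fin 2) ℂ) : Polynomial ℂ :=
  MvPolynomial.aeval ![1, Polynomial.X] σ

lemma aeval_dehomogenize {A : Type} [CommRing A] [Algebra ℂ A] (σ : MvPolynomial (Fin 2) ℂ) (x : A) :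
    Polynomial.aeval x (dehomogenize σ) = MvPolynomial.aeval ![1, x] σ := by
  rw [dehomogenize, ← AlgHom.comp_apply, MvPolynomial.comp_aeval]
  congr 2
  funext i
  fin_cases i <;> simp

lemma dehomogenize_eq (σ : MvPolynomial (Fin 2) ℂ) :
    dehomogenize σ = ∑ d ∈ σ.support, Polynomial.C (σ.coeff d) * Polynomial.X ^ d 1 := by
  rw [dehomogenize, MvPolynomial.aeval_def, MvPolynomial.eval₂_eq']
  refine Finset.sum_congr rfl fun d _ => ?_
  simp

lemma eval_eq_mul_eval_dehomogenize {σ : MvPolynomial (Fin 2) ℂ} {n : ℕ} (hσ : σ.IsHomogeneous n)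
    {v : Fin 2 → ℂ} (hv : v 0 ≠ 0) :
    MvPolynomial.eval v σ = v 0 ^ n * (dehomogenize σ).eval (v 1 / v 0) := by
  rw [dehomogenize_eq, MvPolynomial.eval_eq', Polynomial.eval_finsetSum, Finset.mul_sum]
  refine Finset.sum_congr rfl fun d hd => ?_
  have h := hσ.degree_eq_sum_deg_support hd
  rw [Finset.sum_subset (Finset.subset_univ _) (fun i _ hi => Finsupp.notMem_support_iff.1 hi), Fin.sum_univ_two] at h
  simp only [Fin.prod_univ_two, Polynomial.eval_mul, Polynomial.eval_C, Polynomial.eval_pow, Polynomial.eval_X,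
    h, pow_add, div_pow]
  field_simp

lemma natDegree_dehomogenize_le {σ : MvPolynomial (Fin 2) ℂ} {n : ℕ} (hσ : σ.IsHomogeneous n) :
    (dehomogenize σ).natDegree ≤ n := by
  rw [dehomogenize_eq]
  refine Polynomial.natDegree_sum_le_of_forall_le _ _ fun d hd => (Polynomial.natDegree_C_mul_X_pow_le _ _).trans ?_
  have h := hσ.degree_eq_sum_deg_support hd
  rw [Finset.sum_subset (Finset.subset_univ _) (fun i _ hi => Finsupp.notMem_support_iff.1 hi), Fin.sum_univ_two] at h
  omega

lemma dehomogenize_ne_zero {σ : MvPolynomial (Fin 2) ℂ} {n : ℕ} (hσ : σ.IsHomogeneous n) (hσ0 : σ ≠ 0) :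
    dehomogenize σ ≠ 0 := by
  intro h
  -- The dehomogenization controls σ only where the first coordinate is nonzero; the factor X₀ takes
  -- care of the remaining points.
  have : MvPolynomial.X 0 * σ = 0 := by
    refine MvPolynomial.funext fun v => ?_
    by_cases hv : v 0 = 0
    · simp [hv]
    · simp [eval_eq_mul_eval_dehomogenize hσ hv, h]
  simp [hσ0] at this

/-- A binary sextic with six distinct zeros has a simple zero outside the point at infinity. -/
lemma exists_simple_root {σ : MvPolynomial (Fin 2) ℂ} (hσ : σ.IsHomogeneous 6) (hσ0 : σ ≠ 0)
    (q : Fin 6 ↪ Projectivization ℂ (Fin 2 → ℂ)) (hq : ∀ i, MvPolynomial.eval (q i).rep σ = 0) :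
    ∃ a, (dehomogenize σ).eval a = 0 ∧ (Polynomial.derivative (dehomogenize σ)).eval a ≠ 0 := by
  classical
  by_contra! H
  set f := dehomogenize σ
  have hf0 : f ≠ 0 := dehomogenize_ne_zero hσ hσ0
  have hpq : ∀ i j, (q i).rep 0 * (q j).rep 1 = (q j).rep 0 * (q i).rep 1 → i = j := by
    intro i j hij
    refine q.injective ?_
    rw [← (q i).mk_rep, ← (q j).mk_rep, Projectivization.mk_eq_mk_iff']
    by_cases h0 : (q j).rep 0 = 0
    · have h1 : (q j).rep 1 ≠ 0 := fun h1 => (q j).rep_nonzero (by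
        funext k; fin_cases k <;> simp [h0, h1])
      refine ⟨(q i).rep 1 / (q j).rep 1, ?_⟩
      have h2 : (q i).rep 0 = 0 := by simpa [h0, h1] using hij
      funext k
      fin_cases k <;> simp [h0, h2, h1]
    · refine ⟨(q i).rep 0 / (q j).rep 0, ?_⟩
      funext k
      fin_cases k
      · simp [h0]
      · simp only [Fin.mk_one, Pi.smul_apply, smul_eq_mul]
        rw [div_mul_eq_mul_div, hij, mul_div_cancel_left₀ _ h0]
  let S := Finset.univ.filter fun i => (q i).rep 0 ≠ 0
  -- At most one of the six distinct points of ℙ¹ is the point at infinity.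
  have hS : 5 ≤ S.card := by
    have h1 : (Finset.univ.filter fun i => ¬ (q i).rep 0 ≠ 0).card ≤ 1 := by
      refine Finset.card_le_one.2 fun i hi j hj => hpq i j ?_
      simp only [ne_eq, not_not, Finset.mem_filter, Finset.mem_univ, true_and] at hi hj
      rw [hi, hj, zero_mul, zero_mul]
    have h2 := Finset.card_filter_add_card_filter_not (s := (Finset.univ : Finset (Fin 6)))
      (fun i => (q i).rep 0 ≠ 0)
    rw [Finset.card_univ, Fintype.card_fin] at h2
    change S.card + _ = 6 at h2
    omega
  let r : Fin 6 → ℂ := fun i => (q i).rep 1 / (q i).rep 0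
  have hr : Set.InjOn r S := by
    intro i hi j hj hij
    have hi : (q i).rep 0 ≠ 0 := (Finset.mem_filter.1 hi).2
    have hj : (q j).rep 0 ≠ 0 := (Finset.mem_filter.1 hj).2
    refine hpq i j ?_
    have := (div_eq_div_iff hi hj).1 hij
    linear_combination -this
  -- Without a simple zero each of the at least five finite zeros counts twice, which gives at least
  -- ten roots for a polynomial of degree at most six.
  have hroot : ∀ b ∈ S.image r, 2 ≤ f.roots.count b := by
    intro b hb
    obtain ⟨i, hi, rfl⟩ := Finset.mem_image.1 hb
    have hi : (q i).rep 0 ≠ 0 := (Finset.mem_filter.1 hi).2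
    have h0 : f.eval (r i) = 0 := by
      have := hq i
      rw [eval_eq_mul_eval_dehomogenize hσ hi] at this
      exact (mul_eq_zero.1 this).resolve_left (pow_ne_zero _ hi)
    rw [Polynomial.count_roots]
    exact (Polynomial.one_lt_rootMultiplicity_iff_isRoot hf0).2 ⟨h0, H _ h0⟩
  have h1 : ∑ b ∈ S.image r, 2 ≤ f.roots.card := by
    rw [← Multiset.toFinset_sum_count_eq]
    refine (Finset.sum_le_sum hroot).trans (Finset.sum_le_sum_of_subset fun b hb => ?_)
    rw [Multiset.mem_toFinset, ← Multiset.count_pos]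
    exact lt_of_lt_of_le (by norm_num) (hroot b hb)
  rw [Finset.sum_const, Finset.card_image_of_injOn hr, smul_eq_mul] at h1
  have h2 := f.card_roots'
  have h3 := natDegree_dehomogenize_le hσ
  change f.natDegree ≤ 6 at h3
  omega

lemma formValue_var {m : ℕ} (σ : MvPolynomial (Fin 2) ℂ) (i : Fin m) :
    formValue σ (var i) =
      algebraMap _ (RatField m) (Polynomial.aeval (MvPolynomial.X i : MvPolynomial (Fin m) ℂ) (dehomogenize σ)) := by
  rw [formValue, ← aeval_dehomogenize, var, Polynomial.aeval_algebraMap_apply]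

lemma eval_aeval_X {m : ℕ} (v : Fin m → ℂ) (i : Fin m) (f : Polynomial ℂ) :
    MvPolynomial.eval v (Polynomial.aeval (MvPolynomial.X i) f) = f.eval (v i) := by
  rw [Polynomial.aeval_def, Polynomial.hom_eval₂, MvPolynomial.eval_X, Polynomial.eval]
  congr 1
  ext c
  simp

lemma irreducible_curve {σ : MvPolynomial (Fin 2) ℂ} {a : ℂ} (h0 : (dehomogenize σ).eval a = 0)
    (h1 : (Polynomial.derivative (dehomogenize σ)).eval a ≠ 0) {n : ℕ} (hn : 0 < n) :
    Irreducible (Polynomial.X ^ n - Polynomial.C (formValue σ pVar)) := by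
  rw [pVar, formValue_var]
  refine irreducible_X_pow_sub_C hn (a := fun _ => a) (i := 0) ?_ ?_
  · rw [eval_aeval_X, h0]
  · simpa [Derivation.map_aeval, eval_aeval_X] using h1

lemma irreducible_curve' {n : ℕ} (hn : 0 < n) :
    Irreducible (Polynomial.X ^ n - Polynomial.C (pVar * (pVar - 1))) := by
  have := irreducible_X_pow_sub_C hn (p := MvPolynomial.X (0 : Fin 1) * (MvPolynomial.X 0 - 1))
    (a := 0) (i := 0) (by simp) (by simp [Derivation.leibniz])
  simpa [pVar, var] using this

lemma irreducible_doublePlane {σ : MvPolynomial (Fin 2) ℂ} {a : ℂ} (h0 : (dehomogenize σ).eval a = 0)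
    (h1 : (Polynomial.derivative (dehomogenize σ)).eval a ≠ 0) {n : ℕ} (hn : 0 < n) :
    Irreducible (Polynomial.X ^ n - Polynomial.C (var 1 ^ 6 - formValue σ (var 0) : RatField 2)) := by
  have := irreducible_X_pow_sub_C hn
    (p := MvPolynomial.X 1 ^ 6 - Polynomial.aeval (MvPolynomial.X (0 : Fin 2)) (dehomogenize σ))
    -- On the sextic y⁶ = f(x) the point (a, 0) is smooth: the derivative in x there is -f'(a).
    (a := ![a, 0]) (i := 0) (by simp [eval_aeval_X, h0]) (by
      simpa [Derivation.map_aeval, Derivation.leibniz_pow, eval_aeval_X] using h1)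
  rw [formValue_var]
  simpa [var] using this

lemma muField_formValue (σ : MvPolynomial (Fin 2) ℂ) : muField (formValue σ xVar) = formValue σ xVar := by
  rw [formValue, ← aeval_dehomogenize, ← Polynomial.aeval_algHom_apply, muField_xVar]

lemma muField_sectionRatio (σ : MvPolynomial (Fin 2) ℂ) :
    muField (sectionRatio σ) = (uVar ^ 6 - formValue σ xVar) / uVar ^ 6 := by
  rw [sectionRatio, map_div₀, map_sub, muField_formValue, muField_uVar]

/-- The denominator u⁶ is the square of u³, so a square root of the ratio would give one of u⁶ -
f(x), contradicting the irreducibility for the double plane. -/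
lemma irreducible_surfaceY {σ : MvPolynomial (Fin 2) ℂ} {a : ℂ} (h0 : (dehomogenize σ).eval a = 0)
    (h1 : (Polynomial.derivative (dehomogenize σ)).eval a ≠ 0) :
    Irreducible (Polynomial.X ^ 2 - Polynomial.C (muField (sectionRatio σ))) := by
  have h := irreducible_doublePlane h0 h1 (n := 2) (by norm_num)
  have hu : uVar ≠ 0 := var_ne_zero 1
  rw [X_pow_sub_C_irreducible_iff_of_prime Nat.prime_two] at h ⊢
  intro b hb
  rw [muField_sectionRatio] at hb
  refine h (b * uVar ^ 3) ?_
  rw [mul_pow, hb, ← pow_mul, div_mul_cancel₀ _ (pow_ne_zero _ hu)]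
  rfl

end Irreducible

/-! ### Function fields of 𝒴 and of the double plane. -/

section KummerField

lemma algHom_mem_of_var {m : ℕ} {F : Type} [Field F] [Algebra ℂ F] (φ : RatField m →ₐ[ℂ] F)
    (E : IntermediateField ℂ F) (h : ∀ i, φ (var i) ∈ E) (a : RatField m) : φ a ∈ E := by
  have hp : ∀ p : MvPolynomial (Fin m) ℂ, φ (algebraMap _ _ p) ∈ E := fun p => by
    induction p using MvPolynomial.induction_on with
    | C c =>
      have : algebraMap (MvPolynomial (Fin m) ℂ) (RatField m) (MvPolynomial.C c) = algebraMap ℂ _ c :=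
        (IsScalarTower.algebraMap_apply ℂ (MvPolynomial (Fin m) ℂ) (RatField m) c).symm
      rw [this, AlgHom.commutes]
      exact E.algebraMap_mem c
    | add p q hp hq => rw [map_add, map_add]; exact add_mem hp hq
    | mul_X p i hp => rw [map_mul, map_mul]; exact mul_mem hp (h i)
  obtain ⟨p, q, -, rfl⟩ := IsFractionRing.div_surjective (A := MvPolynomial (Fin m) ℂ) a
  rw [map_div₀]
  exact div_mem (hp p) (hp q)

lemma exists_algHom_ratField {m : ℕ} {F : Type} [Field F] [Algebra ℂ F] {x : Fin m → F}
    (hx : AlgebraicIndependent ℂ x) : ∃ φ : RatField m →ₐ[ℂ] F, ∀ i, φ (var i) = x i := by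
  have hinj : Function.Injective (MvPolynomial.aeval x : _ →ₐ[ℂ] F) := hx
  refine ⟨IsFractionRing.liftAlgHom hinj, fun i => ?_⟩
  rw [var, IsFractionRing.liftAlgHom_apply, IsFractionRing.lift_algebraMap]
  simp

lemma root_pow {K : Type} [Field K] {n : ℕ} {h : K} : (AdjoinRoot.root (Polynomial.X ^ n - Polynomial.C h)) ^ n = algebraMap K (KummerField n h) h := by
  have := AdjoinRoot.eval₂_root (Polynomial.X ^ n - Polynomial.C h)
  rw [Polynomial.eval₂_sub, Polynomial.eval₂_pow, Polynomial.eval₂_X, Polynomial.eval₂_C] at this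
  exact sub_eq_zero.1 this

variable {K : Type} [Field K] [Algebra ℂ K] {n : ℕ} {h : K}

lemma algHom_mem_of_root {F : Type} [Field F] [Algebra ℂ F] (φ : KummerField n h →ₐ[ℂ] F)
    (E : IntermediateField ℂ F) (h₀ : ∀ a, φ (algebraMap K _ a) ∈ E) (h₁ : φ (AdjoinRoot.root _) ∈ E)
    (z : KummerField n h) : φ z ∈ E := by
  induction z using AdjoinRoot.induction_on with
  | ih p =>
    induction p using Polynomial.induction_on' with
    | add p q hp hq => rw [map_add, map_add]; exact add_mem hp hq
    | monomial k a =>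
      rw [← Polynomial.C_mul_X_pow_eq_monomial, map_mul, map_pow, AdjoinRoot.mk_C, AdjoinRoot.mk_X, map_mul, map_pow]
      exact mul_mem (h₀ a) (pow_mem h₁ k)

lemma exists_algHom_kummerField {F : Type} [Field F] [Algebra ℂ F] (φ₀ : K →ₐ[ℂ] F) {t : F}
    (ht : t ^ n = φ₀ h) : ∃ φ : KummerField n h →ₐ[ℂ] F,
      (∀ a, φ (algebraMap K _ a) = φ₀ a) ∧ φ (AdjoinRoot.root _) = t :=
  ⟨AdjoinRoot.liftAlgHom _ φ₀ t (by simp [ht]), fun a => AdjoinRoot.liftAlgHom_of .., AdjoinRoot.liftAlgHom_root ..⟩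

lemma map_formValue {F : Type} [Field F] [Algebra ℂ F] (φ : K →ₐ[ℂ] F) (σ : MvPolynomial (Fin 2) ℂ) (x : K) :
    φ (formValue σ x) = formValue σ (φ x) := by
  rw [formValue, formValue, ← aeval_dehomogenize, ← aeval_dehomogenize, Polynomial.aeval_algHom_apply]

/-- The universal property of the function field of `𝒴`. -/
lemma exists_algHom_surfaceY (σ : MvPolynomial (Fin 2) ℂ)
    [Fact (Irreducible (Polynomial.X ^ 2 - Polynomial.C (muField (sectionRatio σ))))]
    {F : Type} [Field F] [Algebra ℂ F] {x u t : F} (hxu : AlgebraicIndependent ℂ ![x, u])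
    (ht : t ^ 2 = (u ^ 6 - formValue σ x) / u ^ 6) :
    ∃ φ : KummerField 2 (muField (sectionRatio σ)) →ₐ[ℂ] F,
      φ.fieldRange = IntermediateField.adjoin ℂ {x, u, t} := by
  obtain ⟨φ₀, hφ₀⟩ := exists_algHom_ratField hxu
  have hx : φ₀ xVar = x := hφ₀ 0
  have hu : φ₀ uVar = u := hφ₀ 1
  obtain ⟨φ, h1, h2⟩ := exists_algHom_kummerField (n := 2) (h := muField (sectionRatio σ)) φ₀ (t := t) (by
    rw [ht, muField_sectionRatio, map_div₀, map_sub, map_pow, map_formValue, hx, hu])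
  refine ⟨φ, le_antisymm ?_ (IntermediateField.adjoin_le_iff.2 ?_)⟩
  · rintro _ ⟨z, rfl⟩
    refine algHom_mem_of_root φ _ (fun a => ?_) ?_ z
    · rw [h1]
      refine algHom_mem_of_var φ₀ _ (fun i => ?_) a
      rw [hφ₀]
      fin_cases i
      · exact IntermediateField.subset_adjoin _ _ (by simp)
      · exact IntermediateField.subset_adjoin _ _ (by simp)
    · rw [h2]
      exact IntermediateField.subset_adjoin _ _ (by simp)
  · rintro z (rfl | rfl | rfl)
    · exact ⟨algebraMap _ _ xVar, (h1 _).trans hx⟩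
    · exact ⟨algebraMap _ _ uVar, (h1 _).trans hu⟩
    · exact ⟨_, h2⟩

lemma algebraicIndependent_var (m : ℕ) : AlgebraicIndependent ℂ (var : Fin m → RatField m) :=
  (MvPolynomial.algebraicIndependent_X (Fin m) ℂ).map' (f := IsScalarTower.toAlgHom ℂ _ (RatField m))
    (IsFractionRing.injective _ _)

/-- The function fields of `𝒴` and of the double plane are isomorphic. -/
lemma exists_algEquiv_doublePlane (σ : MvPolynomial (Fin 2) ℂ)
    [Fact (Irreducible (Polynomial.X ^ 2 - Polynomial.C (muField (sectionRatio σ))))]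
    [Fact (Irreducible (Polynomial.X ^ 2 - Polynomial.C (var 1 ^ 6 - formValue σ (var 0) : RatField 2)))] :
    Nonempty (KummerField 2 (muField (sectionRatio σ)) ≃ₐ[ℂ]
      KummerField 2 (var 1 ^ 6 - formValue σ (var 0) : RatField 2)) := by
  set F := KummerField 2 (var 1 ^ 6 - formValue σ (var 0) : RatField 2)
  let i : RatField 2 →ₐ[ℂ] F := IsScalarTower.toAlgHom ℂ _ F
  let r : F := AdjoinRoot.root _
  have hr : r ^ 2 = i (var 1) ^ 6 - formValue σ (i (var 0)) :=
    root_pow.trans ((map_sub i _ _).trans (congrArg₂ _ (map_pow i _ _) (map_formValue i σ _)))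
  have hu : i (var 1) ≠ 0 := (map_ne_zero i).2 (var_ne_zero 1)
  have hxu : AlgebraicIndependent ℂ ![i (var 0), i (var 1)] := by
    have := (algebraicIndependent_var 2).map' (f := i) i.injective
    convert this using 1
    funext k
    fin_cases k <;> rfl
  -- Dividing r² = u⁶ - f(x) by u⁶ shows that t = r/u³ satisfies the equation of 𝒴.
  obtain ⟨φ, hφ⟩ := exists_algHom_surfaceY σ hxu (t := r / i (var 1) ^ 3) (by
    rw [div_pow, hr, ← pow_mul])
  refine ⟨AlgEquiv.ofBijective φ ⟨φ.injective, fun z => ?_⟩⟩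
  change z ∈ φ.fieldRange
  refine algHom_mem_of_root (AlgHom.id ℂ F) _ (fun a => algHom_mem_of_var i _ (fun k => ?_) a) ?_ z
  · rw [hφ]
    fin_cases k
    · exact IntermediateField.subset_adjoin _ _ (by simp)
    · exact IntermediateField.subset_adjoin _ _ (by simp)
  · rw [hφ]
    have h1 : r / i (var 1) ^ 3 ∈ IntermediateField.adjoin ℂ {i (var 0), i (var 1), r / i (var 1) ^ 3} :=
      IntermediateField.subset_adjoin _ _ (by simp)
    have h2 : i (var 1) ∈ IntermediateField.adjoin ℂ {i (var 0), i (var 1), r / i (var 1) ^ 3} :=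
      IntermediateField.subset_adjoin _ _ (by simp)
    have := mul_mem h1 (pow_mem h2 3)
    rwa [div_mul_cancel₀ _ (pow_ne_zero 3 hu)] at this

lemma HasModel.of_algEquiv {X : LocallyRingedSpace.{0}} {s : X ⟶ (Spec (.of ℂ)).toLocallyRingedSpace}
    {L L' : Type} [Field L] [Field L'] [Algebra ℂ L] [Algebra ℂ L'] (H : HasModel s L) (e : L ≃ₐ[ℂ] L') :
    HasModel s L' := by
  obtain ⟨B, κ, hB, hfr, hκ, hd, hs⟩ := H
  have := B.fg_iff_finiteType.1 hB
  refine hasModel_of_algHom ((e : L →ₐ[ℂ] L').comp B.val) (e.injective.comp Subtype.val_injective)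
    (fun z => ?_) κ hd hs
  obtain ⟨b, hb, hb0, hbz⟩ := hfr (e.symm z)
  refine ⟨⟨_, hbz⟩, ⟨b, hb⟩, ?_, ?_⟩
  · exact (map_ne_zero e).2 hb0
  · change e b * z = e (b * e.symm z)
    rw [map_mul, e.apply_symm_apply]

end KummerField

/-! ### Covering transformations and coordinates of the affine curves. -/

section Deck

lemma deckField_root {K : Type} [Field K] {n : ℕ} (h ξ : K) (hξ : ξ ^ n = 1) :
    deckField h ξ hξ (AdjoinRoot.root _) =
      algebraMap K _ ξ * AdjoinRoot.root (Polynomial.X ^ n - Polynomial.C h) := by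
  rw [deckField, AdjoinRoot.liftAlgHom_root]

lemma deckField_pow {K : Type} [Field K] {n : ℕ} (h ξ : K) (hξ : ξ ^ n = 1) : deckField h ξ hξ ^ n = 1 := by
  have key : ∀ k : ℕ, (deckField h ξ hξ ^ k) (AdjoinRoot.root _) =
      algebraMap K _ (ξ ^ k) * AdjoinRoot.root (Polynomial.X ^ n - Polynomial.C h) := by
    intro k
    induction k with
    | zero => simp
    | succ k ih =>
      rw [pow_succ', AlgHom.mul_apply, ih, map_mul, AlgHom.commutes, deckField_root, ← mul_assoc, ← map_mul,
        pow_succ]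
  refine AdjoinRoot.algHom_ext ?_
  rw [key, hξ, map_one, one_mul, AlgHom.one_apply]

variable {n : ℕ} (h : RatField 1)

lemma curveDeck_root (ξ : ℂ) (hξ : ξ ^ n = 1) :
    curveDeck h ξ hξ (AdjoinRoot.root _) = ξ • AdjoinRoot.root (Polynomial.X ^ n - Polynomial.C h) := by
  refine (deckField_root h (algebraMap ℂ _ ξ) (by rw [← map_pow, hξ, map_one])).trans ?_
  rw [Algebra.smul_def]
  rfl

lemma curveRingDeck_pow {ξ : ℂ} (hξ : ξ ^ n = 1) : curveRingDeck h ξ hξ ^ n = 1 := by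
  have hξ' : algebraMap ℂ (RatField 1) ξ ^ n = 1 := by rw [← map_pow, hξ, map_one]
  have key : ∀ (k : ℕ) (b : curveRing n h), ((curveRingDeck h ξ hξ ^ k) b : KummerField n h) =
      (deckField h (algebraMap ℂ _ ξ) hξ' ^ k) b := by
    intro k b
    induction k with
    | zero => rfl
    | succ k ih =>
      rw [pow_succ', pow_succ', AlgHom.mul_apply, AlgHom.mul_apply, ← ih]
      rfl
  refine AlgHom.ext fun b => Subtype.ext ?_
  rw [key, deckField_pow]
  rfl

end Deck

section Curve

lemma exists_mul_mem_adjoin {L : Type} [Field L] [Algebra ℂ L] {B : Subalgebra ℂ L} {S : Set B}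
    (hS : ∀ z : L, z ∈ IntermediateField.adjoin ℂ (B.val '' S)) (b : B) :
    ∃ d ∈ Algebra.adjoin ℂ S, d ≠ 0 ∧ d * b ∈ Algebra.adjoin ℂ S := by
  obtain ⟨r, hr, s, hs, h⟩ := (IntermediateField.mem_adjoin_iff_div ..).1 (hS b)
  rw [← AlgHom.map_adjoin] at hr hs
  obtain ⟨r, hr, rfl⟩ := hr
  obtain ⟨s, hs, rfl⟩ := hs
  -- Division by zero gives 0, so a zero denominator in the chosen fraction forces b = 0.
  by_cases h0 : s = 0
  · have : b = 0 := Subtype.ext (by simpa [h0] using h)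
    exact ⟨1, one_mem _, one_ne_zero, by rw [this, mul_zero]; exact zero_mem _⟩
  · refine ⟨s, hs, h0, ?_⟩
    have h0' : (s : L) ≠ 0 := fun h => h0 (Subtype.ext h)
    have : s * b = r := Subtype.ext (by
      change (s : L) * b = r
      rw [h]
      exact mul_div_cancel₀ _ h0')
    rwa [this]

variable {n : ℕ} {h : RatField 1} [Fact (Irreducible (Polynomial.X ^ n - Polynomial.C h))]

lemma finiteType_curveRing (hn : 0 < n) : Algebra.FiniteType ℂ (curveRing n h) := by
  have := finiteDimensional_kummerField h hn
  have e := projAtlas_ring_default 1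
  have h1 : IsIntegrallyClosed ((projAtlas 1).ring {default}) := by rw [e]; infer_instance
  have h2 : Algebra.FiniteType ℂ ((projAtlas 1).ring {default}) := by rw [e]; infer_instance
  have h3 : IsFractionRing ((projAtlas 1).ring {default}) (RatField 1) := by rw [e]; infer_instance
  exact (Subalgebra.fg_iff_finiteType _).1 (fg_intClosure (RatField 1))

/-- The coordinate functions of the affine curve `yⁿ = f(x)`. -/
lemma exists_curve_coordinates {f : Polynomial ℂ} (hf : h = Polynomial.aeval pVar f) (hf0 : f ≠ 0) (hn : 0 < n)
    {ξ : ℂ} (hξ : ξ ^ n = 1) : ∃ x y : curveRing n h, Transcendental ℂ x ∧ y ≠ 0 ∧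
      y ^ n = Polynomial.aeval x f ∧ curveRingDeck h ξ hξ x = x ∧ curveRingDeck h ξ hξ y = ξ • y ∧
      ∀ b, ∃ d ∈ Algebra.adjoin ℂ {x, y}, d ≠ 0 ∧ d * b ∈ Algebra.adjoin ℂ {x, y} := by
  have hp : pVar ∈ (projAtlas 1).ring {default} := by
    rw [projAtlas_ring_default, polyAlg_eq_adjoin]
    exact Algebra.subset_adjoin ⟨0, rfl⟩
  let i : RatField 1 →ₐ[ℂ] KummerField n h := IsScalarTower.toAlgHom ℂ _ _
  let x : curveRing n h := ⟨i pVar, mem_intClosure.2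
    (isIntegral_algebraMap (R := (projAtlas 1).ring {default}) (x := ⟨pVar, hp⟩))⟩
  have hfx : i h = Polynomial.aeval (i pVar) f := by
    rw [Polynomial.aeval_algHom_apply]
    exact congrArg i hf
  have hxf : ((Polynomial.aeval x f : curveRing n h) : KummerField n h) = Polynomial.aeval (i pVar) f :=
    (Polynomial.aeval_algHom_apply (curveRing n h).val x f).symm
  let r : KummerField n h := AdjoinRoot.root _
  have hr : r ^ n = i h := root_pow
  have hrint : r ∈ curveRing n h := by
    refine mem_intClosure.2 (IsIntegral.of_pow hn ?_)
    rw [hr, hfx, ← hxf]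
    exact mem_intClosure.1 (Polynomial.aeval x f).2
  let y : curveRing n h := ⟨r, hrint⟩
  have hy : y ^ n = Polynomial.aeval x f := Subtype.ext (by rw [hxf, ← hfx, ← hr]; rfl)
  have hx : Transcendental ℂ x := by
    have h1 : Transcendental ℂ (pVar : RatField 1) := (algebraicIndependent_var 1).transcendental 0
    intro hx
    exact h1 ((isAlgebraic_algHom_iff i i.injective).1 (hx.algHom (curveRing n h).val))
  refine ⟨x, y, hx, fun h0 => ?_, hy, Subtype.ext (curveDeck_algebraMap h ξ hξ pVar),
    Subtype.ext (curveDeck_root h ξ hξ), exists_mul_mem_adjoin fun z => ?_⟩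
  · rw [h0, zero_pow hn.ne'] at hy
    exact hf0 (transcendental_iff.1 hx f hy.symm)
  · refine algHom_mem_of_root (AlgHom.id ℂ _) _ (fun a => algHom_mem_of_var i _ (fun k => ?_) a) ?_ z
    · rw [Subsingleton.elim k 0]
      exact IntermediateField.subset_adjoin _ _ ⟨x, by simp, rfl⟩
    · exact IntermediateField.subset_adjoin _ _ ⟨y, by simp, rfl⟩

end Curve

/-! ### The invariant ring inside the function field of 𝒴. -/

section Embedding

lemma map_pow_eq_one {B₁ B₂ : Type} [CommRing B₁] [CommRing B₂] [Algebra ℂ B₁] [Algebra ℂ B₂]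
    {δ₁ : B₁ →ₐ[ℂ] B₁} {δ₂ : B₂ →ₐ[ℂ] B₂} {n : ℕ} (h₁ : δ₁ ^ n = 1) (h₂ : δ₂ ^ n = 1) :
    Algebra.TensorProduct.map δ₁ δ₂ ^ n = 1 := by
  have key : ∀ k : ℕ, Algebra.TensorProduct.map δ₁ δ₂ ^ k = Algebra.TensorProduct.map (δ₁ ^ k) (δ₂ ^ k) := by
    intro k
    induction k with
    | zero => exact Algebra.TensorProduct.map_id.symm
    | succ k ih =>
      rw [pow_succ', ih, pow_succ', pow_succ']
      exact (Algebra.TensorProduct.map_comp _ _ _ _).symm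
  rw [key, h₁, h₂]
  exact Algebra.TensorProduct.map_id

/-- The ring of invariants in `B₁ ⊗ B₂` embeds into a field with the universal property of the
function field of `𝒴`, with the same fractions. -/
lemma exists_algHom_fixedSubalgebra {B₁ B₂ L : Type} [CommRing B₁] [CommRing B₂] [IsDomain B₁] [IsDomain B₂]
    [Algebra ℂ B₁] [Algebra ℂ B₂] [Algebra.FiniteType ℂ B₁] [Field L] [Algebra ℂ L] {f : Polynomial ℂ}
    (hL : ∀ (F : Type) [Field F] [Algebra ℂ F] (x u t : F), AlgebraicIndependent ℂ ![x, u] →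
      t ^ 2 = (u ^ 6 - Polynomial.aeval x f) / u ^ 6 →
      ∃ φ : L →ₐ[ℂ] F, φ.fieldRange = IntermediateField.adjoin ℂ {x, u, t})
    {x₁ y₁ : B₁} {x₂ y₂ : B₂} {δ₁ : B₁ →ₐ[ℂ] B₁} {δ₂ : B₂ →ₐ[ℂ] B₂} {ξ : ℂ} (hξ : IsPrimitiveRoot ξ 6)
    (hγ : Algebra.TensorProduct.map δ₁ δ₂ ^ 6 = 1)
    (hx₁ : Transcendental ℂ x₁) (hx₂ : Transcendental ℂ x₂)
    (hδx₁ : δ₁ x₁ = x₁) (hδy₁ : δ₁ y₁ = ξ • y₁) (hδx₂ : δ₂ x₂ = x₂) (hδy₂ : δ₂ y₂ = ξ • y₂) (hy₁0 : y₁ ≠ 0)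
    (hy₁ : y₁ ^ 6 = Polynomial.aeval x₁ f) (hy₂ : y₂ ^ 6 = x₂ * (x₂ - 1))
    (hg₁ : ∀ b : B₁, ∃ d ∈ Algebra.adjoin ℂ {x₁, y₁}, d ≠ 0 ∧ d * b ∈ Algebra.adjoin ℂ {x₁, y₁})
    (hg₂ : ∀ b : B₂, ∃ d ∈ Algebra.adjoin ℂ {x₂, y₂}, d ≠ 0 ∧ d * b ∈ Algebra.adjoin ℂ {x₂, y₂}) :
    ∃ ψ : fixedSubalgebra (Algebra.TensorProduct.map δ₁ δ₂) →ₐ[ℂ] L, Function.Injective ψ ∧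
      ∀ z, ∃ a b, ψ b ≠ 0 ∧ ψ b * z = ψ a := by
  have : IsDomain (B₁ ⊗[ℂ] B₂) := isDomain_tensorProduct
  set γ := Algebra.TensorProduct.map δ₁ δ₂
  let R := B₁ ⊗[ℂ] B₂
  let F := FractionRing R
  have hfaith : FaithfulSMul B₁ R := (faithfulSMul_iff_algebraMap_injective _ _).2
    (Algebra.TensorProduct.includeLeft_injective (S := ℂ) (algebraMap ℂ B₂).injective)
  obtain ⟨u, t, hxu, ht, h1, h2⟩ := exists_invariant_field (R := R) (F := F) hξ hγ
    (Algebra.TensorProduct.includeRight : B₂ →ₐ[ℂ] R)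
    (Algebra.TensorProduct.includeRight_injective (algebraMap ℂ B₁).injective)
    (by
      rw [eq_top_iff, ← Algebra.TensorProduct.adjoin_tmul_eq_top ℂ B₁ B₂]
      refine Algebra.adjoin_le ?_
      rintro _ ⟨b₁, b₂, rfl⟩
      rw [← mul_one b₁, ← one_mul b₂, ← Algebra.TensorProduct.tmul_mul_tmul]
      exact mul_mem (Algebra.mem_sup_left ⟨b₁, rfl⟩) (Algebra.mem_sup_right ⟨b₂, rfl⟩)) (fun b => by simp [γ, R]) (fun b => by simp [γ, R]) hx₁ hx₂ (transcendental_one_tmul hx₂) hδx₁ hδy₁ hδx₂ hδy₂ hy₁0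
    hy₁ hy₂ hg₁ hg₂
  -- The universal property of L realizes L as the field generated by x₁, u and t, which contains
  -- the invariants and consists of their quotients. Inverting φ on its range then embeds the
  -- invariants in L.
  obtain ⟨φ, hφ⟩ := hL F _ u t hxu (by rw [ht, Polynomial.aeval_algebraMap_apply])
  let ρ : fixedSubalgebra γ →ₐ[ℂ] φ.fieldRange :=
    ((IsScalarTower.toAlgHom ℂ R F).comp (fixedSubalgebra γ).val).codRestrict φ.fieldRange.toSubalgebra
      fun r => hφ ▸ h1 r r.2
  have hρ : Function.Injective ρ := fun r r' h =>
    Subtype.ext (IsFractionRing.injective R F (congrArg Subtype.val h))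
  let e : L ≃ₐ[ℂ] φ.fieldRange := AlgEquiv.ofInjectiveField φ
  refine ⟨(e.symm : φ.fieldRange →ₐ[ℂ] L).comp ρ, e.symm.injective.comp hρ, fun z => ?_⟩
  obtain ⟨a, b, ha, hb, hb0, hab⟩ := h2 (φ z) (hφ ▸ ⟨z, rfl⟩)
  refine ⟨⟨a, ha⟩, ⟨b, hb⟩, fun h0 => hb0 ?_, e.injective ?_⟩
  · exact congrArg Subtype.val (e.symm.map_eq_zero_iff.1 h0)
  · change e (e.symm (ρ ⟨b, hb⟩) * z) = e (e.symm (ρ ⟨a, ha⟩))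
    rw [map_mul, e.apply_symm_apply, e.apply_symm_apply]
    exact Subtype.ext hab

end Embedding

/-! ### Models of the three surfaces. -/

section Models

lemma finiteType_fixedSubalgebra_map {B₁ B₂ : Type} [CommRing B₁] [CommRing B₂] [Algebra ℂ B₁] [Algebra ℂ B₂]
    [Algebra.FiniteType ℂ B₁] [Algebra.FiniteType ℂ B₂] {δ₁ : B₁ →ₐ[ℂ] B₁} {δ₂ : B₂ →ₐ[ℂ] B₂} {n : ℕ}
    (hn : 0 < n) (hγ : Algebra.TensorProduct.map δ₁ δ₂ ^ n = 1) :
    Algebra.FiniteType ℂ (fixedSubalgebra (Algebra.TensorProduct.map δ₁ δ₂)) :=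
  have : Algebra.FiniteType ℂ (B₁ ⊗[ℂ] B₂) := Algebra.FiniteType.trans (S := B₁) inferInstance inferInstance
  finiteType_fixedSubalgebra _ hn hγ

variable {σ : MvPolynomial (Fin 2) ℂ}

lemma hasModel_doublePlane
    [Fact (Irreducible (Polynomial.X ^ 2 - Polynomial.C (var 1 ^ 6 - formValue σ (var 0) : RatField 2)))] :
    HasModel (doublePlaneToSpec σ).toLRSHom (KummerField 2 (var 1 ^ 6 - formValue σ (var 0) : RatField 2)) := by
  have e := projAtlas_ring_default 2
  have : IsIntegrallyClosed ((projAtlas 2).ring {default}) := by rw [e]; infer_instance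
  have : Algebra.FiniteType ℂ ((projAtlas 2).ring {default}) := by rw [e]; infer_instance
  have : IsFractionRing ((projAtlas 2).ring {default}) (RatField 2) := by rw [e]; infer_instance
  exact hasModel_kummerCover (projAtlas 2) (by norm_num)

variable [Fact (Irreducible (Polynomial.X ^ 2 - Polynomial.C (muField (sectionRatio σ))))]

lemma hasModel_surfaceY :
    HasModel (surfaceYToSpec σ).toLRSHom (KummerField 2 (muField (sectionRatio σ))) := by
  have e := hirzebruch_ring_default 1
  have : IsIntegrallyClosed ((hirzebruch 1).ring {default}) := by rw [e]; infer_instance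
  have : Algebra.FiniteType ℂ ((hirzebruch 1).ring {default}) := by rw [e]; infer_instance
  have : IsFractionRing ((hirzebruch 1).ring {default}) (RatField 2) := by rw [e]; infer_instance
  exact hasModel_kummerCover (hirzebruch 1) (by norm_num)

lemma hasModel_quotProd (hσ : dehomogenize σ ≠ 0)
    [Fact (Irreducible (Polynomial.X ^ 6 - Polynomial.C (formValue σ pVar)))]
    [Fact (Irreducible (Polynomial.X ^ 6 - Polynomial.C (pVar * (pVar - 1))))]
    {ξ : ℂ} (hξ : IsPrimitiveRoot ξ 6) :
    HasModel (quotProdToSpec (formValue σ pVar) (pVar * (pVar - 1)) ξ hξ.pow_eq_one)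
      (KummerField 2 (muField (sectionRatio σ))) := by
  set h₁ := formValue σ pVar
  set h₂ := pVar * (pVar - 1)
  have hγ := map_pow_eq_one (curveRingDeck_pow h₁ hξ.pow_eq_one) (curveRingDeck_pow h₂ hξ.pow_eq_one)
  have := finiteType_curveRing (h := h₁) (n := 6) (by norm_num)
  have := finiteType_curveRing (h := h₂) (n := 6) (by norm_num)
  obtain ⟨x₁, y₁, hx₁, hy₁0, hy₁, hδx₁, hδy₁, hg₁⟩ := exists_curve_coordinates (h := h₁)
    (aeval_dehomogenize σ pVar).symm hσ (by norm_num) hξ.pow_eq_one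
  obtain ⟨x₂, y₂, hx₂, -, hy₂, hδx₂, hδy₂, hg₂⟩ := exists_curve_coordinates (h := h₂)
    (f := Polynomial.X * (Polynomial.X - 1)) (by simp [h₂])
    (mul_ne_zero Polynomial.X_ne_zero (Polynomial.X_sub_C_ne_zero (1 : ℂ))) (by norm_num) hξ.pow_eq_one
  obtain ⟨ψ, hψ, hfr⟩ := exists_algHom_fixedSubalgebra (L := KummerField 2 (muField (sectionRatio σ)))
    (f := dehomogenize σ)
    (fun F _ _ x u t hxu ht => exists_algHom_surfaceY σ hxu (by rw [ht, formValue, aeval_dehomogenize]))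
    hξ hγ hx₁ hx₂ hδx₁ hδy₁ hδx₂ hδy₂ hy₁0 hy₁ (by simpa using hy₂) hg₁ hg₂
  obtain ⟨j, hj, hd, hs⟩ := exists_quotProd_chart (h₁ := h₁) (h₂ := h₂) ξ hξ.pow_eq_one (by norm_num) hγ
  have := finiteType_fixedSubalgebra_map (by norm_num) hγ
  exact hasModel_of_algHom ψ hψ hfr j hd hs

end Models

end KummerSurface

end

theorem mainTheorem5 (σ : MvPolynomial (Fin 2) ℂ) (hσ : σ.IsHomogeneous 6) (hσ0 : σ ≠ 0)
    (q : Fin 6 ↪ Projectivization ℂ (Fin 2 → ℂ))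
    (hq : ∀ i, MvPolynomial.eval (q i).rep σ = 0)
    (ξ : ℂ) (hξ : IsPrimitiveRoot ξ 6) :
    KummerSurface.LRSBirationalOver
      (KummerSurface.surfaceYToSpec σ).toLRSHom
      (KummerSurface.quotProdToSpec
        (KummerSurface.formValue σ KummerSurface.pVar)
        (KummerSurface.pVar * (KummerSurface.pVar - 1)) ξ hξ.pow_eq_one) ∧
    Scheme.BirationalOver
      (KummerSurface.surfaceYToSpec σ) (KummerSurface.doublePlaneToSpec σ) := by
  -- A simple finite zero of σ makes the Kummer polynomials of 𝒴, of the double plane and of C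
  -- irreducible; the one of C' uses the simple zero x = 0 of x(x - 1).
  obtain ⟨a, h0, h1⟩ := KummerSurface.exists_simple_root hσ hσ0 q hq
  have : Fact (Irreducible (Polynomial.X ^ 2 -
      Polynomial.C (KummerSurface.muField (KummerSurface.sectionRatio σ)))) :=
    ⟨KummerSurface.irreducible_surfaceY h0 h1⟩
  have : Fact (Irreducible (Polynomial.X ^ 2 - Polynomial.C
      (KummerSurface.var 1 ^ 6 - KummerSurface.formValue σ (KummerSurface.var 0) : KummerSurface.RatField 2))) :=
    ⟨KummerSurface.irreducible_doublePlane h0 h1 (by norm_num)⟩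
  have : Fact (Irreducible (Polynomial.X ^ 6 -
      Polynomial.C (KummerSurface.formValue σ KummerSurface.pVar))) :=
    ⟨KummerSurface.irreducible_curve h0 h1 (by norm_num)⟩
  have : Fact (Irreducible (Polynomial.X ^ 6 -
      Polynomial.C (KummerSurface.pVar * (KummerSurface.pVar - 1)))) :=
    ⟨KummerSurface.irreducible_curve' (by norm_num)⟩
  obtain ⟨e⟩ := KummerSurface.exists_algEquiv_doublePlane σ
  have hY := KummerSurface.hasModel_surfaceY (σ := σ)
  exact ⟨hY.lrsBirationalOver
      (KummerSurface.hasModel_quotProd (KummerSurface.dehomogenize_ne_zero hσ hσ0) hξ),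
    hY.birationalOver (KummerSurface.hasModel_doublePlane.of_algEquiv e.symm)⟩
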